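/- **Setting.** Let $D_\theta\subset\mathbb R^p$ be open, let $D_\theta^*\subset D_\theta$ be compact and let $\theta^*\in\operatorname{int}D_\theta^*$. Let $Z=(Z_t)_{t\in\mathbb R}$ and $Z'=(Z'_t)_{t\in\mathbb R}$ be independent real Lévy processes ($Z_0=Z'_0=0$ a.s.) with the same characteristic triplet, whose Lévy measure is $\nu$ (the common noise parameter $\eta^*$ is known): $Z$ drives the observed system, $Z'$ is the simulated noise. Fix a sampling interval $\delta>0$ and put $\Delta Z_n=Z_{n\delta}-Z_{(n-1)\delta}$, and similarly $\Delta Z'_n$, $n\in\mathbb Z$. For a family of filters $A(\theta,q^{-1})=\sum_{l\ge0}h_l(\theta)q^{-l}$ ($q^{-1}$ is the backward shift) the observed series is $\Delta y_n=\sum_{l\ge0}h_l(\theta^*)\Delta Z_{n-l}$ and the simulated series is $\Delta y_n(\theta)=\sum_{l\ge0}h_l(\theta)\Delta Z'_{n-l}$. Fix a block length $r$, vectors $u_1,\dots,u_M\in\mathbb R^r$ and a Hermitian positive definite $M\times M$ matrix $K$. With the blocks $Y_n=(\Delta y_{n-1},\dots,\Delta y_{n-r})$ and $Y_n(\theta)=(\Delta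 y_{n-1}(\theta),\dots,\Delta y_{n-r}(\theta))$ define $$h_{k,n}(\theta)=e^{iu_k^TY_n}-e^{iu_k^TY_n(\theta)},\qquad \overline h_k(\theta)=\frac1N\sum_{n=r+1}^{N+r}h_{k,n}(\theta),\qquad V_N(\theta)=\|K^{-1/2}\overline h(\theta)\|^2,$$ $g(\theta)=\mathrm E[\overline h(\theta)]$ (which does not depend on $N$) and $W(\theta)=\|K^{-1/2}g(\theta)\|^2$. Subscripts $\theta$ and $\theta\theta$ denote the gradient and the Hessian. Let $\hat\theta_N$ be a random vector in $D_\theta^*$ that is the solution of $V_{\theta N}(\theta)=0$ in $D_\theta^*$: almost surely, whenever this equation has exactly one solution in $D_\theta^*$, $\hat\theta_N$ is this solution. **Theorem.** Assume that 1. $A(\theta,q^{-1})$ is for all $\theta\in D_\theta$ a stable rational function of $q^{-1}$ that is three times continuously differentiable in $\theta\in D_\theta$, in the sense that it has a state-space realization of finite order whose matrices are $C^3$ in $\theta\in D_\theta$ and whose state matrix has all its eigenvalues in the open unit disc (inverse stability is not assumed); 2. $\int_{|x|\ge1}|x|^q\,\nu(dx)<\infty$ for all $q\ge1$, and $\mathrm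 E[Z_t]=\mathrm E[Z'_t]=0$ for all $t$; 3. $\theta^*$ is the unique solution of $W_\theta(\theta)=0$ in $D_\theta$, and the Hessian $W_{\theta\theta}(\theta^*)$ is invertible. Then $$\hat\theta_N-\theta^*=-W_{\theta\theta}^{-1}(\theta^*)\,V_{\theta N}(\theta^*)+O_M(N^{-1}),$$ that is, for every $q\ge1$ there is a constant $C_q$ such that the difference $R_N$ of $\hat\theta_N-\theta^*$ and $-W_{\theta\theta}^{-1}(\theta^*)V_{\theta N}(\theta^*)$ satisfies $\mathrm E^{1/q}|R_N|^q\le C_qN^{-1}$ for all $N\ge1$. -/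

import Mathlib

open MeasureTheory ProbabilityTheory Filter Topology
open scoped ENNReal Matrix ComplexOrder

namespace ECF

noncomputable section

/-! ### Lévy processes -/

/-- `Z` is a real Lévy process indexed by the whole real line and tied to `0` at time `0`:
independent and stationary increments, and continuity in probability. -/
structure IsLevyProcess {Ω : Type*} [MeasurableSpace Ω] (P : Measure Ω)
    (Z : ℝ → Ω → ℝ) : Prop where
  measurable : ∀ t, Measurable (Z t)
  zero : ∀ᵐ ω ∂P, Z 0 ω = 0
  indep : HasIndepIncrements Z P
  stationary : ∀ s t, s ≤ t →
    IdentDistrib (fun ω => Z t ω - Z s ω) (Z (t - s)) P P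
  stochCont : ∀ t, TendstoInMeasure P Z (𝓝 t) (Z t)

/-- `ν` is a Lévy measure on the line. -/
structure IsLevyMeasure (ν : Measure ℝ) : Prop where
  zero : ν {0} = 0
  lintegral_lt_top : ∫⁻ x, ENNReal.ofReal (min 1 (x ^ 2)) ∂ν < ∞

/-- The characteristic exponent with drift `b`, Gaussian variance `c` and Lévy measure `ν`:
`ψ(u) = i b u - c u² / 2 + ∫ (e^{iux} - 1 - i u x 1_{|x| ≤ 1}) ν(dx)`. -/
def levyExponent (b c : ℝ) (ν : Measure ℝ) (u : ℝ) : ℂ :=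
  Complex.I * b * u - c * u ^ 2 / 2 +
    ∫ x, (Complex.exp (Complex.I * u * x) - 1
      - Complex.I * u * (if |x| ≤ 1 then (x : ℂ) else 0)) ∂ν

/-- The Lévy process `Z` has characteristic triplet `(b, c, ν)`:
`E[e^{iuZ_t}] = e^{tψ(u)}` for `t ≥ 0`. -/
structure HasLevyTriplet {Ω : Type*} [MeasurableSpace Ω] (P : Measure Ω)
    (Z : ℝ → Ω → ℝ) (b c : ℝ) (ν : Measure ℝ) : Prop where
  nonneg : 0 ≤ c
  levyMeasure : IsLevyMeasure ν
  charFun_eq : ∀ t : ℝ, 0 ≤ t → ∀ u : ℝ,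
    charFun (P.map (Z t)) u = Complex.exp (t * levyExponent b c ν u)

/-- The increment of `Z` over the `n`-th sampling interval, of length `δ`. -/
def increment {Ω : Type*} (Z : ℝ → Ω → ℝ) (δ : ℝ) (n : ℤ) (ω : Ω) : ℝ :=
  Z (n * δ) ω - Z ((n - 1) * δ) ω

/-! ### Linear filters -/

/-- The filter `A(θ, q⁻¹)`, given as a power series in the backward shift `q⁻¹`, is for all
`θ ∈ D` a stable rational function of `q⁻¹`, three times continuously differentiable in `θ`:
it has a state-space realization `A(θ, q⁻¹) = d(θ) + C(θ) (I - F(θ) q⁻¹)⁻¹ B(θ) q⁻¹` of finite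
order `s`, whose matrices are `C³` in `θ ∈ D` and whose state matrix `F(θ)` has all its
(complex) eigenvalues in the open unit disc. -/
def IsStableC3 {p : ℕ} (A : EuclideanSpace ℝ (Fin p) → PowerSeries ℝ)
    (D : Set (EuclideanSpace ℝ (Fin p))) : Prop :=
  ∃ (s : ℕ) (F : EuclideanSpace ℝ (Fin p) → Matrix (Fin s) (Fin s) ℝ)
    (B C : EuclideanSpace ℝ (Fin p) → Fin s → ℝ) (d : EuclideanSpace ℝ (Fin p) → ℝ),
    (∀ i j, ContDiffOn ℝ 3 (fun θ => F θ i j) D) ∧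
    (∀ i, ContDiffOn ℝ 3 (fun θ => B θ i) D) ∧
    (∀ i, ContDiffOn ℝ 3 (fun θ => C θ i) D) ∧
    ContDiffOn ℝ 3 d D ∧
    (∀ θ ∈ D, ∀ z ∈ spectrum ℂ ((F θ).map (algebraMap ℝ ℂ)), ‖z‖ < 1) ∧
    (∀ θ ∈ D, PowerSeries.coeff 0 (A θ) = d θ ∧
      ∀ l : ℕ, PowerSeries.coeff (l + 1) (A θ) = C θ ⬝ᵥ (F θ ^ l *ᵥ B θ))

/-- The output `(a(q⁻¹) e)_n = ∑_{l ≥ 0} a_l e_{n-l}` of the filter `a` with input `e`. -/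
def filterOutput (a : PowerSeries ℝ) (e : ℤ → ℝ) (n : ℤ) : ℝ :=
  ∑' l : ℕ, PowerSeries.coeff l a * e (n - l)

/-! ### Scores and cost functions -/

/-- `uᵀ Y_n` for the block `Y_n = (y_{n-1}, …, y_{n-r})`. -/
def blockProd {r : ℕ} (u : Fin r → ℝ) (y : ℤ → ℝ) (n : ℤ) : ℝ :=
  ∑ j : Fin r, u j * y (n - ((j : ℤ) + 1))

/-- The score `e^{i uᵀ Y_n} - e^{i uᵀ Y'_n}` built from observed data `y` and simulated data
`y'`. -/
def score {r : ℕ} (u : Fin r → ℝ) (y y' : ℤ → ℝ) (n : ℤ) : ℂ :=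
  Complex.exp (Complex.I * blockProd u y n) - Complex.exp (Complex.I * blockProd u y' n)

/-- The vector of averaged scores over the times `n = r + 1, …, N + r`. -/
def avgScore {r M : ℕ} (u : Fin M → Fin r → ℝ) (y y' : ℤ → ℝ) (N : ℕ) : Fin M → ℂ :=
  fun k => (1 / (N : ℂ)) * ∑ n ∈ Finset.Icc ((r : ℤ) + 1) ((N : ℤ) + r), score (u k) y y' n

/-- `‖K^{-1/2} x‖² = x* K⁻¹ x` for a positive definite Hermitian matrix `K`. -/
def weightedSq {M : ℕ} (K : Matrix (Fin M) (Fin M) ℂ) (x : Fin M → ℂ) : ℝ :=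
  (star x ⬝ᵥ (K⁻¹ *ᵥ x)).re

/-- If `S` is a Hermitian square root of `K⁻¹`, then `weightedSq K x` is the squared Euclidean
norm of `S x`. -/
theorem weightedSq_eq_norm_sq {M : ℕ} (K S : Matrix (Fin M) (Fin M) ℂ)
    (hS : S.IsHermitian) (hSK : S * S = K⁻¹) (x : Fin M → ℂ) :
    weightedSq K x = ‖WithLp.toLp 2 (S *ᵥ x)‖ ^ 2 := by
  have h1 : star x ⬝ᵥ (K⁻¹ *ᵥ x) = star (S *ᵥ x) ⬝ᵥ (S *ᵥ x) := by
    rw [← hSK, Matrix.star_mulVec, hS.eq, ← Matrix.dotProduct_mulVec, Matrix.mulVec_mulVec]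
  rw [weightedSq, h1, EuclideanSpace.norm_sq_eq]
  simp [dotProduct, ← Complex.normSq_eq_conj_mul_self, Complex.normSq_eq_norm_sq]
  norm_cast

variable {Ω : Type*} {p r M : ℕ}

/-- The family of time series `Δy_n(θ) = A(θ, q⁻¹) ΔZ_n`. -/
def series (A : EuclideanSpace ℝ (Fin p) → PowerSeries ℝ) (Z : ℝ → Ω → ℝ) (δ : ℝ)
    (θ : EuclideanSpace ℝ (Fin p)) (ω : Ω) : ℤ → ℝ :=
  filterOutput (A θ) (fun m => increment Z δ m ω)

/-- The cost `V_N(θ) = ‖K^{-1/2} h̄(θ)‖²`. The observed data are generated with the parameter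
`θs` from the noise `Z`, the simulated data with the parameter `θ` from the noise `Z'`. -/
def cost (A : EuclideanSpace ℝ (Fin p) → PowerSeries ℝ) (Z Z' : ℝ → Ω → ℝ) (δ : ℝ)
    (u : Fin M → Fin r → ℝ) (K : Matrix (Fin M) (Fin M) ℂ) (θs : EuclideanSpace ℝ (Fin p))
    (N : ℕ) (ω : Ω) (θ : EuclideanSpace ℝ (Fin p)) : ℝ :=
  weightedSq K (avgScore u (series A Z δ θs ω) (series A Z' δ θ ω) N)

/-- The expected score `g(θ) = E[h̄(θ)]`; by stationarity the expectation of the score does not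
depend on the time `n`, so that the first one, `n = r + 1`, is taken. -/
def expScore [MeasurableSpace Ω] (P : Measure Ω)
    (A : EuclideanSpace ℝ (Fin p) → PowerSeries ℝ) (Z Z' : ℝ → Ω → ℝ) (δ : ℝ)
    (u : Fin M → Fin r → ℝ) (θs θ : EuclideanSpace ℝ (Fin p)) : Fin M → ℂ :=
  fun k => ∫ ω, score (u k) (series A Z δ θs ω) (series A Z' δ θ ω) ((r : ℤ) + 1) ∂P

/-- The asymptotic cost `W(θ) = ‖K^{-1/2} g(θ)‖²`. -/
def asympCost [MeasurableSpace Ω] (P : Measure Ω)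
    (A : EuclideanSpace ℝ (Fin p) → PowerSeries ℝ) (Z Z' : ℝ → Ω → ℝ) (δ : ℝ)
    (u : Fin M → Fin r → ℝ) (K : Matrix (Fin M) (Fin M) ℂ)
    (θs θ : EuclideanSpace ℝ (Fin p)) : ℝ :=
  weightedSq K (expScore P A Z Z' δ u θs θ)

/-- `θhat N` is a random vector in `D₀` that solves the gradient equation `V_{θN}(θ) = 0`:
almost surely, if the equation has exactly one solution in `D₀`, then `θhat N` is this
solution. -/
structure IsGradientEstimator [MeasurableSpace Ω] (P : Measure Ω)
    (V : ℕ → Ω → EuclideanSpace ℝ (Fin p) → ℝ) (D₀ : Set (EuclideanSpace ℝ (Fin p)))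
    (θhat : ℕ → Ω → EuclideanSpace ℝ (Fin p)) : Prop where
  measurable : ∀ N, Measurable (θhat N)
  mem : ∀ N, ∀ᵐ ω ∂P, θhat N ω ∈ D₀
  eq_of_unique : ∀ N, 1 ≤ N → ∀ᵐ ω ∂P, ∀ θ ∈ D₀, gradient (V N ω) θ = 0 →
    (∀ θ' ∈ D₀, gradient (V N ω) θ' = 0 → θ' = θ) → θhat N ω = θ

/-- `X_N = O_M(a_N)`: for every `q ≥ 1` there is a constant `c` with
`E^{1/q} |X_N|^q ≤ c a_N` for all `N ≥ 1`. -/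
def IsOM [MeasurableSpace Ω] (P : Measure Ω)
    (X : ℕ → Ω → EuclideanSpace ℝ (Fin p)) (a : ℕ → ℝ) : Prop :=
  ∀ q : ℝ, 1 ≤ q → ∃ c : ℝ, ∀ N : ℕ, 1 ≤ N →
    eLpNorm (X N) (ENNReal.ofReal q) P ≤ ENNReal.ofReal (c * a N)

end

end ECF

set_option linter.unusedSectionVars false

/-! ### Moments from a smooth characteristic function. -/

namespace ECF

/-! Since the gradient of `W` vanishes at `θs`, the gradient of `V_N` there is `O_M(N^{-1/2})`. Its
derivative at `θs` is `O_M(N^{-1/2})`-close to the invertible Hessian of `W` and is locally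
Lipschitz with constant `l + τ_N`, where `τ_N = O_M(N^{-1/2})`. The Newton lemma
`exists_unique_zero_of_hasFDerivAt` then yields a unique zero near `θs`, equal to one Newton step up
to products of two `O_M(N^{-1/2})` terms. On the rest of the compact set the gradient of `W` does
not vanish, so neither does that of `V_N` (`ApproxField₂.noCriticalPoint`,
`noCriticalPoint_of_isCompact`).

Both conclusions require a certain nonnegative `T_N = O_M(N^{-1/2})` to be less than 1. Where `T_N ≥
1`, the crude bound for the error may be multiplied by `T_N² ≥ 1`, and is then `O_M(N^{-1})` as
well. Hence no exceptional event has to be estimated: the error is bounded pathwise by a polynomial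
in `O_M` variables (`exists_boundedInM_newton_error`).

The closeness of `V_N` to `W` is expressed by `ApproxField₂`: errors pointwise in `θ` together with
a random Lipschitz constant, for the field and two derivatives. This replaces uniform laws of large
numbers and is stable under bilinear maps. As the cost is quadratic in time averages of `exp(i uᵀ
Y_n)`, these averages are all that matters. Near each parameter `uᵀ Y_n` is a bounded linear
functional, `C³` in `θ`, of the discounted past `(ρ^m ΔZ_{n-1-m})_m` in `ℓ¹`
(`IsStableC3.exists_blockProd_eq`); so the exponential and its parameter derivatives are functionals
of the past with polynomially growing Lipschitz constants.

For such functionals `PolyLip.exists_eLpNorm_sum_sub_le` shows that centred sums over `N` times are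
`O_M(√N)`. Passing from `j` to `j + 1` remembered terms changes the functional by `O_M(ρ^j)`, and
this change depends on `j + 1` consecutive noise values only. In each residue class mod `j + 1` the
changes are independent, so a moment inequality for independent centred variables applies, and `∑ (j
+ 1) ρ^j` converges. All this needs noise with moments of every order, which follow from smoothness
of the Lévy exponent (`HasLevyTriplet.memLp`). -/

theorem integrable_norm_pow_iff {α : Type*} [MeasurableSpace α] {μ : Measure α} {f : α → ℝ}
    {k : ℕ} (hf : AEStronglyMeasurable f μ) (hk : k ≠ 0) :
    Integrable (fun x => ‖f x‖ ^ k) μ ↔ MemLp f k μ := by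
  simpa using integrable_norm_rpow_iff (p := (k : ℝ≥0∞)) hf (by exact_mod_cast hk) (by simp)

/-- The function `h ↦ D h + D (-h)` is even, so its linear Taylor term at 0 vanishes and only a
quadratic remainder is left. -/
theorem exists_norm_secondDifference_le {D : ℝ → ℂ} (hD : ContDiff ℝ 2 D) :
    ∃ C : ℝ, ∀ h ∈ Set.Icc (0 : ℝ) 1, ‖D h + D (-h) - 2 * D 0‖ ≤ C * h ^ 2 := by
  have hF : ContDiff ℝ 2 (fun h => D h + D (-h)) := hD.add (hD.comp contDiff_neg)
  obtain ⟨C, hC⟩ := exists_taylor_mean_remainder_bound (n := 1) zero_le_one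
    (f := fun h => D h + D (-h)) (hF.contDiffOn.of_le (by norm_num))
  refine ⟨C, fun h hh => ?_⟩
  have h0 := hC h hh
  have hd : HasDerivAt D (deriv D 0) 0 := (hD.differentiable (by norm_num) 0).hasDerivAt
  have hd' : HasDerivAt (fun h => D h + D (-h)) 0 0 := by
    have h1 : HasDerivAt (fun h : ℝ => D (-h)) (-deriv D 0) 0 := by
      have h2 : HasDerivAt D (deriv D 0) (-0) := by simpa using hd
      simpa [Function.comp_def] using h2.scomp (0 : ℝ) (hasDerivAt_neg (0 : ℝ))
    simpa [Pi.add_def] using hd.add h1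
  have h1 : derivWithin (fun h => D h + D (-h)) (Set.Icc 0 1) 0 = 0 :=
    hd'.hasDerivWithinAt.derivWithin (uniqueDiffOn_Icc zero_lt_one 0 (by simp))
  rw [taylorWithinEval_succ, iteratedDerivWithin_one, h1] at h0
  simpa [two_mul] using h0

/-- The symmetric second difference of the derivative of order `2k` at 0 is, up to sign, `∫ x^{2k}
(2 - 2 cos(hx)) dμ`, hence `O(h²)`. For `|x| ≤ 1/h` one has `2 - 2 cos(hx) ≥ (4/π²) h² x²`, so the
moments of order `2k + 2` truncated at `1/h` stay bounded as `h → 0`. -/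
theorem integrable_even_pow_succ_of_contDiff_charFun {μ : Measure ℝ} [IsFiniteMeasure μ]
    {k : ℕ} (hφ : ContDiff ℝ (2 * k + 2 : ℕ) (charFun μ))
    (hk : Integrable (fun x : ℝ => x ^ (2 * k)) μ) :
    Integrable (fun x : ℝ => x ^ (2 * (k + 1))) μ := by
  have hmem : MemLp id (2 * k : ℕ) μ := by
    rcases Nat.eq_zero_or_pos k with rfl | hk0
    · simpa using by fun_prop
    · refine (integrable_norm_pow_iff aestronglyMeasurable_id (by omega)).1 ?_
      simpa [pow_mul] using hk
  have hD : ContDiff ℝ 2 (iteratedDeriv (2 * k) (charFun μ)) :=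
    by
    rw [iteratedDeriv_eq_iterate]
    exact ContDiff.iterate_deriv' 2 (2 * k) (by rwa [add_comm])
  obtain ⟨C, hC⟩ := exists_norm_secondDifference_le hD
  have hint : ∀ h : ℝ, Integrable (fun x : ℝ => x ^ (2 * k) * (2 - 2 * Real.cos (h * x))) μ := by
    intro h
    refine hk.mul_bdd (c := 4) (by fun_prop) (ae_of_all _ fun x => ?_)
    rw [Real.norm_eq_abs, abs_le]
    constructor <;> linarith [Real.neg_one_le_cos (h * x), Real.cos_le_one (h * x)]
  have hintc : ∀ h : ℝ, Integrable (fun x : ℝ => (x : ℂ) ^ (2 * k) *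
      Complex.exp (h * x * Complex.I)) μ := by
    intro h
    have h1 : Integrable (fun x : ℝ => (x : ℂ) ^ (2 * k)) μ := by
      simpa using hk.ofReal (𝕜 := ℂ)
    refine h1.mul_bdd (c := 1) (by fun_prop) (ae_of_all _ fun x => ?_)
    rw [← Complex.ofReal_mul, Complex.norm_exp_ofReal_mul_I]
  have hbound : ∀ h ∈ Set.Icc (0 : ℝ) 1,
      ∫ x, x ^ (2 * k) * (2 - 2 * Real.cos (h * x)) ∂μ ≤ C * h ^ 2 := by
    intro h hh
    refine le_trans (le_of_eq ?_) (hC h hh)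
    simp only [iteratedDeriv_charFun hmem]
    rw [← mul_add, mul_left_comm, ← mul_sub, norm_mul, norm_pow, Complex.norm_I, one_pow, one_mul,
      ← integral_add (hintc h) (hintc (-h)), ← integral_const_mul,
      ← integral_sub (by exact (hintc h).add (hintc (-h))) ((hintc 0).const_mul 2)]
    have h2 : ∀ x : ℝ, ((x : ℂ) ^ (2 * k) * Complex.exp (h * x * Complex.I) +
        (x : ℂ) ^ (2 * k) * Complex.exp ((-h : ℝ) * x * Complex.I) -
        2 * ((x : ℂ) ^ (2 * k) * Complex.exp ((0 : ℝ) * x * Complex.I)))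
        = ((-(x ^ (2 * k) * (2 - 2 * Real.cos (h * x))) : ℝ) : ℂ) := by
      intro x
      push_cast
      rw [Complex.cos]
      simp only [zero_mul, Complex.exp_zero]
      ring_nf
    simp_rw [h2]
    rw [integral_complex_ofReal, Complex.norm_real, integral_neg, norm_neg, Real.norm_of_nonneg]
    refine integral_nonneg fun x => mul_nonneg ?_ ?_
    · rw [pow_mul]; positivity
    · linarith [Real.cos_le_one (h * x)]
  have hcov : AECover μ atTop (fun n : ℕ => Metric.closedBall (0 : ℝ) (n + 1)) :=
    aecover_closedBall (tendsto_atTop_add_const_right _ _ tendsto_natCast_atTop_atTop)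
  have hcont : Continuous (fun x : ℝ => x ^ (2 * (k + 1))) := by fun_prop
  have hIon : ∀ n : ℕ, IntegrableOn (fun x : ℝ => x ^ (2 * (k + 1)))
      (Metric.closedBall (0 : ℝ) (n + 1)) μ := fun n =>
    hcont.continuousOn.integrableOn_compact (isCompact_closedBall _ _)
  refine hcov.integrable_of_integral_bounded_of_nonneg_ae (Real.pi ^ 2 / 4 * C) hIon
    (ae_of_all _ fun x => by rw [pow_mul]; positivity) (Eventually.of_forall fun n => ?_)
  set h : ℝ := 1 / (n + 1) with hh
  have hn : (0 : ℝ) < n + 1 := by positivity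
  have hpos : 0 < h := by positivity
  have h1 : h ≤ 1 := by rw [hh, div_le_one hn]; linarith [(Nat.cast_nonneg n : (0 : ℝ) ≤ n)]
  have key : ∀ x ∈ Metric.closedBall (0 : ℝ) (n + 1), x ^ (2 * (k + 1)) ≤
      Real.pi ^ 2 / 4 * (1 / h ^ 2) * (x ^ (2 * k) * (2 - 2 * Real.cos (h * x))) := by
    intro x hx
    have hx' : |h * x| ≤ Real.pi := by
      rw [mem_closedBall_zero_iff, Real.norm_eq_abs] at hx
      rw [abs_mul, abs_of_pos hpos]
      calc h * |x| ≤ h * (n + 1) := by gcongr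
        _ = 1 := by rw [hh]; field_simp
        _ ≤ Real.pi := by linarith [Real.pi_gt_three]
    have hq := Real.cos_le_one_sub_mul_cos_sq hx'
    have hxx : 0 ≤ x ^ (2 * k) := by rw [pow_mul]; positivity
    have hpi := Real.pi_pos
    have : x ^ 2 ≤ Real.pi ^ 2 / 4 * (1 / h ^ 2) * (2 - 2 * Real.cos (h * x)) := by
      calc x ^ 2 = Real.pi ^ 2 / 4 * (1 / h ^ 2) * (2 * (2 / Real.pi ^ 2 * (h * x) ^ 2)) := by
            field_simp; ring
        _ ≤ _ := by gcongr; linarith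
    calc x ^ (2 * (k + 1)) = x ^ (2 * k) * x ^ 2 := by ring
      _ ≤ x ^ (2 * k) * (Real.pi ^ 2 / 4 * (1 / h ^ 2) * (2 - 2 * Real.cos (h * x))) := by gcongr
      _ = _ := by ring
  calc ∫ x in Metric.closedBall (0 : ℝ) (n + 1), x ^ (2 * (k + 1)) ∂μ
      ≤ ∫ x in Metric.closedBall (0 : ℝ) (n + 1), Real.pi ^ 2 / 4 * (1 / h ^ 2) *
          (x ^ (2 * k) * (2 - 2 * Real.cos (h * x))) ∂μ :=
        setIntegral_mono_on (hIon n) ((hint h).const_mul _).integrableOn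
          Metric.isClosed_closedBall.measurableSet key
    _ ≤ ∫ x, Real.pi ^ 2 / 4 * (1 / h ^ 2) * (x ^ (2 * k) * (2 - 2 * Real.cos (h * x))) ∂μ := by
        refine setIntegral_le_integral ((hint h).const_mul _) (ae_of_all _ fun x => ?_)
        have : 0 ≤ x ^ (2 * k) := by rw [pow_mul]; positivity
        have : 0 ≤ 2 - 2 * Real.cos (h * x) := by linarith [Real.cos_le_one (h * x)]
        simp only [Pi.zero_apply]
        positivity
    _ ≤ Real.pi ^ 2 / 4 * (1 / h ^ 2) * (C * h ^ 2) := by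
        rw [integral_const_mul]
        gcongr
        exact hbound h ⟨hpos.le, h1⟩
    _ = Real.pi ^ 2 / 4 * C := by field_simp

theorem memLp_of_contDiff_charFun {μ : Measure ℝ} [IsFiniteMeasure μ]
    (hφ : ∀ n : ℕ, ContDiff ℝ n (charFun μ)) {q : ℝ≥0∞} (hq : q ≠ ∞) : MemLp id q μ := by
  have h : ∀ k : ℕ, Integrable (fun x : ℝ => x ^ (2 * k)) μ := by
    intro k
    induction k with
    | zero => simp
    | succ k ih => exact integrable_even_pow_succ_of_contDiff_charFun (hφ _) ih
  obtain ⟨n, hn⟩ := exists_nat_gt q.toReal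
  have h2 : MemLp id (2 * (n + 1) : ℕ) μ := by
    refine (integrable_norm_pow_iff aestronglyMeasurable_id (by omega)).1 ?_
    simpa [pow_mul] using h (n + 1)
  refine h2.mono_exponent ?_
  rw [← ENNReal.ofReal_toReal hq, ← ENNReal.ofReal_natCast]
  refine ENNReal.ofReal_le_ofReal (hn.le.trans ?_)
  push_cast
  linarith

/-! ### Smoothness of the characteristic exponent -/

theorem integrable_abs_pow_of_levy {ν : Measure ℝ} (hν : IsLevyMeasure ν)
    (hmom : ∀ q : ℝ, 1 ≤ q → ∫⁻ x in {x : ℝ | 1 ≤ |x|}, ENNReal.ofReal (|x| ^ q) ∂ν < ∞)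
    {k : ℕ} (hk : 2 ≤ k) : Integrable (fun x : ℝ => |x| ^ k) ν := by
  refine ⟨by fun_prop, ?_⟩
  have hms : MeasurableSet {x : ℝ | 1 ≤ |x|} := measurableSet_le measurable_const (by fun_prop)
  have h1 : ∀ x : ℝ, ‖|x| ^ k‖ₑ ≤ ENNReal.ofReal (min 1 (x ^ 2)) +
      {x : ℝ | 1 ≤ |x|}.indicator (fun x => ENNReal.ofReal (|x| ^ (k : ℝ))) x := by
    intro x
    rw [Real.enorm_of_nonneg (by positivity)]
    by_cases hx : 1 ≤ |x|
    · rw [Set.indicator_of_mem (by exact hx), Real.rpow_natCast]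
      exact le_add_self
    · rw [Set.indicator_of_notMem (by exact hx), add_zero]
      push Not at hx
      refine ENNReal.ofReal_le_ofReal (le_min (pow_le_one₀ (abs_nonneg x) hx.le) ?_)
      rw [← sq_abs]
      exact pow_le_pow_of_le_one (abs_nonneg x) hx.le hk
  refine (lintegral_mono h1).trans_lt ?_
  rw [lintegral_add_left (by fun_prop), lintegral_indicator hms]
  exact ENNReal.add_lt_top.2 ⟨hν.lintegral_lt_top, hmom k (by exact_mod_cast (by omega : 1 ≤ k))⟩

/-- Differentiating twice under the integral leaves `-x² e^{iux}`. The measure `x² ν(dx)` is finite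
with all moments, so the second derivative is minus a smooth characteristic function. -/
theorem contDiff_integral_levyIntegrand {ν : Measure ℝ} (hν : IsLevyMeasure ν)
    (hmom : ∀ q : ℝ, 1 ≤ q → ∫⁻ x in {x : ℝ | 1 ≤ |x|}, ENNReal.ofReal (|x| ^ q) ∂ν < ∞) :
    ContDiff ℝ (⊤ : ℕ∞) (fun u : ℝ => ∫ x, (Complex.exp (Complex.I * u * x) - 1
      - Complex.I * u * (if |x| ≤ 1 then (x : ℂ) else 0)) ∂ν) := by
  have hsq : Integrable (fun x : ℝ => x ^ 2) ν := by
    simpa using integrable_abs_pow_of_levy hν hmom (le_refl 2)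
  have hms : MeasurableSet {x : ℝ | |x| ≤ 1} := measurableSet_le (by fun_prop) measurable_const
  have hmi : Measurable (fun x : ℝ => if |x| ≤ 1 then (x : ℂ) else 0) :=
    Measurable.ite hms (by fun_prop) measurable_const
  have hmi1 : Measurable (fun x : ℝ => if |x| ≤ 1 then (1 : ℂ) else 0) :=
    Measurable.ite hms (by fun_prop) measurable_const
  set F : ℝ → ℝ → ℂ := fun u x => Complex.exp (Complex.I * u * x) - 1
      - Complex.I * u * (if |x| ≤ 1 then (x : ℂ) else 0)
  set F1 : ℝ → ℝ → ℂ := fun u x => Complex.I * x * (Complex.exp (Complex.I * u * x) -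
    (if |x| ≤ 1 then 1 else 0))
  set F2 : ℝ → ℝ → ℂ := fun u x => -(x : ℂ) ^ 2 * Complex.exp (Complex.I * u * x)
  have hexp : ∀ u x : ℝ, ‖Complex.exp (Complex.I * u * x)‖ = 1 := by
    intro u x
    rw [mul_assoc, mul_comm, ← Complex.ofReal_mul, Complex.norm_exp_ofReal_mul_I]
  have hexp1 : ∀ u x : ℝ, ‖Complex.exp (Complex.I * u * x) - 1‖ ≤ |u| * |x| := by
    intro u x
    rw [mul_assoc, ← Complex.ofReal_mul, ← abs_mul]
    exact Real.norm_exp_I_mul_ofReal_sub_one_le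
  have hF_meas : ∀ u, AEStronglyMeasurable (F u) ν := fun u =>
    (((by fun_prop : Measurable fun x : ℝ => Complex.exp (Complex.I * u * x) - 1).sub
      (hmi.const_mul _))).aestronglyMeasurable
  have hF1_meas : ∀ u, AEStronglyMeasurable (F1 u) ν := fun u =>
    ((by fun_prop : Measurable fun x : ℝ => Complex.I * (x : ℂ)).mul
      ((by fun_prop : Measurable fun x : ℝ => Complex.exp (Complex.I * u * x)).sub
        hmi1)).aestronglyMeasurable
  have hF2_meas : ∀ u, AEStronglyMeasurable (F2 u) ν := fun u =>
    (by fun_prop : Measurable (F2 u)).aestronglyMeasurable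
  -- For `|x| ≤ 1` the compensator supplies the second factor `|x|`; for `|x| > 1` the bound `|x| ≤
  -- x²` suffices.
  have hF1_bd : ∀ u x, ‖F1 u x‖ ≤ (|u| + 1) * x ^ 2 := by
    intro u x
    have h0 := abs_nonneg x
    simp only [F1]
    rw [norm_mul, norm_mul, Complex.norm_I, one_mul, Complex.norm_real, Real.norm_eq_abs]
    split_ifs with hx
    · calc |x| * ‖Complex.exp (Complex.I * u * x) - 1‖ ≤ |x| * (|u| * |x|) := by
            gcongr; exact hexp1 u x
        _ = |u| * x ^ 2 := by rw [← sq_abs x]; ring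
        _ ≤ _ := by gcongr; linarith
    · rw [sub_zero, hexp, mul_one]
      push Not at hx
      rw [← sq_abs x]
      nlinarith [abs_nonneg u, mul_nonneg (abs_nonneg u) (sq_nonneg |x|)]
  have hF_d : ∀ u x, HasDerivAt (fun v => F v x) (F1 u x) u := by
    intro u x
    have h1 : HasDerivAt (fun v : ℝ => (v : ℂ)) 1 u := Complex.ofRealCLM.hasDerivAt
    have h2 : HasDerivAt (fun v : ℝ => Complex.I * v * x) (Complex.I * x) u := by
      simpa using (h1.const_mul Complex.I).mul_const (x : ℂ)
    have h3 := ((h2.cexp.sub_const 1).sub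
      ((h1.const_mul Complex.I).mul_const (if |x| ≤ 1 then (x : ℂ) else 0)))
    refine h3.congr_deriv ?_
    show _ = Complex.I * x * _
    split_ifs <;> ring
  have hF1_d : ∀ u x, HasDerivAt (fun v => F1 v x) (F2 u x) u := by
    intro u x
    have h1 : HasDerivAt (fun v : ℝ => (v : ℂ)) 1 u := Complex.ofRealCLM.hasDerivAt
    have h2 : HasDerivAt (fun v : ℝ => Complex.I * v * x) (Complex.I * x) u := by
      simpa using (h1.const_mul Complex.I).mul_const (x : ℂ)
    have h3 := (h2.cexp.sub_const (if |x| ≤ 1 then (1 : ℂ) else 0)).const_mul (Complex.I * x)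
    refine h3.congr_deriv ?_
    show _ = -(x : ℂ) ^ 2 * Complex.exp (Complex.I * u * x)
    linear_combination ((x : ℂ) ^ 2 * Complex.exp (Complex.I * u * x)) * Complex.I_mul_I
  have hF_bd : ∀ u x, ‖F u x‖ ≤ (|u| * (|u| + 1)) * x ^ 2 := by
    intro u x
    have h0 : F 0 x = 0 := by simp [F]
    have := (convex_closedBall (0 : ℝ) |u|).norm_image_sub_le_of_norm_hasDerivWithin_le
      (f := fun v => F v x) (C := (|u| + 1) * x ^ 2) (x := 0) (y := u)
      (fun v _ => (hF_d v x).hasDerivWithinAt) (fun v hv => (hF1_bd v x).trans (by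
        rw [mem_closedBall_zero_iff, Real.norm_eq_abs] at hv
        gcongr)) (by simp) (by simp)
    rw [h0, sub_zero, sub_zero, Real.norm_eq_abs] at this
    linarith
  have hI : ∀ u, HasDerivAt (fun v => ∫ x, F v x ∂ν) (∫ x, F1 u x ∂ν) u := fun u =>
    (hasDerivAt_integral_of_dominated_loc_of_deriv_le (Metric.ball_mem_nhds u one_pos)
      (Eventually.of_forall hF_meas) ((hsq.const_mul _).mono' (hF_meas u) (ae_of_all _ (hF_bd u)))
      (hF1_meas u) (ae_of_all _ fun x v hv => (hF1_bd v x).trans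
        (show _ ≤ (|u| + 2) * x ^ 2 by
          rw [mem_ball_iff_norm, Real.norm_eq_abs] at hv
          have := abs_sub_abs_le_abs_sub v u
          exact mul_le_mul_of_nonneg_right (by linarith) (sq_nonneg x)))
      (hsq.const_mul _) (ae_of_all _ fun x v _ => hF_d v x)).2
  have hI1 : ∀ u, HasDerivAt (fun v => ∫ x, F1 v x ∂ν) (∫ x, F2 u x ∂ν) u := fun u =>
    (hasDerivAt_integral_of_dominated_loc_of_deriv_le (Metric.ball_mem_nhds u one_pos)
      (Eventually.of_forall hF1_meas)
      ((hsq.const_mul _).mono' (hF1_meas u) (ae_of_all _ (hF1_bd u)))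
      (hF2_meas u) (ae_of_all _ fun x v _ => (show ‖F2 v x‖ ≤ x ^ 2 by
        simp only [F2]
        rw [norm_mul, hexp, mul_one, norm_neg, norm_pow, Complex.norm_real, Real.norm_eq_abs,
          sq_abs])) hsq (ae_of_all _ fun x v _ => hF1_d v x)).2
  set ν₂ : Measure ℝ := ν.withDensity (fun x => ENNReal.ofReal (x ^ 2))
  have : IsFiniteMeasure ν₂ := isFiniteMeasure_withDensity_ofReal hsq.2
  have hmem : ∀ k : ℕ, MemLp id k ν₂ := by
    intro k
    rcases Nat.eq_zero_or_pos k with rfl | hk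
    · simpa using by fun_prop
    refine (integrable_norm_pow_iff aestronglyMeasurable_id (by omega)).1 ?_
    rw [integrable_withDensity_iff_integrable_smul' (by fun_prop) (by simp)]
    refine (integrable_abs_pow_of_levy hν hmom (k := k + 2) (by omega)).congr
      (ae_of_all _ fun x => ?_)
    simp only [id, smul_eq_mul, Real.norm_eq_abs]
    rw [ENNReal.toReal_ofReal (sq_nonneg x), pow_add, sq_abs, mul_comm]
  have hI2 : (fun u => ∫ x, F2 u x ∂ν) = fun u => -charFun ν₂ u := by
    ext u
    rw [charFun_apply_real, integral_withDensity_eq_integral_toReal_smul (by fun_prop) (by simp),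
      ← integral_neg]
    refine integral_congr_ae (ae_of_all _ fun x => ?_)
    simp only [F2]
    rw [ENNReal.toReal_ofReal (sq_nonneg x), Complex.real_smul]
    push_cast
    rw [show Complex.I * u * x = u * x * Complex.I by ring]
    ring
  have hc2 : ContDiff ℝ (⊤ : ℕ∞) (fun u => ∫ x, F2 u x ∂ν) := by
    rw [hI2]
    exact (contDiff_charFun' hmem).neg
  have hc1 : ContDiff ℝ (⊤ : ℕ∞) (fun u => ∫ x, F1 u x ∂ν) := by
    rw [contDiff_infty_iff_deriv, funext fun u => (hI1 u).deriv]
    exact ⟨fun u => (hI1 u).differentiableAt, hc2⟩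
  rw [contDiff_infty_iff_deriv, funext fun u => (hI u).deriv]
  exact ⟨fun u => (hI u).differentiableAt, hc1⟩

theorem contDiff_levyExponent (b c : ℝ) {ν : Measure ℝ} (hν : IsLevyMeasure ν)
    (hmom : ∀ q : ℝ, 1 ≤ q → ∫⁻ x in {x : ℝ | 1 ≤ |x|}, ENNReal.ofReal (|x| ^ q) ∂ν < ∞) :
    ContDiff ℝ (⊤ : ℕ∞) (levyExponent b c ν) := by
  have h0 : ContDiff ℝ (⊤ : ℕ∞) (fun u : ℝ => (u : ℂ)) := Complex.ofRealCLM.contDiff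
  have := contDiff_integral_levyIntegrand hν hmom
  unfold levyExponent
  refine ContDiff.add ?_ this
  exact (contDiff_const.mul h0).sub ((contDiff_const.mul (h0.pow 2)).div_const 2)

/-! ### The sampled noise -/

variable {Ω : Type*} [MeasurableSpace Ω] {P : Measure Ω}

theorem HasLevyTriplet.memLp [IsProbabilityMeasure P] {Z : ℝ → Ω → ℝ} {b c : ℝ} {ν : Measure ℝ}
    (hZ : IsLevyProcess P Z) (hZν : HasLevyTriplet P Z b c ν)
    (hmom : ∀ q : ℝ, 1 ≤ q → ∫⁻ x in {x : ℝ | 1 ≤ |x|}, ENNReal.ofReal (|x| ^ q) ∂ν < ∞)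
    {t : ℝ} (ht : 0 ≤ t) {q : ℝ≥0∞} (hq : q ≠ ∞) : MemLp (Z t) q P := by
  have : IsProbabilityMeasure (P.map (Z t)) :=
    Measure.isProbabilityMeasure_map (hZ.measurable t).aemeasurable
  have h1 : ∀ n : ℕ, ContDiff ℝ n (charFun (P.map (Z t))) := by
    intro n
    rw [show charFun (P.map (Z t)) = fun u => Complex.exp (t * levyExponent b c ν u) from
      funext (hZν.charFun_eq t ht)]
    exact (contDiff_const.mul ((contDiff_levyExponent b c hZν.levyMeasure hmom).of_le
      (by exact_mod_cast le_top))).cexp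
  exact (memLp_map_measure_iff aestronglyMeasurable_id (hZ.measurable t).aemeasurable).1
    (memLp_of_contDiff_charFun h1 hq)

/-- A bi-infinite sequence of independent identically distributed variables having all moments. -/
structure IsNoise (P : Measure Ω) (e : ℤ → Ω → ℝ) : Prop where
  measurable : ∀ n, Measurable (e n)
  indep : iIndepFun e P
  identDistrib : ∀ n, IdentDistrib (e n) (e 0) P P
  memLp : ∀ n (q : ℝ≥0∞), q ≠ ∞ → MemLp (e n) q P

-- Independence is tested on finite index sets; each lies above some `a`, which reduces two-sided
-- time to a grid indexed by `ℕ`.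
theorem iIndepFun_increment [IsProbabilityMeasure P] {Z : ℝ → Ω → ℝ} (hZ : IsLevyProcess P Z)
    {δ : ℝ} (hδ : 0 < δ) : iIndepFun (fun n => increment Z δ n) P := by
  refine iIndepFun_iff_finset.2 fun s => ?_
  obtain ⟨a, ha⟩ : ∃ a : ℤ, ∀ n ∈ s, a ≤ n := by
    obtain ⟨a, ha⟩ := s.bddBelow
    exact ⟨a, fun n hn => ha hn⟩
  -- The grid starts at `a - 1` so that its `i`-th step is the increment with number `a + i`.
  have hmono : Monotone (fun i : ℕ => ((a - 1 + i : ℤ) : ℝ) * δ) := by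
    intro i j hij
    dsimp only
    gcongr
  have h := hZ.indep.nat hmono
  let g : s → ℕ := fun n => (n.1 - a).toNat
  have hg : Function.Injective g := by
    intro m n hmn
    have := ha m.1 m.2
    have := ha n.1 n.2
    simp only [g] at hmn
    exact Subtype.ext (by omega)
  have h2 := h.precomp hg
  refine h2.congr fun n => ae_of_all _ fun ω => ?_
  have hn : (a - 1 + ((n.1 - a).toNat : ℤ)) = n.1 - 1 := by
    have := ha n.1 n.2
    omega
  have hn' : (a - 1 + ((n.1 - a).toNat + 1 : ℕ) : ℤ) = n.1 := by
    have := ha n.1 n.2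
    omega
  simp only [g, Finset.restrict, increment, hn, hn']
  push_cast
  rfl

theorem isNoise_increment [IsProbabilityMeasure P] {Z : ℝ → Ω → ℝ} {b c : ℝ} {ν : Measure ℝ}
    (hZ : IsLevyProcess P Z) (hZν : HasLevyTriplet P Z b c ν)
    (hmom : ∀ q : ℝ, 1 ≤ q → ∫⁻ x in {x : ℝ | 1 ≤ |x|}, ENNReal.ofReal (|x| ^ q) ∂ν < ∞)
    {δ : ℝ} (hδ : 0 < δ) : IsNoise P (fun n => increment Z δ n) := by
  have hid : ∀ n : ℤ, IdentDistrib (increment Z δ n) (Z δ) P P := by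
    intro n
    have h := hZ.stationary ((n - 1) * δ) (n * δ) (by gcongr; linarith)
    rwa [show (n : ℝ) * δ - (n - 1) * δ = δ by ring] at h
  exact
    { measurable := fun n => (hZ.measurable _).sub (hZ.measurable _)
      indep := iIndepFun_increment hZ hδ
      identDistrib := fun n => (hid n).trans (hid 0).symm
      memLp := fun n q hq => (hid n).memLp_iff.2 (HasLevyTriplet.memLp hZ hZν hmom hδ.le hq) }

end ECF

/-! ### Calculus of `O_M` variables. -/

namespace ECF

theorem holderTriple_two_mul (q : ℝ≥0∞) : ENNReal.HolderTriple (2 * q) (2 * q) q where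
  inv_add_inv_eq_inv := by
    rw [← two_mul, ENNReal.mul_inv (by simp) (by simp), ← mul_assoc,
      ENNReal.mul_inv_cancel (by simp) (by simp), one_mul]

variable {Ω : Type*} [MeasurableSpace Ω] {P : Measure Ω}
  {ι G G' G₁ G₂ G₃ : Type*} [NormedAddCommGroup G] [NormedAddCommGroup G'] [NormedAddCommGroup G₁]
  [NormedSpace ℝ G₁] [NormedAddCommGroup G₂] [NormedSpace ℝ G₂] [NormedAddCommGroup G₃]
  [NormedSpace ℝ G₃]

theorem eLpNorm_bilin_le {X : Ω → G₁} {Y : Ω → G₂} (hX : AEStronglyMeasurable X P)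
    (hY : AEStronglyMeasurable Y P) (β : G₁ →L[ℝ] G₂ →L[ℝ] G₃) (q : ℝ≥0∞) :
    eLpNorm (fun ω => β (X ω) (Y ω)) q P ≤
      ENNReal.ofReal ‖β‖ * eLpNorm X (2 * q) P * eLpNorm Y (2 * q) P := by
  have := holderTriple_two_mul q
  have h := eLpNorm_le_eLpNorm_mul_eLpNorm_of_nnnorm (p := 2 * q) (q := 2 * q) (r := q) hX hY
    (fun x y => β x y) ‖β‖₊ (ae_of_all _ fun ω => β.le_opNorm₂ (X ω) (Y ω))
  rwa [← norm_toNNReal] at h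

/-- `X_i = O_M(a_i)` for variables in a normed space indexed by any type, with measurability. -/
structure BoundedInM (P : Measure Ω) (X : ι → Ω → G) (a : ι → ℝ) : Prop where
  meas : ∀ N, AEStronglyMeasurable (X N) P
  bound : ∀ q : ℝ≥0∞, 1 ≤ q → q ≠ ∞ → ∃ C : ℝ, 0 ≤ C ∧ ∀ N,
    eLpNorm (X N) q P ≤ ENNReal.ofReal (C * a N)

namespace BoundedInM

variable {a b : ι → ℝ} {X Y : ι → Ω → G}

theorem add (ha : ∀ N, 0 ≤ a N) (hX : BoundedInM P X a) (hY : BoundedInM P Y a) :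
    BoundedInM P (fun N ω => X N ω + Y N ω) a := by
  refine ⟨fun N => (hX.meas N).add (hY.meas N), fun q hq hq' => ?_⟩
  obtain ⟨C, hC, h⟩ := hX.bound q hq hq'
  obtain ⟨C', hC', h'⟩ := hY.bound q hq hq'
  refine ⟨C + C', by positivity, fun N => ?_⟩
  rw [add_mul, ENNReal.ofReal_add (mul_nonneg hC (ha N)) (mul_nonneg hC' (ha N))]
  exact (eLpNorm_add_le (hX.meas N) (hY.meas N) hq).trans (add_le_add (h N) (h' N))

theorem of_norm_le {Y : ι → Ω → G'} (hX : ∀ N, AEStronglyMeasurable (X N) P)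
    (hY : BoundedInM P Y a) (h : ∀ᵐ ω ∂P, ∀ N, ‖X N ω‖ ≤ ‖Y N ω‖) : BoundedInM P X a := by
  refine ⟨hX, fun q hq hq' => ?_⟩
  obtain ⟨C, hC, h'⟩ := hY.bound q hq hq'
  exact ⟨C, hC, fun N => (eLpNorm_mono_ae (h.mono fun ω hω => hω N)).trans (h' N)⟩

theorem norm (hX : BoundedInM P X a) : BoundedInM P (fun N ω => ‖X N ω‖) a :=
  of_norm_le (fun N => (hX.meas N).norm) hX (ae_of_all _ fun ω N => by simp)

theorem congr (hX : BoundedInM P X a) (h : ∀ᵐ ω ∂P, ∀ N, X N ω = Y N ω) : BoundedInM P Y a :=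
  of_norm_le (fun N => (hX.meas N).congr (h.mono fun ω hω => hω N)) hX
    (h.mono fun ω hω N => by rw [hω N])

theorem mono (hX : BoundedInM P X a) (hab : ∀ N, a N ≤ b N) : BoundedInM P X b := by
  refine ⟨hX.meas, fun q hq hq' => ?_⟩
  obtain ⟨C, hC, h'⟩ := hX.bound q hq hq'
  exact ⟨C, hC, fun N => (h' N).trans (ENNReal.ofReal_le_ofReal (by
    have := hab N
    gcongr))⟩

/-- Hölder's inequality doubles the exponent; this costs nothing because the bounds are available
for every finite exponent. -/
theorem bilin {X : ι → Ω → G₁} {Y : ι → Ω → G₂} (ha : ∀ N, 0 ≤ a N)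
    (β : G₁ →L[ℝ] G₂ →L[ℝ] G₃) (hX : BoundedInM P X a) (hY : BoundedInM P Y b) :
    BoundedInM P (fun N ω => β (X N ω) (Y N ω)) (fun N => a N * b N) := by
  refine ⟨fun N => β.aestronglyMeasurable_comp₂ (hX.meas N) (hY.meas N), fun q hq hq' => ?_⟩
  have h1 : 1 ≤ 2 * q := hq.trans (le_mul_of_one_le_left' one_le_two)
  have h2 : 2 * q ≠ ∞ := ENNReal.mul_ne_top (by simp) hq'
  obtain ⟨C, hC, h⟩ := hX.bound (2 * q) h1 h2
  obtain ⟨C', hC', h'⟩ := hY.bound (2 * q) h1 h2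
  refine ⟨‖β‖ * C * C', by positivity, fun N => ?_⟩
  refine (eLpNorm_bilin_le (hX.meas N) (hY.meas N) β q).trans ?_
  calc ENNReal.ofReal ‖β‖ * eLpNorm (X N) (2 * q) P * eLpNorm (Y N) (2 * q) P
      ≤ ENNReal.ofReal ‖β‖ * ENNReal.ofReal (C * a N) * ENNReal.ofReal (C' * b N) := by
        gcongr
        exacts [h N, h' N]
    _ = ENNReal.ofReal (‖β‖ * C * C' * (a N * b N)) := by
        rw [← ENNReal.ofReal_mul (norm_nonneg β),
          ← ENNReal.ofReal_mul (mul_nonneg (norm_nonneg β) (mul_nonneg hC (ha N)))]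
        congr 1
        ring

theorem mul {X Y : ι → Ω → ℝ} (ha : ∀ N, 0 ≤ a N) (hX : BoundedInM P X a)
    (hY : BoundedInM P Y b) : BoundedInM P (fun N ω => X N ω * Y N ω) (fun N => a N * b N) :=
  bilin ha (ContinuousLinearMap.mul ℝ ℝ) hX hY

theorem clm_comp (f : G₁ →L[ℝ] G₂) {X : ι → Ω → G₁}
    (hX : BoundedInM P X a) : BoundedInM P (fun N ω => f (X N ω)) a := by
  refine ⟨fun N => f.continuous.comp_aestronglyMeasurable (hX.meas N), fun q hq hq' => ?_⟩
  obtain ⟨C, hC, h⟩ := hX.bound q hq hq'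
  refine ⟨‖f‖ * C, by positivity, fun N => ?_⟩
  refine (eLpNorm_le_mul_eLpNorm_of_ae_le_mul (ae_of_all _ fun ω => f.le_opNorm (X N ω)) q).trans ?_
  rw [mul_assoc, ENNReal.ofReal_mul (norm_nonneg _)]
  gcongr
  exact h N

theorem sum (ha : ∀ N, 0 ≤ a N) {κ : Type*} (s : Finset κ) {X : κ → ι → Ω → G}
    (h : ∀ i ∈ s, BoundedInM P (X i) a) : BoundedInM P (fun N ω => ∑ i ∈ s, X i N ω) a := by
  classical
  induction s using Finset.induction_on with
  | empty => exact ⟨fun N => by simpa using aestronglyMeasurable_const,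
    fun q _ _ => ⟨0, le_rfl, fun N => by simp⟩⟩
  | insert i s hi ih =>
    simp only [Finset.sum_insert hi]
    exact add ha (h i (by simp)) (ih fun j hj => h j (by simp [hj]))

theorem const_one [IsProbabilityMeasure P] (g : G) :
    BoundedInM P (fun (_ : ι) _ => g) (fun _ => 1) := by
  refine ⟨fun N => aestronglyMeasurable_const, fun q hq hq' => ⟨‖g‖, norm_nonneg _, fun N => ?_⟩⟩
  rw [eLpNorm_const _ (by positivity) (IsProbabilityMeasure.ne_zero P)]
  simp

theorem integral [NormedSpace ℝ G] [IsProbabilityMeasure P] (hX : BoundedInM P X a) :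
    BoundedInM P (fun N _ => ∫ ω, X N ω ∂P) a := by
  refine ⟨fun N => aestronglyMeasurable_const, fun q hq _ => ?_⟩
  obtain ⟨C, hC, h⟩ := hX.bound 1 le_rfl (by simp)
  refine ⟨C, hC, fun N => le_trans ?_ (h N)⟩
  rw [eLpNorm_const _ (by positivity) (IsProbabilityMeasure.ne_zero P), measure_univ,
    ENNReal.one_rpow, mul_one, eLpNorm_one_eq_lintegral_enorm]
  exact enorm_integral_le_lintegral_enorm _

/-- General index types are needed to have one constant for all times and truncation lengths
together. -/
theorem comp {κ : Type*} (hX : BoundedInM P X a) (φ : κ → ι) :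
    BoundedInM P (fun i => X (φ i)) (fun i => a (φ i)) :=
  ⟨fun _ => hX.meas _, fun q hq hq' =>
    let ⟨C, hC, h⟩ := hX.bound q hq hq'; ⟨C, hC, fun _ => h _⟩⟩

theorem neg (hX : BoundedInM P X a) : BoundedInM P (fun N ω => -X N ω) a :=
  of_norm_le (fun N => (hX.meas N).neg) hX (ae_of_all _ fun ω N => by simp)

theorem sub (ha : ∀ N, 0 ≤ a N) (hX : BoundedInM P X a) (hY : BoundedInM P Y a) :
    BoundedInM P (fun N ω => X N ω - Y N ω) a := by
  simpa only [sub_eq_add_neg] using add ha hX hY.neg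

theorem memLp [IsProbabilityMeasure P] (hX : BoundedInM P X a) (i : ι) {q : ℝ≥0∞}
    (hq : q ≠ ∞) : MemLp (X i) q P := by
  obtain ⟨C, hC, h⟩ := hX.bound (max 1 q) (le_max_left _ _) (by simp [hq])
  exact MemLp.mono_exponent ⟨hX.meas i, (h i).trans_lt ENNReal.ofReal_lt_top⟩ (le_max_right _ _)

theorem pow [IsProbabilityMeasure P] {X : ι → Ω → ℝ} (hX : BoundedInM P X fun _ => 1) (k : ℕ) :
    BoundedInM P (fun i ω => X i ω ^ k) fun _ => 1 := by
  induction k with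
  | zero => simpa using const_one (1 : ℝ)
  | succ k ih => simpa [pow_succ] using mul (fun _ => zero_le_one) ih hX

end BoundedInM

end ECF

/-! ### A moment inequality for sums of independent centred variables. -/

namespace ECF

/-- The constant in the binomial estimate `add_pow_even_le`. -/
def binomTail (m : ℕ) : ℝ := ∑ k ∈ Finset.range (2 * m + 1), ((2 * m + 2).choose (k + 2) : ℝ)

theorem binomTail_nonneg (m : ℕ) : 0 ≤ binomTail m :=
  Finset.sum_nonneg fun _ _ => Nat.cast_nonneg _

/-- The terms of degree 0 and 1 in `x` are kept exactly, because the linear one will have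
expectation zero. All others contain `x²`, and the remaining factor is at most `max(|s|, |x|)^{2m} ≤
s^{2m} + x^{2m}`. -/
theorem add_pow_even_le (m : ℕ) (s x : ℝ) :
    (s + x) ^ (2 * (m + 1)) ≤ s ^ (2 * (m + 1)) + (2 * m + 2) * (s ^ (2 * m + 1) * x) +
      binomTail m * (s ^ (2 * m) * x ^ 2 + x ^ (2 * (m + 1))) := by
  have hs : s ^ (2 * m) = |s| ^ (2 * m) := (Even.pow_abs (even_two_mul m) s).symm
  have hx : x ^ (2 * m) = |x| ^ (2 * m) := (Even.pow_abs (even_two_mul m) x).symm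
  rw [add_comm s x, show 2 * (m + 1) = (2 * m + 1) + 1 by ring, add_pow, Finset.sum_range_succ',
    Finset.sum_range_succ']
  have h : ∑ k ∈ Finset.range (2 * m + 1), x ^ (k + 1 + 1) * s ^ (2 * m + 1 + 1 - (k + 1 + 1)) *
      ((2 * m + 1 + 1).choose (k + 1 + 1) : ℝ) ≤
      binomTail m * (s ^ (2 * m) * x ^ 2 + x ^ (2 * m + 1 + 1)) := by
    rw [binomTail, Finset.sum_mul]
    refine Finset.sum_le_sum fun k hk => ?_
    rw [mul_comm]
    refine mul_le_mul_of_nonneg_left ?_ (Nat.cast_nonneg _)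
    have hk' : k ≤ 2 * m := by simpa [Nat.lt_succ_iff] using hk
    have h1 : x ^ (k + 1 + 1) * s ^ (2 * m + 1 + 1 - (k + 1 + 1)) =
        x ^ 2 * (x ^ k * s ^ (2 * m - k)) := by
      rw [show 2 * m + 1 + 1 - (k + 1 + 1) = 2 * m - k by omega]
      ring
    have h2 : x ^ k * s ^ (2 * m - k) ≤ s ^ (2 * m) + x ^ (2 * m) := by
      refine (le_abs_self _).trans ?_
      rw [abs_mul, abs_pow, abs_pow, hs, hx]
      have h3 : |x| ^ k * |s| ^ (2 * m - k) ≤ max |s| |x| ^ (2 * m) := by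
        calc |x| ^ k * |s| ^ (2 * m - k) ≤ max |s| |x| ^ k * max |s| |x| ^ (2 * m - k) := by
              gcongr
              exacts [le_max_right _ _, le_max_left _ _]
          _ = _ := by rw [← pow_add]; congr 1; omega
      refine h3.trans ?_
      rcases max_cases |s| |x| with h | h <;> rw [h.1]
      · linarith [pow_nonneg (abs_nonneg x) (2 * m)]
      · linarith [pow_nonneg (abs_nonneg s) (2 * m)]
    rw [h1]
    calc x ^ 2 * (x ^ k * s ^ (2 * m - k)) ≤ x ^ 2 * (s ^ (2 * m) + x ^ (2 * m)) := by gcongr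
      _ = _ := by ring
  have h0 : x ^ (0 + 1) * s ^ (2 * m + 1 + 1 - (0 + 1)) * ((2 * m + 1 + 1).choose (0 + 1) : ℝ) =
      (2 * m + 2) * (s ^ (2 * m + 1) * x) := by
    simp
    ring
  have h00 : x ^ 0 * s ^ (2 * m + 1 + 1 - 0) * ((2 * m + 1 + 1).choose 0 : ℝ) =
      s ^ (2 * m + 1 + 1) := by simp
  linarith

/-- The constants in the moment inequality for sums of independent centred variables. -/
def momentConst (D : ℕ → ℝ) : ℕ → ℝ
  | 0 => 1
  | m + 1 => binomTail m * (momentConst D m * D 1 + D (m + 1))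

theorem momentConst_nonneg {D : ℕ → ℝ} (hD : ∀ m, 0 ≤ D m) (m : ℕ) : 0 ≤ momentConst D m := by
  induction m with
  | zero => simp [momentConst]
  | succ m ih =>
    exact mul_nonneg (binomTail_nonneg m) (add_nonneg (mul_nonneg ih (hD 1)) (hD _))

variable {Ω : Type*} [MeasurableSpace Ω] {P : Measure Ω} [IsProbabilityMeasure P]

theorem integrable_pow_of_memLp {x : Ω → ℝ} (hx : ∀ q : ℝ≥0∞, q ≠ ∞ → MemLp x q P) (k : ℕ) :
    Integrable (fun ω => x ω ^ k) P := by
  have h := (hx k (by simp)).integrable_norm_pow'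
  refine h.mono' ((hx 1 (by simp)).1.pow k) (ae_of_all _ fun ω => by simp)

/-- Induction on the exponent and, inside it, on the index set by adjoining its largest element `n`.
As `d n` is centred and independent of the sum `S` of the others, the linear term of
`add_pow_even_le` integrates to zero and `S^{2m} (d n)²` is controlled by the outer induction
hypothesis. -/
theorem integral_sum_pow_even_le {d : ℤ → Ω → ℝ} {D : ℕ → ℝ} (J : ℤ)
    (hd : ∀ n (q : ℝ≥0∞), q ≠ ∞ → MemLp (d n) q P) (h0 : ∀ n, ∫ ω, d n ω ∂P = 0)
    (hind : ∀ n (I : Finset ℤ), (∀ i ∈ I, i + J ≤ n) →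
      IndepFun (fun ω => ∑ i ∈ I, d i ω) (d n) P)
    (hD : ∀ m n, ∫ ω, d n ω ^ (2 * m) ∂P ≤ D m)
    (I : Finset ℤ) (hI : ∀ i ∈ I, ∀ j ∈ I, i < j → i + J ≤ j) (m : ℕ) :
    ∫ ω, (∑ i ∈ I, d i ω) ^ (2 * m) ∂P ≤ momentConst D m * (I.card : ℝ) ^ m := by
  have hD0 : ∀ m, 0 ≤ D m := fun m =>
    (integral_nonneg fun ω => by simp only [Pi.zero_apply, pow_mul]; positivity).trans (hD m 0)
  induction m generalizing I with
  | zero => simp [momentConst]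
  | succ m ihm =>
    induction I using Finset.induction_on_max with
    | empty => simp
    | insert n I hn ih =>
      have hnI : n ∉ I := fun h => lt_irrefl _ (hn n h)
      have hI' : ∀ i ∈ I, ∀ j ∈ I, i < j → i + J ≤ j := fun i hi j hj =>
        hI i (by simp [hi]) j (by simp [hj])
      have hsep : ∀ i ∈ I, i + J ≤ n := fun i hi => hI i (by simp [hi]) n (by simp) (hn i hi)
      set S : Ω → ℝ := fun ω => ∑ i ∈ I, d i ω
      have hS : ∀ q : ℝ≥0∞, q ≠ ∞ → MemLp S q P := fun q hq =>
        memLp_finsetSum I fun i _ => hd i q hq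
      have hSd : ∀ a b : ℕ, IndepFun (fun ω => S ω ^ a) (fun ω => d n ω ^ b) P := fun a b =>
        (hind n I hsep).comp (φ := fun x => x ^ a) (ψ := fun x => x ^ b) (by fun_prop) (by fun_prop)
      have hiS := integrable_pow_of_memLp hS
      have hid := integrable_pow_of_memLp (hd n)
      have hi2 : ∀ a b : ℕ, Integrable (fun ω => S ω ^ a * d n ω ^ b) P := fun a b =>
        (hSd a b).integrable_mul (hiS a) (hid b)
      have hm2 : ∀ a b : ℕ, ∫ ω, S ω ^ a * d n ω ^ b ∂P =
          (∫ ω, S ω ^ a ∂P) * ∫ ω, d n ω ^ b ∂P := fun a b =>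
        (hSd a b).integral_fun_mul_eq_mul_integral (hiS a).1 (hid b).1
      have h1 : ∫ ω, S ω ^ (2 * m + 1) * d n ω ∂P = 0 := by
        simpa [h0 n] using hm2 (2 * m + 1) 1
      have hi1 : Integrable (fun ω => S ω ^ (2 * m + 1) * d n ω) P := by
        simpa using hi2 (2 * m + 1) 1
      have hA := momentConst_nonneg hD0 m
      have hA' := momentConst_nonneg hD0 (m + 1)
      simp only [Finset.sum_insert hnI]
      have i1 : Integrable (fun ω => S ω ^ (2 * (m + 1)) +
          (2 * m + 2) * (S ω ^ (2 * m + 1) * d n ω)) P := (hiS _).add (hi1.const_mul _)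
      have i2 : Integrable (fun ω => S ω ^ (2 * m) * d n ω ^ 2 + d n ω ^ (2 * (m + 1))) P :=
        (hi2 _ _).add (hid _)
      have hstep : ∫ ω, (d n ω + S ω) ^ (2 * (m + 1)) ∂P ≤ ∫ ω, S ω ^ (2 * (m + 1)) ∂P +
          binomTail m * ((∫ ω, S ω ^ (2 * m) ∂P) * (∫ ω, d n ω ^ 2 ∂P) +
            ∫ ω, d n ω ^ (2 * (m + 1)) ∂P) := by
        calc ∫ ω, (d n ω + S ω) ^ (2 * (m + 1)) ∂P
            ≤ ∫ ω, (S ω ^ (2 * (m + 1)) + (2 * m + 2) * (S ω ^ (2 * m + 1) * d n ω) +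
              binomTail m * (S ω ^ (2 * m) * d n ω ^ 2 + d n ω ^ (2 * (m + 1)))) ∂P := by
              refine integral_mono (integrable_pow_of_memLp
                (fun q hq => (hd n q hq).add (hS q hq)) _) ?_ fun ω => ?_
              · exact i1.add (i2.const_mul _)
              · dsimp only
                rw [add_comm (d n ω)]
                exact add_pow_even_le m (S ω) (d n ω)
          _ = _ := by
              rw [integral_add i1 (i2.const_mul _), integral_add (hiS _) (hi1.const_mul _),
                integral_const_mul, h1, integral_const_mul, integral_add (hi2 _ _) (hid _), hm2]
              ring
      refine hstep.trans ?_
      rw [Finset.card_insert_of_notMem hnI]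
      set c : ℝ := (I.card : ℝ)
      have hc : 0 ≤ c := Nat.cast_nonneg _
      have e1 : ∫ ω, S ω ^ (2 * m) ∂P ≤ momentConst D m * (c + 1) ^ m :=
        (ihm I hI').trans (by gcongr; linarith)
      have e2 : ∫ ω, d n ω ^ 2 ∂P ≤ D 1 := by simpa using hD 1 n
      have e20 : 0 ≤ ∫ ω, d n ω ^ 2 ∂P := integral_nonneg fun ω => by positivity
      have e3 : 1 ≤ (c + 1) ^ m := one_le_pow₀ (by linarith)
      calc ∫ ω, S ω ^ (2 * (m + 1)) ∂P +
          binomTail m * ((∫ ω, S ω ^ (2 * m) ∂P) * (∫ ω, d n ω ^ 2 ∂P) +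
            ∫ ω, d n ω ^ (2 * (m + 1)) ∂P)
          ≤ momentConst D (m + 1) * c ^ (m + 1) + binomTail m *
            ((momentConst D m * (c + 1) ^ m) * D 1 + D (m + 1) * (c + 1) ^ m) := by
            have := binomTail_nonneg m
            have := hD0 1
            gcongr
            · exact ih hI'
            · exact (hD (m + 1) n).trans (le_mul_of_one_le_right (hD0 _) e3)
        _ = momentConst D (m + 1) * (c ^ (m + 1) + (c + 1) ^ m) := by
            simp only [momentConst]
            ring
        -- The inner induction closes because `c^{m+1} + (c+1)^m ≤ (c+1)^{m+1}`.
        _ ≤ momentConst D (m + 1) * ((I.card + 1 : ℕ) : ℝ) ^ (m + 1) := by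
            gcongr
            push_cast
            have : c ^ m ≤ (c + 1) ^ m := by gcongr; linarith
            rw [pow_succ, pow_succ]
            nlinarith

theorem integral_pow_even_le_of_eLpNorm_le {P : Measure Ω} {x : Ω → ℝ} {m : ℕ} (hm : m ≠ 0)
    (hx : MemLp x (2 * m : ℕ) P) {C : ℝ} (hC : 0 ≤ C)
    (h : eLpNorm x (2 * m : ℕ) P ≤ ENNReal.ofReal C) : ∫ ω, x ω ^ (2 * m) ∂P ≤ C ^ (2 * m) := by
  have h1 := hx.eLpNorm_eq_integral_rpow_norm (by simpa using hm) (ENNReal.natCast_ne_top _)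
  rw [h1, ENNReal.ofReal_le_ofReal_iff hC] at h
  have h2 : ∀ ω, ‖x ω‖ ^ ((2 * m : ℕ) : ℝ≥0∞).toReal = x ω ^ (2 * m) := by
    intro ω
    rw [ENNReal.toReal_natCast, Real.rpow_natCast, Real.norm_eq_abs, Even.pow_abs (even_two_mul m)]
  simp only [h2] at h
  simp only [ENNReal.toReal_natCast] at h
  have h3 : 0 ≤ ∫ ω, x ω ^ (2 * m) ∂P :=
    integral_nonneg fun ω => by simp only [Pi.zero_apply, pow_mul]; positivity
  calc ∫ ω, x ω ^ (2 * m) ∂P = ((∫ ω, x ω ^ (2 * m) ∂P) ^ (((2 * m : ℕ) : ℝ)⁻¹)) ^ (2 * m) := by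
        rw [Real.rpow_inv_natCast_pow h3 (by omega)]
    _ ≤ C ^ (2 * m) := by gcongr

theorem eLpNorm_le_of_integral_pow_even_le {P : Measure Ω} {x : Ω → ℝ} {m : ℕ} (hm : m ≠ 0)
    (hx : MemLp x (2 * m : ℕ) P) {C : ℝ} (hC : 0 ≤ C)
    (h : ∫ ω, x ω ^ (2 * m) ∂P ≤ C ^ (2 * m)) : eLpNorm x (2 * m : ℕ) P ≤ ENNReal.ofReal C := by
  have h1 := hx.eLpNorm_eq_integral_rpow_norm (by simpa using hm) (ENNReal.natCast_ne_top _)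
  rw [h1, ENNReal.ofReal_le_ofReal_iff hC]
  have h2 : ∀ ω, ‖x ω‖ ^ ((2 * m : ℕ) : ℝ≥0∞).toReal = x ω ^ (2 * m) := by
    intro ω
    rw [ENNReal.toReal_natCast, Real.rpow_natCast, Real.norm_eq_abs, Even.pow_abs (even_two_mul m)]
  simp only [h2]
  simp only [ENNReal.toReal_natCast]
  have h3 : 0 ≤ ∫ ω, x ω ^ (2 * m) ∂P :=
    integral_nonneg fun ω => by simp only [Pi.zero_apply, pow_mul]; positivity
  calc (∫ ω, x ω ^ (2 * m) ∂P) ^ (((2 * m : ℕ) : ℝ)⁻¹) ≤ (C ^ (2 * m)) ^ (((2 * m : ℕ) : ℝ)⁻¹) := by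
        gcongr
    _ = C := Real.pow_rpow_inv_natCast hC (by omega)

/-- Moment inequality for sums over `J`-separated indices of centred variables, each of which is
independent of the sums over indices at least `J` before it; the constant depends only on the
bounds for the moments. -/
theorem exists_eLpNorm_separated_sum_le {B : ℕ → ℝ} (hB : ∀ m, 0 ≤ B m) {m : ℕ} (hm : m ≠ 0) :
    ∃ A : ℝ, 0 ≤ A ∧ ∀ (d : ℤ → Ω → ℝ) (J : ℤ) (κ : ℝ), 0 < κ →
      (∀ n (q : ℝ≥0∞), q ≠ ∞ → MemLp (d n) q P) → (∀ n, ∫ ω, d n ω ∂P = 0) →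
      (∀ n (I : Finset ℤ), (∀ i ∈ I, i + J ≤ n) → IndepFun (fun ω => ∑ i ∈ I, d i ω) (d n) P) →
      (∀ m n, m ≠ 0 → eLpNorm (d n) (2 * m : ℕ) P ≤ ENNReal.ofReal (B m * κ)) →
      ∀ I : Finset ℤ, (∀ i ∈ I, ∀ j ∈ I, i < j → i + J ≤ j) →
      eLpNorm (fun ω => ∑ i ∈ I, d i ω) (2 * m : ℕ) P ≤
        ENNReal.ofReal (A * κ * √(I.card : ℝ)) := by
  -- The norm bounds are assumed for `m ≠ 0` only; the zeroth moment is 1.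
  set D : ℕ → ℝ := fun m => if m = 0 then 1 else B m ^ (2 * m)
  have hD0 : ∀ m, 0 ≤ D m := by
    intro m
    simp only [D]
    split_ifs
    · exact zero_le_one
    · have := hB m
      positivity
  have hMC := momentConst_nonneg hD0 m
  refine ⟨momentConst D m ^ (((2 * m : ℕ) : ℝ)⁻¹), by positivity,
    fun d J κ hκ hd h0 hind hb I hI => ?_⟩
  have hS : ∀ q : ℝ≥0∞, q ≠ ∞ → MemLp (fun ω => ∑ i ∈ I, d i ω) q P := fun q hq =>
    memLp_finsetSum I fun i _ => hd i q hq
  refine eLpNorm_le_of_integral_pow_even_le hm (hS _ (ENNReal.natCast_ne_top _)) (by positivity) ?_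
  -- Dividing by `κ` makes the moment bounds independent of it, so the constant depends on `B`
  -- alone; homogeneity restores `κ` afterwards.
  have key := integral_sum_pow_even_le (P := P) (d := fun n ω => κ⁻¹ * d n ω) (D := D) J
    (fun n q hq => (hd n q hq).const_mul _)
    (fun n => by rw [integral_const_mul, h0, mul_zero])
    (fun n I hI => by
      simp_rw [← Finset.mul_sum]
      exact (hind n I hI).comp (φ := fun x => κ⁻¹ * x) (ψ := fun x => κ⁻¹ * x)
        (by fun_prop) (by fun_prop))
    (fun k n => by
      by_cases hk : k = 0
      · simp [hk, D]
      · simp only [D, if_neg hk, mul_pow]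
        rw [integral_const_mul]
        have h1 := integral_pow_even_le_of_eLpNorm_le hk (hd n _ (ENNReal.natCast_ne_top _))
          (mul_nonneg (hB k) hκ.le) (hb k n hk)
        calc κ⁻¹ ^ (2 * k) * ∫ ω, d n ω ^ (2 * k) ∂P ≤ κ⁻¹ ^ (2 * k) * (B k * κ) ^ (2 * k) := by
              gcongr
          _ = B k ^ (2 * k) := by rw [mul_pow, inv_pow]; field_simp) I hI m
  simp_rw [← Finset.mul_sum, mul_pow] at key
  rw [integral_const_mul] at key
  have hc : √(I.card : ℝ) ^ (2 * m) = (I.card : ℝ) ^ m := by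
    rw [pow_mul, Real.sq_sqrt (Nat.cast_nonneg _)]
  rw [mul_pow, mul_pow, Real.rpow_inv_natCast_pow hMC (by omega), hc]
  calc ∫ ω, (∑ i ∈ I, d i ω) ^ (2 * m) ∂P
      = κ ^ (2 * m) * (κ⁻¹ ^ (2 * m) * ∫ ω, (∑ i ∈ I, d i ω) ^ (2 * m) ∂P) := by
        rw [inv_pow]; field_simp
    _ ≤ κ ^ (2 * m) * (momentConst D m * (I.card : ℝ) ^ m) := by gcongr
    _ = _ := by ring

end ECF

/-! ### The discounted past of the noise as an element of `ℓ¹`. -/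

namespace ECF

/-- Absolutely summable sequences; they hold the discounted past of a noise sequence. -/
abbrev Hist : Type := lp (fun _ : ℕ => ℝ) 1

theorem Hist.hasSum_norm (f : Hist) : HasSum (fun m => ‖f m‖) ‖f‖ := by
  simpa using lp.hasSum_norm (p := 1) (by simp) f

theorem memℓp_one_of_summable {f : ℕ → ℝ} (hf : Summable fun m => |f m|) :
    Memℓp (E := fun _ : ℕ => ℝ) f 1 :=
  memℓp_gen (by simpa using hf)

open Classical in
/-- The sequence `ρ^m x_m`, if it is absolutely summable. -/
noncomputable def discount (ρ : ℝ) (x : ℕ → ℝ) : Hist :=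
  if h : Summable fun m => |ρ ^ m * x m| then ⟨fun m => ρ ^ m * x m, memℓp_one_of_summable h⟩ else 0

theorem discount_apply {ρ : ℝ} {x : ℕ → ℝ} (h : Summable fun m => |ρ ^ m * x m|) (m : ℕ) :
    discount ρ x m = ρ ^ m * x m := by
  rw [discount, dif_pos h]

/-- The first `j` terms of the discounted sequence. -/
noncomputable def discountTrunc (ρ : ℝ) (j : ℕ) (x : ℕ → ℝ) : Hist :=
  ∑ m ∈ Finset.range j, x m • lp.single 1 m (ρ ^ m)

/-- Only finitely many coordinates enter, so continuity holds for the product topology.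
Measurability of the truncated pasts follows, and that of the full past by an almost sure limit. -/
theorem continuous_discountTrunc (ρ : ℝ) (j : ℕ) : Continuous (discountTrunc ρ j) :=
  continuous_finsetSum _ fun m _ => (continuous_apply m).smul continuous_const

theorem discountTrunc_apply (ρ : ℝ) (j : ℕ) (x : ℕ → ℝ) (m : ℕ) :
    discountTrunc ρ j x m = if m < j then ρ ^ m * x m else 0 := by
  have h : discountTrunc ρ j x m =
      ∑ i ∈ Finset.range j, x i * (lp.single 1 i (ρ ^ i) : Hist) m := by
    rw [discountTrunc, lp.coeFn_sum, Finset.sum_apply]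
    rfl
  rw [h]
  simp only [lp.single_apply, Pi.single_apply, mul_ite, mul_zero, Finset.sum_ite_eq,
    Finset.mem_range, mul_comm]

theorem norm_discountTrunc_le {ρ : ℝ} {x : ℕ → ℝ} (h : Summable fun m => |ρ ^ m * x m|) (j : ℕ) :
    ‖discountTrunc ρ j x‖ ≤ ‖discount ρ x‖ := by
  refine hasSum_le (fun m => ?_) (discountTrunc ρ j x).hasSum_norm (discount ρ x).hasSum_norm
  rw [discountTrunc_apply, discount_apply h]
  split_ifs
  · exact le_rfl
  · rw [norm_zero]
    exact norm_nonneg _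

theorem norm_discountTrunc (ρ : ℝ) (j : ℕ) (x : ℕ → ℝ) :
    ‖discountTrunc ρ j x‖ = ∑ m ∈ Finset.range j, |ρ ^ m * x m| := by
  refine (discountTrunc ρ j x).hasSum_norm.unique ?_
  have h : ∑ m ∈ Finset.range j, |ρ ^ m * x m| =
      ∑ m ∈ Finset.range j, ‖discountTrunc ρ j x m‖ := by
    refine Finset.sum_congr rfl fun m hm => ?_
    rw [discountTrunc_apply, if_pos (Finset.mem_range.1 hm), Real.norm_eq_abs]
  rw [h]
  refine hasSum_sum_of_ne_finset_zero fun m hm => ?_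
  rw [discountTrunc_apply, if_neg (by simpa using hm), norm_zero]

/-- The error of truncation is the tail from index `j` on; reindexing it extracts the factor `ρ^j`.
This is the source of geometric forgetting. -/
theorem norm_discount_sub_discountTrunc {ρ : ℝ} (hρ : 0 ≤ ρ) {x : ℕ → ℝ} (j : ℕ)
    (h : Summable fun m => |ρ ^ m * x m|) (h' : Summable fun m => |ρ ^ m * x (m + j)|) :
    ‖discount ρ x - discountTrunc ρ j x‖ = ρ ^ j * ‖discount ρ fun m => x (m + j)‖ := by
  have h1 := (discount ρ x - discountTrunc ρ j x).hasSum_norm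
  have h2 : ∀ m, ‖(discount ρ x - discountTrunc ρ j x) m‖ =
      if m < j then 0 else |ρ ^ m * x m| := by
    intro m
    rw [lp.coeFn_sub, Pi.sub_apply, discountTrunc_apply, discount_apply h]
    split_ifs <;> simp
  simp_rw [h2] at h1
  rw [← hasSum_nat_add_iff' j] at h1
  have h3 : ∑ m ∈ Finset.range j, (if m < j then 0 else |ρ ^ m * x m|) = 0 :=
    Finset.sum_eq_zero fun m hm => if_pos (Finset.mem_range.1 hm)
  rw [h3, sub_zero] at h1
  refine h1.unique ?_
  have h4 := (discount ρ fun m => x (m + j)).hasSum_norm.mul_left (ρ ^ j)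
  refine h4.congr_fun fun m => ?_
  rw [if_neg (by omega), discount_apply h', Real.norm_eq_abs, abs_mul, abs_mul, pow_add, abs_mul,
    abs_of_nonneg (pow_nonneg hρ j)]
  ring

theorem tendsto_discountTrunc {ρ : ℝ} {x : ℕ → ℝ} (h : Summable fun m => |ρ ^ m * x m|) :
    Tendsto (fun j => ‖discountTrunc ρ j x‖) atTop (𝓝 ‖discount ρ x‖) := by
  simp_rw [norm_discountTrunc]
  have := (discount ρ x).hasSum_norm
  simp only [discount_apply h, Real.norm_eq_abs] at this
  exact this.tendsto_sum_nat

/-! ### The discounted past of a noise sequence -/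

variable {Ω : Type*} [MeasurableSpace Ω] {P : Measure Ω}

/-- The values of `e` before time `n`, the most recent one first. -/
def past (e : ℤ → ℝ) (n : ℤ) : ℕ → ℝ := fun m => e (n - 1 - m)

theorem past_add (e : ℤ → ℝ) (n : ℤ) (j : ℕ) :
    (fun m => past e n (m + j)) = past e (n - j) := by
  ext m
  simp only [past]
  congr 1
  push_cast
  ring

/-- The discounted past of the noise `e` at time `n`. -/
noncomputable def noisePast (ρ : ℝ) (e : ℤ → Ω → ℝ) (n : ℤ) (ω : Ω) : Hist :=
  discount ρ (past (fun i => e i ω) n)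

/-- The discounted past of the noise `e` at time `n`, truncated to `j` terms. -/
noncomputable def noisePastTrunc (ρ : ℝ) (e : ℤ → Ω → ℝ) (j : ℕ) (n : ℤ) (ω : Ω) : Hist :=
  discountTrunc ρ j (past (fun i => e i ω) n)

namespace IsNoise

variable {e : ℤ → Ω → ℝ} {ρ : ℝ}

theorem boundedInM (he : IsNoise P e) : BoundedInM P e (fun _ => 1) := by
  refine ⟨fun n => (he.measurable n).aestronglyMeasurable, fun q _ hq' => ?_⟩
  refine ⟨(eLpNorm (e 0) q P).toReal, ENNReal.toReal_nonneg, fun n => ?_⟩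
  rw [mul_one, ENNReal.ofReal_toReal (he.memLp 0 q hq').eLpNorm_ne_top,
    (he.identDistrib n).eLpNorm_eq]

theorem measurable_past (he : IsNoise P e) (n : ℤ) :
    Measurable (fun ω => past (fun i => e i ω) n) :=
  measurable_pi_iff.2 fun _ => he.measurable _

theorem aestronglyMeasurable_noisePastTrunc (he : IsNoise P e) (j : ℕ) (n : ℤ) :
    AEStronglyMeasurable (noisePastTrunc ρ e j n) P :=
  ((continuous_discountTrunc ρ j).stronglyMeasurable.comp_measurable
    (he.measurable_past n)).aestronglyMeasurable

/-- By Tonelli the expected absolute sum is at most `C ∑ ρ^m`. -/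
theorem ae_summable [IsProbabilityMeasure P] (he : IsNoise P e) (hρ0 : 0 ≤ ρ) (hρ1 : ρ < 1) :
    ∀ᵐ ω ∂P, ∀ n, Summable fun m => |ρ ^ m * past (fun i => e i ω) n m| := by
  rw [ae_all_iff]
  intro n
  obtain ⟨C, hC, hb⟩ := he.boundedInM.bound 1 le_rfl (by simp)
  have hm : ∀ m : ℕ, Measurable fun ω => ENNReal.ofReal |ρ ^ m * past (fun i => e i ω) n m| :=
    fun m => by
      have := he.measurable (n - 1 - m)
      simp only [past]
      fun_prop
  have h1 : ∫⁻ ω, ∑' m : ℕ, ENNReal.ofReal |ρ ^ m * past (fun i => e i ω) n m| ∂P ≠ ∞ := by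
    rw [lintegral_tsum fun m => (hm m).aemeasurable]
    have h2 : ∀ m : ℕ, ∫⁻ ω, ENNReal.ofReal |ρ ^ m * past (fun i => e i ω) n m| ∂P ≤
        ENNReal.ofReal (C * ρ ^ m) := by
      intro m
      have h3 := hb (n - 1 - m)
      rw [eLpNorm_one_eq_lintegral_enorm, mul_one] at h3
      simp_rw [abs_mul, ENNReal.ofReal_mul (abs_nonneg _)]
      rw [lintegral_const_mul' _ _ ENNReal.ofReal_ne_top, abs_of_nonneg (pow_nonneg hρ0 m),
        mul_comm C, ENNReal.ofReal_mul (pow_nonneg hρ0 m)]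
      gcongr
      simpa only [past, Real.enorm_eq_ofReal_abs] using h3
    refine ((ENNReal.tsum_le_tsum h2).trans_lt ?_).ne
    rw [← ENNReal.ofReal_tsum_of_nonneg (fun m => by positivity)
      ((summable_geometric_of_lt_one hρ0 hρ1).mul_left C)]
    exact ENNReal.ofReal_lt_top
  filter_upwards [ae_lt_top (Measurable.tsum hm) h1] with ω hω
  have h4 := ENNReal.summable_toReal hω.ne
  simpa only [ENNReal.toReal_ofReal (abs_nonneg _)] using h4

theorem ae_norm_sub [IsProbabilityMeasure P] (he : IsNoise P e) (hρ0 : 0 ≤ ρ) (hρ1 : ρ < 1) :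
    ∀ᵐ ω ∂P, ∀ n j, ‖noisePast ρ e n ω - noisePastTrunc ρ e j n ω‖ =
      ρ ^ j * ‖noisePast ρ e (n - j) ω‖ := by
  filter_upwards [he.ae_summable hρ0 hρ1] with ω hω n j
  rw [noisePast, noisePastTrunc, norm_discount_sub_discountTrunc hρ0 j (hω n) ?_, past_add,
    noisePast]
  simpa only [← past_add] using hω (n - j)

theorem ae_tendsto [IsProbabilityMeasure P] (he : IsNoise P e) (hρ0 : 0 ≤ ρ) (hρ1 : ρ < 1) :
    ∀ᵐ ω ∂P, ∀ n, Tendsto (fun j => noisePastTrunc ρ e j n ω) atTop (𝓝 (noisePast ρ e n ω)) := by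
  filter_upwards [he.ae_summable hρ0 hρ1] with ω hω n
  have h1 := (discount ρ (past (fun i => e i ω) n)).hasSum_norm
  simp only [discount_apply (hω n)] at h1
  rw [tendsto_iff_norm_sub_tendsto_zero]
  -- In `ℓ¹` the norm is additive over the disjoint supports of the truncation and the tail, so
  -- convergence of the norms is enough.
  have h3 : ∀ j, ‖noisePastTrunc ρ e j n ω - noisePast ρ e n ω‖ =
      ‖noisePast ρ e n ω‖ - ‖noisePastTrunc ρ e j n ω‖ := by
    intro j
    refine (noisePastTrunc ρ e j n ω - noisePast ρ e n ω).hasSum_norm.unique ?_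
    refine ((noisePast ρ e n ω).hasSum_norm.sub
      (noisePastTrunc ρ e j n ω).hasSum_norm).congr_fun fun m => ?_
    rw [lp.coeFn_sub, Pi.sub_apply, noisePast, noisePastTrunc, discountTrunc_apply,
      discount_apply (hω n)]
    split_ifs <;> simp
  simp_rw [h3]
  simpa only [noisePast, noisePastTrunc, sub_self] using
    (tendsto_discountTrunc (hω n)).const_sub ‖noisePast ρ e n ω‖

theorem aestronglyMeasurable_noisePast [IsProbabilityMeasure P] (he : IsNoise P e)
    (hρ0 : 0 ≤ ρ) (hρ1 : ρ < 1) (n : ℤ) :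
    AEStronglyMeasurable (noisePast ρ e n) P :=
  aestronglyMeasurable_of_tendsto_ae atTop
    (fun j => he.aestronglyMeasurable_noisePastTrunc (ρ := ρ) j n)
    ((he.ae_tendsto hρ0 hρ1).mono fun _ hω => hω n)

/-- Minkowski's inequality and the geometric series bound all truncations uniformly; Fatou's lemma
passes to the limit. -/
theorem boundedInM_noisePast [IsProbabilityMeasure P] (he : IsNoise P e)
    (hρ0 : 0 ≤ ρ) (hρ1 : ρ < 1) :
    BoundedInM P (noisePast ρ e) (fun _ => 1) := by
  refine ⟨he.aestronglyMeasurable_noisePast hρ0 hρ1, fun q hq hq' => ?_⟩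
  obtain ⟨C, hC, hb⟩ := he.boundedInM.bound q hq hq'
  have h1ρ : 0 < 1 - ρ := by linarith
  refine ⟨C * (1 - ρ)⁻¹, by positivity, fun n => ?_⟩
  have htr : ∀ j, eLpNorm (noisePastTrunc ρ e j n) q P ≤ ENNReal.ofReal (C * (1 - ρ)⁻¹ * 1) := by
    intro j
    have h1 : eLpNorm (noisePastTrunc ρ e j n) q P =
        eLpNorm (fun ω => ∑ m ∈ Finset.range j, |ρ ^ m * e (n - 1 - m) ω|) q P := by
      rw [← eLpNorm_norm]
      simp only [noisePastTrunc, norm_discountTrunc, past]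
    have hmeas : ∀ m : ℕ, AEStronglyMeasurable (fun ω => |ρ ^ m * e (n - 1 - m) ω|) P := fun m => by
      have := he.measurable (n - 1 - m)
      exact (by fun_prop : Measurable _).aestronglyMeasurable
    have h2 : ∀ m : ℕ, eLpNorm (fun ω => |ρ ^ m * e (n - 1 - m) ω|) q P ≤
        ENNReal.ofReal (C * ρ ^ m) := by
      intro m
      refine (eLpNorm_le_mul_eLpNorm_of_ae_le_mul (g := e (n - 1 - m)) (c := ρ ^ m)
        (ae_of_all _ fun ω => ?_) q).trans ?_
      · rw [Real.norm_eq_abs, abs_abs, abs_mul, abs_of_nonneg (pow_nonneg hρ0 m), Real.norm_eq_abs]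
      · rw [mul_comm C, ENNReal.ofReal_mul (pow_nonneg hρ0 m)]
        gcongr
        simpa using hb (n - 1 - m)
    rw [h1]
    have h3 := eLpNorm_sum_le (s := Finset.range j)
      (f := fun (m : ℕ) ω => |ρ ^ m * e (n - 1 - m) ω|) (fun m _ => hmeas m) hq
    have h4 : (∑ m ∈ Finset.range j, fun ω => |ρ ^ m * e (n - 1 - (m : ℤ)) ω|) =
        fun ω => ∑ m ∈ Finset.range j, |ρ ^ m * e (n - 1 - m) ω| := by
      ext ω
      simp
    rw [h4] at h3
    refine h3.trans ((Finset.sum_le_sum fun m _ => h2 m).trans ?_)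
    rw [← ENNReal.ofReal_sum_of_nonneg (fun m _ => by positivity)]
    refine ENNReal.ofReal_le_ofReal ?_
    rw [← Finset.mul_sum, mul_one]
    gcongr
    rw [← tsum_geometric_of_lt_one hρ0 hρ1]
    exact (summable_geometric_of_lt_one hρ0 hρ1).sum_le_tsum _ fun m _ => by positivity
  refine (Lp.eLpNorm_lim_le_liminf_eLpNorm
    (fun j => he.aestronglyMeasurable_noisePastTrunc (ρ := ρ) j n) _
    ((he.ae_tendsto hρ0 hρ1).mono fun _ hω => hω n)).trans ?_
  exact liminf_le_of_le (by isBoundedDefault) fun b hb => by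
    obtain ⟨j, hj⟩ := hb.exists
    exact hj.trans (htr j)

/-- Stationarity: whatever the time, the past has the law of an i.i.d. sequence, a product measure.
-/
theorem map_past (he : IsNoise P e) (n : ℤ) :
    P.map (fun ω => past (fun i => e i ω) n) = P.map (fun ω => past (fun i => e i ω) 0) := by
  have h : ∀ n : ℤ, P.map (fun ω => past (fun i => e i ω) n) =
      Measure.infinitePi fun _ : ℕ => P.map (e 0) := by
    intro n
    have hinj : Function.Injective fun m : ℕ => n - 1 - (m : ℤ) := fun a b hab => by
      simp only at hab
      omega
    have h1 := (he.indep.precomp hinj).map_fun_eq_infinitePi_map (fun m => he.measurable _)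
    simp only [(he.identDistrib _).map_eq] at h1
    exact h1
  rw [h n, h 0]

end IsNoise

end ECF

/-! ### Functionals of the discounted past and their time averages. -/

namespace ECF

variable {G G' : Type*} [NormedAddCommGroup G] [NormedAddCommGroup G']

/-- Local Lipschitz continuity with a constant growing at most polynomially. -/
def PolyLip (Φ : Hist → G) : Prop :=
  ∃ (C : ℝ) (k : ℕ), 0 ≤ C ∧ ∀ a b, ‖Φ a - Φ b‖ ≤ C * (1 + ‖a‖ + ‖b‖) ^ k * ‖a - b‖

theorem PolyLip.continuous {Φ : Hist → G} (hΦ : PolyLip Φ) : Continuous Φ := by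
  obtain ⟨C, k, hC, h⟩ := hΦ
  refine continuous_iff_continuousAt.2 fun a => ?_
  refine tendsto_iff_norm_sub_tendsto_zero.2 ?_
  refine squeeze_zero (fun b => norm_nonneg _) (fun b => h b a) ?_
  have : Continuous fun b : Hist => C * (1 + ‖b‖ + ‖a‖) ^ k * ‖b - a‖ := by fun_prop
  simpa using this.tendsto a

variable [NormedSpace ℝ G] [NormedSpace ℝ G']

theorem PolyLip.clm_comp {Φ : Hist → G} (hΦ : PolyLip Φ) (f : G →L[ℝ] G') :
    PolyLip fun a => f (Φ a) := by
  obtain ⟨C, k, hC, h⟩ := hΦ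
  refine ⟨‖f‖ * C, k, by positivity, fun a b => ?_⟩
  rw [← map_sub, mul_assoc, mul_assoc]
  refine (f.le_opNorm _).trans (mul_le_mul_of_nonneg_left ?_ (norm_nonneg _))
  rw [← mul_assoc]
  exact h a b

variable {Ω : Type*} [MeasurableSpace Ω] {P : Measure Ω} [IsProbabilityMeasure P]
  {e : ℤ → Ω → ℝ} {ρ : ℝ}

theorem PolyLip.aestronglyMeasurable_noisePast {G : Type*} [NormedAddCommGroup G]
    (he : IsNoise P e) (hρ0 : 0 ≤ ρ) (hρ1 : ρ < 1)
    {Φ : Hist → G} (hΦ : PolyLip Φ) (n : ℤ) :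
    AEStronglyMeasurable (fun ω => Φ (noisePast ρ e n ω)) P :=
  hΦ.continuous.comp_aestronglyMeasurable (he.aestronglyMeasurable_noisePast hρ0 hρ1 n)

theorem boundedInM_mul_one_add_norm_pow (he : IsNoise P e) (hρ0 : 0 ≤ ρ) (hρ1 : ρ < 1) (C c : ℝ)
    (k : ℕ) : BoundedInM P (fun n ω => C * (1 + c * ‖noisePast ρ e n ω‖) ^ k) (fun _ => 1) := by
  have h1 := (he.boundedInM_noisePast hρ0 hρ1).norm
  have h2 : BoundedInM P (fun n ω => c * ‖noisePast ρ e n ω‖) (fun _ => 1) :=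
    h1.clm_comp (ContinuousLinearMap.mul ℝ ℝ c)
  exact (((BoundedInM.const_one (1 : ℝ)).add (fun _ => zero_le_one) h2).pow k).clm_comp
    (ContinuousLinearMap.mul ℝ ℝ C)

/-- Since truncation does not increase the norm, the error is at most `C (1 + 2‖past at n‖)^k ρ^j
‖past at n - j‖`, and both random factors have all moments bounded uniformly in `n` and `j`. -/
theorem PolyLip.boundedInM_sub {G : Type*} [NormedAddCommGroup G]
    (he : IsNoise P e) (hρ0 : 0 ≤ ρ) (hρ1 : ρ < 1)
    {Φ : Hist → G} (hΦ : PolyLip Φ) :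
    BoundedInM P (fun (p : ℤ × ℕ) ω => Φ (noisePast ρ e p.1 ω) - Φ (noisePastTrunc ρ e p.2 p.1 ω))
      (fun p => ρ ^ p.2) := by
  have hcont := hΦ.continuous
  have hm := fun n => hΦ.aestronglyMeasurable_noisePast he hρ0 hρ1 n
  obtain ⟨C, k, hC, h⟩ := hΦ
  have h1 := (boundedInM_mul_one_add_norm_pow he hρ0 hρ1 C 2 k).comp (Prod.fst : ℤ × ℕ → ℤ)
  have h2 := (he.boundedInM_noisePast hρ0 hρ1).norm.comp (fun p : ℤ × ℕ => p.1 - p.2)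
  have h3 : BoundedInM P (fun (p : ℤ × ℕ) ω => ρ ^ p.2 * ‖noisePast ρ e (p.1 - p.2) ω‖)
      (fun p => ρ ^ p.2) := by
    refine ⟨fun p => (h2.meas p).const_mul _, fun q hq hq' => ?_⟩
    obtain ⟨B, hB, hb⟩ := h2.bound q hq hq'
    refine ⟨B, hB, fun p => ?_⟩
    refine (eLpNorm_le_mul_eLpNorm_of_ae_le_mul (c := ρ ^ p.2) (ae_of_all _ fun ω => ?_) q).trans
      (?_ : _ * eLpNorm (fun ω => ‖noisePast ρ e (p.1 - p.2) ω‖) q P ≤ _)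
    · rw [norm_mul, norm_pow, Real.norm_of_nonneg hρ0]
    · rw [mul_comm B, ENNReal.ofReal_mul (pow_nonneg hρ0 _)]
      gcongr
      simpa using hb p
  refine BoundedInM.of_norm_le (fun p => (hm p.1).sub
    (hcont.comp_aestronglyMeasurable (he.aestronglyMeasurable_noisePastTrunc p.2 p.1)))
    (by simpa using BoundedInM.mul (fun _ => zero_le_one) h1 h3) ?_
  filter_upwards [he.ae_norm_sub hρ0 hρ1, he.ae_summable hρ0 hρ1] with ω hω hs p
  have hle : ‖noisePastTrunc ρ e p.2 p.1 ω‖ ≤ ‖noisePast ρ e p.1 ω‖ :=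
    norm_discountTrunc_le (hs p.1) p.2
  refine (h _ _).trans (le_trans ?_ (le_abs_self _))
  rw [hω p.1 p.2]
  have hsum : 1 + ‖noisePast ρ e p.1 ω‖ + ‖noisePastTrunc ρ e p.2 p.1 ω‖ ≤
      1 + 2 * ‖noisePast ρ e p.1 ω‖ := by linarith
  gcongr C * ?_ ^ k * _

theorem PolyLip.boundedInM (he : IsNoise P e) (hρ0 : 0 ≤ ρ) (hρ1 : ρ < 1)
    {Φ : Hist → G} (hΦ : PolyLip Φ) :
    BoundedInM P (fun n ω => Φ (noisePast ρ e n ω)) (fun _ => 1) := by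
  -- Truncation to zero terms is the zero sequence, so this bounds `Φ(past) - Φ 0`.
  have h1 := (hΦ.boundedInM_sub he hρ0 hρ1).comp (fun n : ℤ => (n, 0))
  refine (BoundedInM.add (fun _ => by simp) h1 (BoundedInM.mono (BoundedInM.const_one (Φ 0))
    fun n => by simp)).congr (ae_of_all _ fun ω n => ?_) |>.mono fun n => by simp
  simp [noisePastTrunc, discountTrunc]

theorem PolyLip.integrable (he : IsNoise P e) (hρ0 : 0 ≤ ρ) (hρ1 : ρ < 1)
    {Φ : Hist → G} (hΦ : PolyLip Φ) (n : ℤ) : Integrable (fun ω => Φ (noisePast ρ e n ω)) P :=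
  memLp_one_iff_integrable.1 ((hΦ.boundedInM he hρ0 hρ1).memLp n (by simp))

/-- The equality of laws in `map_past` is transported through the truncations, which are continuous
on sequence space, and survives the limit in `j`. -/
theorem PolyLip.integral_eq (he : IsNoise P e) (hρ0 : 0 ≤ ρ) (hρ1 : ρ < 1) {Φ : Hist → G}
    (hΦ : PolyLip Φ) (n n' : ℤ) :
    ∫ ω, Φ (noisePast ρ e n ω) ∂P = ∫ ω, Φ (noisePast ρ e n' ω) ∂P := by
  have hb := hΦ.boundedInM_sub he hρ0 hρ1
  have hi := hΦ.integrable he hρ0 hρ1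
  have hiT : ∀ j n, Integrable (fun ω => Φ (noisePastTrunc ρ e j n ω)) P := fun j n => by
    have := (hi n).sub (memLp_one_iff_integrable.1 (hb.memLp (n, j) (by simp)))
    simpa [Pi.sub_def] using this
  have hlim : ∀ n, Tendsto (fun j => ∫ ω, Φ (noisePastTrunc ρ e j n ω) ∂P) atTop
      (𝓝 (∫ ω, Φ (noisePast ρ e n ω) ∂P)) := by
    intro n
    obtain ⟨C, hC, h⟩ := (hb.integral).bound 1 le_rfl (by simp)
    refine tendsto_iff_norm_sub_tendsto_zero.2 (squeeze_zero (g := fun j => C * ρ ^ j)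
      (fun j => norm_nonneg _) (fun j => ?_) ?_)
    · have h1 := h (n, j)
      rw [eLpNorm_const _ one_ne_zero (IsProbabilityMeasure.ne_zero P), measure_univ,
        ENNReal.one_rpow, mul_one, integral_sub (hi n) (hiT j n), ← ofReal_norm,
        ENNReal.ofReal_le_ofReal_iff (mul_nonneg hC (pow_nonneg hρ0 _))] at h1
      rwa [norm_sub_rev]
    · simpa using (tendsto_pow_atTop_nhds_zero_of_lt_one hρ0 hρ1).const_mul C
  have heq : ∀ n j, ∫ ω, Φ (noisePastTrunc ρ e j n ω) ∂P =
      ∫ x, Φ (discountTrunc ρ j x) ∂(P.map fun ω => past (fun i => e i ω) 0) := by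
    intro n j
    rw [← he.map_past n]
    exact (integral_map (f := fun x => Φ (discountTrunc ρ j x)) (he.measurable_past n).aemeasurable
      (hΦ.continuous.comp (continuous_discountTrunc ρ j)).aestronglyMeasurable).symm
  refine tendsto_nhds_unique (hlim n) ?_
  simp_rw [heq n, ← heq n']
  exact hlim n'

/-- The variable at time `i` uses the noise at times in `[i - J, i)` only; these windows lie before
`n - J` when `i + J ≤ n`. -/
theorem IsNoise.indepFun_sum_window {P : Measure Ω} (he : IsNoise P e) {J : ℕ} {ψ : (ℕ → ℝ) → ℝ}
    (hψ : Measurable ψ) (hψJ : ∀ x y, (∀ m < J, x m = y m) → ψ x = ψ y) (n : ℤ) (I : Finset ℤ)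
    (hI : ∀ i ∈ I, i + J ≤ n) :
    IndepFun (fun ω => ∑ i ∈ I, ψ (past (fun i => e i ω) i)) (fun ω => ψ (past (fun i => e i ω) n))
      P := by
  classical
  set S : Finset ℤ := I.biUnion fun i => Finset.Ico (i - J) i
  set T : Finset ℤ := Finset.Ico (n - J) n
  have hST : Disjoint S T := by
    rw [Finset.disjoint_left]
    intro a ha hb
    simp only [S, T, Finset.mem_biUnion, Finset.mem_Ico] at ha hb
    obtain ⟨i, hi, h1, h2⟩ := ha
    have := hI i hi
    omega
  -- Extending by zero turns a function of the whole past into a function of the finitely many noise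
  -- values in `U`.
  let ext (U : Finset ℤ) (y : U → ℝ) (i : ℤ) : ℝ := if h : i ∈ U then y ⟨i, h⟩ else 0
  have hext : ∀ (U : Finset ℤ) (i : ℤ), Measurable fun y : U → ℝ => past (ext U y) i := by
    intro U i
    refine measurable_pi_iff.2 fun m => ?_
    simp only [past, ext]
    split_ifs
    · exact measurable_pi_apply _
    · exact measurable_const
  have hwin : ∀ (U : Finset ℤ) (i : ℤ), Finset.Ico (i - J) i ⊆ U → ∀ ω,
      ψ (past (ext U fun a : U => e a ω) i) = ψ (past (fun i => e i ω) i) := by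
    intro U i hU ω
    refine hψJ _ _ fun m hm => ?_
    have : i - 1 - (m : ℤ) ∈ U := hU (by simp only [Finset.mem_Ico]; omega)
    simp only [past, ext, dif_pos this]
  have h := he.indep.indepFun_finset S T hST he.measurable
  have h2 := h.comp (φ := fun y => ∑ i ∈ I, ψ (past (ext S y) i))
      (ψ := fun y => ψ (past (ext T y) n))
    (Finset.measurable_sum _ fun i _ => hψ.comp (hext S i)) (hψ.comp (hext T n))
  convert h2 using 1
  · ext ω
    refine Finset.sum_congr rfl fun i hi => ?_
    exact (hwin S i (fun a ha => Finset.mem_biUnion.2 ⟨i, hi, ha⟩) ω).symm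
  · ext ω
    exact (hwin T n (fun a ha => ha) ω).symm

theorem discountTrunc_congr {j : ℕ} {x y : ℕ → ℝ} (h : ∀ m < j, x m = y m) :
    discountTrunc ρ j x = discountTrunc ρ j y :=
  Finset.sum_congr rfl fun m hm => by rw [h m (Finset.mem_range.1 hm)]

/-- Sums of a functional of the discounted past over `N` times deviate from their mean by
`O_M(√N)`. -/
theorem PolyLip.exists_eLpNorm_sum_sub_le (he : IsNoise P e) (hρ0 : 0 < ρ) (hρ1 : ρ < 1)
    {Φ : Hist → ℝ} (hΦ : PolyLip Φ) {m : ℕ} (hm : m ≠ 0) :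
    ∃ C : ℝ, 0 ≤ C ∧ ∀ I : Finset ℤ,
      eLpNorm (fun ω => ∑ n ∈ I, (Φ (noisePast ρ e n ω) - ∫ ω, Φ (noisePast ρ e n ω) ∂P))
        (2 * m : ℕ) P ≤ ENNReal.ofReal (C * √(I.card : ℝ)) := by
  set f : ℤ → Ω → ℝ := fun n ω => Φ (noisePast ρ e n ω)
  set g : ℕ → ℤ → Ω → ℝ := fun j n ω => Φ (noisePastTrunc ρ e j n ω)
  have hpos : ∀ p : ℤ × ℕ, 0 ≤ ρ ^ p.2 := fun p => pow_nonneg hρ0.le _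
  have hfg : BoundedInM P (fun (p : ℤ × ℕ) ω => f p.1 ω - g p.2 p.1 ω) (fun p => ρ ^ p.2) :=
    hΦ.boundedInM_sub he hρ0.le hρ1
  have hi : ∀ n, Integrable (f n) P := hΦ.integrable he hρ0.le hρ1
  have hig : ∀ j n, Integrable (g j n) P := fun j n => by
    have := (hi n).sub (memLp_one_iff_integrable.1 (hfg.memLp (n, j) (by simp)))
    simpa [Pi.sub_def] using this
  have hR : BoundedInM P (fun (p : ℤ × ℕ) ω => (f p.1 ω - g p.2 p.1 ω) -
      ∫ ω, (f p.1 ω - g p.2 p.1 ω) ∂P) (fun p => ρ ^ p.2) := hfg.sub hpos hfg.integral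
  -- The centred effect of remembering `j + 1` instead of `j` noise values: it is `O_M(ρ^j)` and has
  -- a window of length `j + 1`.
  set d : ℕ → ℤ → Ω → ℝ := fun j n ω => (g (j + 1) n ω - g j n ω) -
    ∫ ω, (g (j + 1) n ω - g j n ω) ∂P
  have hd : BoundedInM P (fun (p : ℤ × ℕ) ω => d p.2 p.1 ω) (fun p => ρ ^ p.2) := by
    have h1 : BoundedInM P (fun (p : ℤ × ℕ) ω => g (p.2 + 1) p.1 ω - g p.2 p.1 ω)
        (fun p => ρ ^ p.2) := by
      refine (hfg.sub hpos ((hfg.comp fun p : ℤ × ℕ => (p.1, p.2 + 1)).mono fun p => ?_)).congr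
        (ae_of_all _ fun ω p => ?_)
      · exact pow_le_pow_of_le_one hρ0.le hρ1.le (Nat.le_succ _)
      · dsimp only
        ring
    exact h1.sub hpos h1.integral
  -- The shift by one keeps the exponent at least 2; it is undone by `B (k - 1)` below.
  choose B hB hb using fun k : ℕ =>
    hd.bound (2 * (k + 1) : ℕ) (by norm_cast; omega) (ENNReal.natCast_ne_top _)
  obtain ⟨A, hA, hsum⟩ := exists_eLpNorm_separated_sum_le (P := P) (B := fun k => B (k - 1))
    (fun k => hB _) hm
  -- Distinct times in one residue class mod `j + 1` are at least a window apart, so the moment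
  -- inequality applies to each class; the factor `j + 1` counts the classes.
  have hres : ∀ (j : ℕ) (I : Finset ℤ), eLpNorm (fun ω => ∑ n ∈ I, d j n ω) (2 * m : ℕ) P ≤
      ENNReal.ofReal (((j : ℝ) + 1) * (A * ρ ^ j * √(I.card : ℝ))) := by
    intro j I
    have hmeas : ∀ n, AEStronglyMeasurable (d j n) P := fun n => hd.meas (n, j)
    have hclass : ∀ c ∈ Finset.Ico (0 : ℤ) (j + 1),
        eLpNorm (fun ω => ∑ n ∈ I with n % (j + 1 : ℤ) = c, d j n ω) (2 * m : ℕ) P ≤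
          ENNReal.ofReal (A * ρ ^ j * √(I.card : ℝ)) := by
      intro c _
      refine (hsum (d j) (j + 1) (ρ ^ j) (pow_pos hρ0 j) (fun n q hq => hd.memLp (n, j) hq)
        (fun n => ?_) (fun n I hI => ?_) (fun k n hk => ?_) _ ?_).trans ?_
      · simp only [d]
        rw [integral_sub (f := fun ω => g (j + 1) n ω - g j n ω) ((hig _ _).sub (hig _ _))
          (integrable_const _)]
        simp
      · have hψ : Measurable fun x => Φ (discountTrunc ρ (j + 1) x) - Φ (discountTrunc ρ j x) :=
          ((hΦ.continuous.comp (continuous_discountTrunc ρ (j + 1))).sub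
            (hΦ.continuous.comp (continuous_discountTrunc ρ j))).measurable
        have hind := he.indepFun_sum_window (J := j + 1) hψ (fun x y hxy => by
          rw [discountTrunc_congr hxy,
            discountTrunc_congr fun m hm => hxy m (hm.trans (Nat.lt_succ_self j))]) n I
          (fun i hi => by exact_mod_cast hI i hi)
        have := hind.comp
          (φ := fun x => x - ∑ i ∈ I, ∫ ω, (g (j + 1) i ω - g j i ω) ∂P)
          (ψ := fun x => x - ∫ ω, (g (j + 1) n ω - g j n ω) ∂P) (by fun_prop) (by fun_prop)
        simp only [d, Finset.sum_sub_distrib] at this ⊢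
        exact this
      · obtain ⟨k, rfl⟩ := Nat.exists_eq_succ_of_ne_zero hk
        exact hb k (n, j)
      · intro a ha b hb hab
        simp only [Finset.mem_filter] at ha hb
        have h1 : (j + 1 : ℤ) ∣ b - a := Int.ModEq.dvd (ha.2.trans hb.2.symm)
        have := Int.le_of_dvd (by omega) h1
        omega
      · gcongr
        exact Finset.filter_subset _ _
    have hsplit : (fun ω => ∑ n ∈ I, d j n ω) =
        ∑ c ∈ Finset.Ico (0 : ℤ) (j + 1), fun ω => ∑ n ∈ I with n % (j + 1 : ℤ) = c, d j n ω := by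
      ext ω
      rw [Finset.sum_apply, Finset.sum_fiberwise_of_maps_to]
      intro n _
      rw [Finset.mem_Ico]
      exact ⟨Int.emod_nonneg _ (by omega), Int.emod_lt_of_pos _ (by omega)⟩
    rw [hsplit]
    refine (eLpNorm_sum_le (fun c _ => ?_) (by norm_cast; omega)).trans
      ((Finset.sum_le_sum hclass).trans ?_)
    · exact Finset.aestronglyMeasurable_fun_sum _ fun n _ => hmeas n
    · rw [Finset.sum_const, nsmul_eq_mul, Int.card_Ico, sub_zero,
        show ((j + 1 : ℤ)).toNat = j + 1 by omega, ← ENNReal.ofReal_natCast,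
        ← ENNReal.ofReal_mul (Nat.cast_nonneg _)]
      push_cast
      exact le_rfl
  obtain ⟨B', hB', hb'⟩ := hR.bound (2 * m : ℕ) (by norm_cast; omega) (ENNReal.natCast_ne_top _)
  have hgeo : Summable fun j : ℕ => ((j : ℝ) + 1) * ρ ^ j := by
    simp_rw [add_mul, one_mul]
    refine Summable.add ?_ (summable_geometric_of_lt_one hρ0.le hρ1)
    simpa using summable_pow_mul_geometric_of_norm_lt_one 1
      (by rwa [Real.norm_of_nonneg hρ0.le] : ‖ρ‖ < 1)
  have hterm : ∀ j : ℕ, 0 ≤ ((j : ℝ) + 1) * ρ ^ j := fun j => by positivity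
  refine ⟨A * ∑' j : ℕ, ((j : ℝ) + 1) * ρ ^ j, mul_nonneg hA (tsum_nonneg hterm), fun I => ?_⟩
  -- Telescoping up to level `K`. The remainder is bounded without any cancellation by `card I · B'
  -- ρ^K`, which disappears as `K → ∞` with `I` fixed.
  have hK : ∀ K : ℕ, eLpNorm (fun ω => ∑ n ∈ I, (f n ω - ∫ ω, f n ω ∂P)) (2 * m : ℕ) P ≤
      ENNReal.ofReal (A * (∑' j : ℕ, ((j : ℝ) + 1) * ρ ^ j) * √(I.card : ℝ) +
        I.card * (B' * ρ ^ K)) := by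
    intro K
    have htel : ∀ n ω, f n ω - ∫ ω, f n ω ∂P = ∑ j ∈ Finset.range K, d j n ω +
        ((f n ω - g K n ω) - ∫ ω, (f n ω - g K n ω) ∂P) := by
      intro n ω
      have h1 : ∑ j ∈ Finset.range K, d j n ω = (g K n ω - g 0 n ω) -
          (∫ ω, g K n ω ∂P - ∫ ω, g 0 n ω ∂P) := by
        simp only [d]
        rw [Finset.sum_sub_distrib, Finset.sum_range_sub (fun j => g j n ω)]
        congr 1
        rw [← Finset.sum_range_sub (fun j => ∫ ω, g j n ω ∂P)]
        exact Finset.sum_congr rfl fun j _ => integral_sub (hig _ _) (hig _ _)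
      -- The lowest level of the telescope is deterministic and cancels after centring.
      have h2 : ∀ ω, g 0 n ω = Φ 0 := fun ω => by simp [g, noisePastTrunc, discountTrunc]
      rw [h1, integral_sub (hi n) (hig K n)]
      simp only [h2, integral_const, probReal_univ, one_smul]
      ring
    have hsplit : (fun ω => ∑ n ∈ I, (f n ω - ∫ ω, f n ω ∂P)) =
        (∑ j ∈ Finset.range K, fun ω => ∑ n ∈ I, d j n ω) +
          ∑ n ∈ I, fun ω => ((f n ω - g K n ω) - ∫ ω, (f n ω - g K n ω) ∂P) := by
      ext ω
      rw [Pi.add_apply, Finset.sum_apply, Finset.sum_apply, Finset.sum_comm,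
        ← Finset.sum_add_distrib]
      exact Finset.sum_congr rfl fun n _ => htel n ω
    have hone : (1 : ℝ≥0∞) ≤ (2 * m : ℕ) := by norm_cast; omega
    have hmd : ∀ j, AEStronglyMeasurable (fun ω => ∑ n ∈ I, d j n ω) P := fun j =>
      Finset.aestronglyMeasurable_fun_sum _ fun n _ => hd.meas (n, j)
    rw [hsplit]
    refine (eLpNorm_add_le (Finset.aestronglyMeasurable_sum _ fun j _ => hmd j)
      (Finset.aestronglyMeasurable_sum _ fun n _ => hR.meas (n, K)) hone).trans ?_
    rw [ENNReal.ofReal_add (by positivity) (by positivity)]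
    refine add_le_add ?_ ?_
    · refine (eLpNorm_sum_le (fun j _ => hmd j) hone).trans
        ((Finset.sum_le_sum fun j _ => hres j I).trans ?_)
      rw [← ENNReal.ofReal_sum_of_nonneg fun j _ => by positivity]
      refine ENNReal.ofReal_le_ofReal ?_
      calc ∑ j ∈ Finset.range K, ((j : ℝ) + 1) * (A * ρ ^ j * √(I.card : ℝ))
          = A * (∑ j ∈ Finset.range K, ((j : ℝ) + 1) * ρ ^ j) * √(I.card : ℝ) := by
            rw [Finset.mul_sum, Finset.sum_mul]
            exact Finset.sum_congr rfl fun j _ => by ring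
        _ ≤ _ := by
            gcongr
            exact hgeo.sum_le_tsum _ fun j _ => hterm j
    · refine (eLpNorm_sum_le (fun n _ => hR.meas (n, K)) hone).trans
        ((Finset.sum_le_sum fun n _ => hb' (n, K)).trans ?_)
      dsimp only
      rw [Finset.sum_const, nsmul_eq_mul, ← ENNReal.ofReal_natCast,
        ← ENNReal.ofReal_mul (Nat.cast_nonneg _)]
  refine ge_of_tendsto' (x := atTop) ?_ hK
  refine ENNReal.tendsto_ofReal ?_
  have h0 := ((tendsto_pow_atTop_nhds_zero_of_lt_one hρ0.le hρ1).const_mul B').const_mul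
    (I.card : ℝ)
  simpa using h0.const_add (A * (∑' j : ℕ, ((j : ℝ) + 1) * ρ ^ j) * √(I.card : ℝ))

/-! ### Averages -/

/-- The rate `N^{-1/2}`, with the value `1` at `N = 0`. -/
noncomputable def rate (N : ℕ) : ℝ := if N = 0 then 1 else (√(N : ℝ))⁻¹

theorem rate_nonneg (N : ℕ) : 0 ≤ rate N := by
  unfold rate
  split_ifs <;> positivity

theorem rate_le_one (N : ℕ) : rate N ≤ 1 := by
  unfold rate
  split_ifs with h
  · exact le_rfl
  · refine inv_le_one_of_one_le₀ (Real.one_le_sqrt.2 ?_)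
    exact_mod_cast Nat.one_le_iff_ne_zero.2 h

/-- The average over the times `r + 1, …, N + r`. -/
noncomputable def timeAvg (r N : ℕ) (F : ℤ → G) : G :=
  (N : ℝ)⁻¹ • ∑ n ∈ Finset.Icc ((r : ℤ) + 1) ((N : ℤ) + r), F n

theorem timeAvg_zero (r : ℕ) (F : ℤ → G) : timeAvg r 0 F = 0 := by simp [timeAvg]

theorem clm_timeAvg (f : G →L[ℝ] G') (r N : ℕ) (F : ℤ → G) :
    f (timeAvg r N F) = timeAvg r N fun n => f (F n) := by
  simp [timeAvg, map_sum]

theorem PolyLip.boundedInM_timeAvg_sub_real (he : IsNoise P e) (hρ0 : 0 < ρ) (hρ1 : ρ < 1)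
    {Φ : Hist → ℝ} (hΦ : PolyLip Φ) (r : ℕ) :
    BoundedInM P (fun N ω => timeAvg r N (fun n => Φ (noisePast ρ e n ω)) -
      ∫ ω, Φ (noisePast ρ e 0 ω) ∂P) rate := by
  have hm := fun n => hΦ.aestronglyMeasurable_noisePast he hρ0.le hρ1 n
  have hmeas : ∀ N : ℕ, AEStronglyMeasurable (fun ω => timeAvg r N
      (fun n => Φ (noisePast ρ e n ω)) - ∫ ω, Φ (noisePast ρ e 0 ω) ∂P) P := fun N => by
    unfold timeAvg
    exact ((Finset.aestronglyMeasurable_fun_sum _ fun n _ => hm n).const_smul (N : ℝ)⁻¹).sub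
      aestronglyMeasurable_const
  refine ⟨hmeas, fun q hq hq' => ?_⟩
  obtain ⟨m, hm⟩ := exists_nat_gt q.toReal
  have hqm : q ≤ (2 * (m + 1) : ℕ) := by
    rw [← ENNReal.ofReal_toReal hq', ← ENNReal.ofReal_natCast]
    refine ENNReal.ofReal_le_ofReal (hm.le.trans ?_)
    push_cast
    linarith
  obtain ⟨C, hC, h⟩ := hΦ.exists_eLpNorm_sum_sub_le he hρ0 hρ1 (Nat.succ_ne_zero m)
  set μ := ∫ ω, Φ (noisePast ρ e 0 ω) ∂P
  -- The summand `|μ|` covers `N = 0`, where the average is 0 and the rate is 1.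
  refine ⟨C + |μ|, by positivity, fun N => ?_⟩
  rcases Nat.eq_zero_or_pos N with rfl | hN
  · simp only [timeAvg_zero, zero_sub]
    rw [eLpNorm_const _ (by positivity) (IsProbabilityMeasure.ne_zero P), measure_univ,
      ENNReal.one_rpow, mul_one, enorm_neg, Real.enorm_eq_ofReal_abs]
    exact ENNReal.ofReal_le_ofReal (by simp [rate]; exact hC)
  have hN0 : (N : ℝ) ≠ 0 := by positivity
  have hcard : (Finset.Icc ((r : ℤ) + 1) ((N : ℤ) + r)).card = N := by
    rw [Int.card_Icc]
    omega
  refine (eLpNorm_le_eLpNorm_of_exponent_le hqm (hmeas N)).trans ?_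
  have heq : (fun ω => timeAvg r N (fun n => Φ (noisePast ρ e n ω)) - μ) = (N : ℝ)⁻¹ •
      fun ω => ∑ n ∈ Finset.Icc ((r : ℤ) + 1) ((N : ℤ) + r), (Φ (noisePast ρ e n ω) -
        ∫ ω, Φ (noisePast ρ e n ω) ∂P) := by
    ext ω
    simp only [Pi.smul_apply, timeAvg, smul_eq_mul]
    rw [Finset.sum_sub_distrib]
    simp_rw [fun n => hΦ.integral_eq he hρ0.le hρ1 n 0]
    rw [Finset.sum_const, hcard, nsmul_eq_mul]
    simp only [μ]
    field_simp
  rw [heq, eLpNorm_const_smul]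
  refine (mul_le_mul_right (h _) _).trans ?_
  rw [hcard, Real.enorm_of_nonneg (by positivity), ← ENNReal.ofReal_mul (by positivity)]
  refine ENNReal.ofReal_le_ofReal ?_
  have hs : (N : ℝ)⁻¹ * (C * √(N : ℝ)) = C * rate N := by
    have : √(N : ℝ) * √(N : ℝ) = N := Real.mul_self_sqrt (Nat.cast_nonneg N)
    have h0 : √(N : ℝ) ≠ 0 := by positivity
    rw [rate, if_neg hN.ne']
    field_simp
    nlinarith
  rw [hs]
  have := rate_nonneg N
  gcongr
  linarith [abs_nonneg μ]

/-- Averages of a functional of the discounted past deviate from their mean by `O_M(N^{-1/2})`. -/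
theorem PolyLip.boundedInM_timeAvg_sub [FiniteDimensional ℝ G] (he : IsNoise P e) (hρ0 : 0 < ρ)
    (hρ1 : ρ < 1) {Φ : Hist → G} (hΦ : PolyLip Φ) (r : ℕ) :
    BoundedInM P (fun N ω => timeAvg r N (fun n => Φ (noisePast ρ e n ω)) -
      ∫ ω, Φ (noisePast ρ e 0 ω) ∂P) rate := by
  have := FiniteDimensional.complete ℝ G
  let b := Module.finBasis ℝ G
  let κ : Fin (Module.finrank ℝ G) → G →L[ℝ] ℝ := fun i =>
    LinearMap.toContinuousLinearMap (b.coord i)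
  have h1 := BoundedInM.sum rate_nonneg Finset.univ (X := fun i N ω =>
    (timeAvg r N (fun n => κ i (Φ (noisePast ρ e n ω))) -
      ∫ ω, κ i (Φ (noisePast ρ e 0 ω)) ∂P) • b i) fun i _ =>
    ((hΦ.clm_comp (κ i)).boundedInM_timeAvg_sub_real he hρ0 hρ1 r).clm_comp
      ((ContinuousLinearMap.lsmul ℝ ℝ).flip (b i))
  refine h1.congr (ae_of_all _ fun ω N => ?_)
  have h2 : ∀ i, timeAvg r N (fun n => κ i (Φ (noisePast ρ e n ω))) -
      ∫ ω, κ i (Φ (noisePast ρ e 0 ω)) ∂P = b.repr (timeAvg r N (fun n => Φ (noisePast ρ e n ω)) -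
      ∫ ω, Φ (noisePast ρ e 0 ω) ∂P) i := by
    intro i
    rw [← clm_timeAvg, (κ i).integral_comp_comm (hΦ.integrable he hρ0.le hρ1 0), ← map_sub]
    rfl
  simp_rw [h2]
  exact b.sum_repr _

end ECF

/-! ### Parametric functionals and smooth random fields. -/

namespace ECF

variable {E G G₁ G₂ G₃ : Type*} [NormedAddCommGroup E] [NormedSpace ℝ E]
  [NormedAddCommGroup G] [NormedSpace ℝ G] [NormedAddCommGroup G₁] [NormedSpace ℝ G₁]
  [NormedAddCommGroup G₂] [NormedSpace ℝ G₂] [NormedAddCommGroup G₃] [NormedSpace ℝ G₃]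
  {U : Set E}

/-- A family of functionals of the past that is Lipschitz in the parameter `θ ∈ U` and in the past,
with constants growing at most polynomially in the past. -/
def ParamPolyLip {E G : Type*} [NormedAddCommGroup E] [NormedAddCommGroup G] (U : Set E)
    (Ψ : E → Hist → G) : Prop :=
  ∃ (C : ℝ) (k : ℕ), 0 ≤ C ∧ (∀ θ ∈ U, ∀ a, ‖Ψ θ a‖ ≤ C * (1 + ‖a‖) ^ k) ∧
    ∀ θ ∈ U, ∀ θ' ∈ U, ∀ a b,
      ‖Ψ θ a - Ψ θ' b‖ ≤ C * (1 + ‖a‖ + ‖b‖) ^ k * (‖θ - θ'‖ + ‖a - b‖)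

namespace ParamPolyLip

theorem polyLip {Ψ : E → Hist → G} (h : ParamPolyLip U Ψ) {θ : E} (hθ : θ ∈ U) :
    PolyLip (Ψ θ) := by
  obtain ⟨C, k, hC, -, h⟩ := h
  exact ⟨C, k, hC, fun a b => by simpa using h θ hθ θ hθ a b⟩

theorem add {Ψ Ψ' : E → Hist → G} (h : ParamPolyLip U Ψ) (h' : ParamPolyLip U Ψ') :
    ParamPolyLip U fun θ a => Ψ θ a + Ψ' θ a := by
  obtain ⟨C, k, hC, hb, hl⟩ := h
  obtain ⟨C', k', hC', hb', hl'⟩ := h'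
  have hp : ∀ t : ℝ, 1 ≤ t → t ^ k ≤ t ^ (k + k') ∧ t ^ k' ≤ t ^ (k + k') := fun t ht =>
    ⟨pow_le_pow_right₀ ht (by omega), pow_le_pow_right₀ ht (by omega)⟩
  refine ⟨C + C', k + k', by positivity, fun θ hθ a => ?_, fun θ hθ θ' hθ' a b => ?_⟩
  · obtain ⟨h1, h2⟩ := hp (1 + ‖a‖) (by linarith [norm_nonneg a])
    calc ‖Ψ θ a + Ψ' θ a‖ ≤ C * (1 + ‖a‖) ^ k + C' * (1 + ‖a‖) ^ k' :=
          (norm_add_le _ _).trans (add_le_add (hb θ hθ a) (hb' θ hθ a))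
      _ ≤ C * (1 + ‖a‖) ^ (k + k') + C' * (1 + ‖a‖) ^ (k + k') := by gcongr
      _ = _ := by ring
  · obtain ⟨h1, h2⟩ := hp (1 + ‖a‖ + ‖b‖) (by linarith [norm_nonneg a, norm_nonneg b])
    set D := ‖θ - θ'‖ + ‖a - b‖
    have hD : 0 ≤ D := by positivity
    calc ‖Ψ θ a + Ψ' θ a - (Ψ θ' b + Ψ' θ' b)‖
        = ‖(Ψ θ a - Ψ θ' b) + (Ψ' θ a - Ψ' θ' b)‖ := by congr 1; abel
      _ ≤ C * (1 + ‖a‖ + ‖b‖) ^ k * D + C' * (1 + ‖a‖ + ‖b‖) ^ k' * D :=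
          (norm_add_le _ _).trans (add_le_add (hl θ hθ θ' hθ' a b) (hl' θ hθ θ' hθ' a b))
      _ ≤ C * (1 + ‖a‖ + ‖b‖) ^ (k + k') * D + C' * (1 + ‖a‖ + ‖b‖) ^ (k + k') * D := by gcongr
      _ = _ := by ring

theorem bilin (β : G₁ →L[ℝ] G₂ →L[ℝ] G₃) {Ψ : E → Hist → G₁} {Ψ' : E → Hist → G₂}
    (h : ParamPolyLip U Ψ) (h' : ParamPolyLip U Ψ') :
    ParamPolyLip U fun θ a => β (Ψ θ a) (Ψ' θ a) := by
  obtain ⟨C, k, hC, hb, hl⟩ := h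
  obtain ⟨C', k', hC', hb', hl'⟩ := h'
  refine ⟨2 * ‖β‖ * C * C', k + k', by positivity, fun θ hθ a => ?_, fun θ hθ θ' hθ' a b => ?_⟩
  · calc ‖β (Ψ θ a) (Ψ' θ a)‖ ≤ ‖β‖ * (C * (1 + ‖a‖) ^ k) * (C' * (1 + ‖a‖) ^ k') := by
          refine (β.le_opNorm₂ _ _).trans ?_
          gcongr
          exacts [hb θ hθ a, hb' θ hθ a]
      _ = ‖β‖ * C * C' * (1 + ‖a‖) ^ (k + k') := by ring
      _ ≤ _ := by
          have : 0 ≤ ‖β‖ * C * C' * (1 + ‖a‖) ^ (k + k') := by positivity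
          linarith
  · set D := ‖θ - θ'‖ + ‖a - b‖
    have hD : 0 ≤ D := by positivity
    have e1 : ‖Ψ' θ a‖ ≤ C' * (1 + ‖a‖ + ‖b‖) ^ k' := (hb' θ hθ a).trans
      (mul_le_mul_of_nonneg_left (pow_le_pow_left₀ (by positivity)
        (by linarith [norm_nonneg b]) _) hC')
    have e2 : ‖Ψ θ' b‖ ≤ C * (1 + ‖a‖ + ‖b‖) ^ k := (hb θ' hθ' b).trans
      (mul_le_mul_of_nonneg_left (pow_le_pow_left₀ (by positivity)
        (by linarith [norm_nonneg a]) _) hC)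
    calc ‖β (Ψ θ a) (Ψ' θ a) - β (Ψ θ' b) (Ψ' θ' b)‖
        = ‖β (Ψ θ a - Ψ θ' b) (Ψ' θ a) + β (Ψ θ' b) (Ψ' θ a - Ψ' θ' b)‖ := by
          congr 1
          simp only [map_sub, sub_apply]
          abel
      _ ≤ ‖β‖ * (C * (1 + ‖a‖ + ‖b‖) ^ k * D) * (C' * (1 + ‖a‖ + ‖b‖) ^ k') +
          ‖β‖ * (C * (1 + ‖a‖ + ‖b‖) ^ k) * (C' * (1 + ‖a‖ + ‖b‖) ^ k' * D) := by
          refine (norm_add_le _ _).trans (add_le_add ((β.le_opNorm₂ _ _).trans ?_)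
            ((β.le_opNorm₂ _ _).trans ?_))
          · gcongr
            exact hl θ hθ θ' hθ' a b
          · gcongr
            exact hl' θ hθ θ' hθ' a b
      _ = _ := by ring

theorem const (U : Set E) (g : G) : ParamPolyLip U fun _ _ => g :=
  ⟨‖g‖, 0, norm_nonneg _, fun _ _ _ => by simp, fun _ _ _ _ _ _ => by simp; positivity⟩

theorem mul {Ψ Ψ' : E → Hist → ℝ} (h : ParamPolyLip U Ψ) (h' : ParamPolyLip U Ψ') :
    ParamPolyLip U fun θ a => Ψ θ a * Ψ' θ a :=
  bilin (ContinuousLinearMap.mul ℝ ℝ) h h'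

theorem pow {Ψ : E → Hist → ℝ} (h : ParamPolyLip U Ψ) (k : ℕ) :
    ParamPolyLip U fun θ a => Ψ θ a ^ k := by
  induction k with
  | zero => simpa using const U (1 : ℝ)
  | succ k ih => simpa [pow_succ] using ih.mul h

theorem norm (U : Set E) : ParamPolyLip U fun _ a => ‖a‖ := by
  refine ⟨1, 1, zero_le_one, fun θ _ a => by simp, fun θ _ θ' _ a b => ?_⟩
  rw [one_mul, pow_one, Real.norm_eq_abs]
  have h1 := abs_norm_sub_norm_le a b
  have h2 := norm_nonneg (θ - θ')
  have h3 : 0 ≤ (‖a‖ + ‖b‖) * (‖θ - θ'‖ + ‖a - b‖) := by positivity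
  nlinarith

theorem apply {B : E → Hist →L[ℝ] G} {C : ℝ} (hB : ∀ θ ∈ U, ‖B θ‖ ≤ C)
    (hL : ∀ θ ∈ U, ∀ θ' ∈ U, ‖B θ - B θ'‖ ≤ C * ‖θ - θ'‖) :
    ParamPolyLip U fun θ a => B θ a := by
  refine ⟨|C|, 1, abs_nonneg C, fun θ hθ a => ?_, fun θ hθ θ' hθ' a b => ?_⟩
  · refine ((B θ).le_of_opNorm_le (hB θ hθ) a).trans ?_
    have := norm_nonneg a
    rw [pow_one]
    exact mul_le_mul (le_abs_self C) (by linarith) this (abs_nonneg C)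
  · have e1 : ‖B θ a - B θ' b‖ ≤ |C| * ‖θ - θ'‖ * ‖a‖ + |C| * ‖a - b‖ := by
      calc ‖B θ a - B θ' b‖ = ‖(B θ - B θ') a + B θ' (a - b)‖ := by
            congr 1
            simp only [map_sub, sub_apply]
            abel
        _ ≤ _ := by
            refine (norm_add_le _ _).trans (add_le_add ((B θ - B θ').le_of_opNorm_le ?_ a)
              ((B θ').le_of_opNorm_le ((hB θ' hθ').trans (le_abs_self C)) _))
            exact (hL θ hθ θ' hθ').trans (by gcongr; exact le_abs_self C)
    refine e1.trans ?_
    rw [pow_one]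
    have h1 : 0 ≤ |C| * ((1 + ‖b‖) * ‖θ - θ'‖) := by positivity
    have h2 : 0 ≤ |C| * ((‖a‖ + ‖b‖) * ‖a - b‖) := by positivity
    nlinarith

/-- On the imaginary axis the exponential has modulus 1 and is 1-Lipschitz, so the polynomial growth
is not destroyed. -/
theorem cexp {Ψ : E → Hist → ℂ} (h : ParamPolyLip U Ψ) (hre : ∀ θ ∈ U, ∀ a, (Ψ θ a).re = 0) :
    ParamPolyLip U fun θ a => Complex.exp (Ψ θ a) := by
  obtain ⟨C, k, hC, -, hl⟩ := h
  have hn : ∀ θ ∈ U, ∀ a, ‖Complex.exp (Ψ θ a)‖ = 1 := fun θ hθ a => by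
    rw [Complex.norm_exp, hre θ hθ a, Real.exp_zero]
  refine ⟨C + 1, k, by positivity, fun θ hθ a => ?_, fun θ hθ θ' hθ' a b => ?_⟩
  · rw [hn θ hθ]
    have : 1 ≤ (1 + ‖a‖) ^ k := one_le_pow₀ (by linarith [norm_nonneg a])
    nlinarith
  · have h1 : ‖Complex.exp (Ψ θ a) - Complex.exp (Ψ θ' b)‖ ≤ ‖Ψ θ a - Ψ θ' b‖ := by
      have h2 : Complex.exp (Ψ θ a) - Complex.exp (Ψ θ' b) =
          Complex.exp (Ψ θ' b) * (Complex.exp (Ψ θ a - Ψ θ' b) - 1) := by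
        rw [mul_sub, ← Complex.exp_add, mul_one, add_sub_cancel]
      have h3 : Ψ θ a - Ψ θ' b = Complex.I * ((Ψ θ a - Ψ θ' b).im : ℝ) := by
        apply Complex.ext <;> simp [hre θ hθ a, hre θ' hθ' b]
      rw [h2, norm_mul, hn θ' hθ', one_mul, h3]
      refine Real.norm_exp_I_mul_ofReal_sub_one_le.trans (le_of_eq ?_)
      rw [norm_mul, Complex.norm_I, one_mul, Complex.norm_real]
    refine (h1.trans (hl θ hθ θ' hθ' a b)).trans ?_
    gcongr
    linarith

end ParamPolyLip

/-! ### Random fields -/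

variable {Ω : Type*} [MeasurableSpace Ω] {P : Measure Ω}

/-- The random fields `X_N` on `U` approximate the field `x` with error `O_M(N^{-1/2})`, and they
are almost surely bounded and Lipschitz with a constant that is itself a number plus an
`O_M(N^{-1/2})` term. -/
structure ApproxField (P : Measure Ω) (U : Set E) (X : ℕ → Ω → E → G) (x : E → G) : Prop where
  err : ∀ θ ∈ U, BoundedInM P (fun N ω => X N ω θ - x θ) rate
  reg : ∃ (l : ℝ) (τ : ℕ → Ω → ℝ), 0 ≤ l ∧ BoundedInM P τ rate ∧ (∀ θ ∈ U, ‖x θ‖ ≤ l) ∧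
    (∀ θ ∈ U, ∀ θ' ∈ U, ‖x θ - x θ'‖ ≤ l * ‖θ - θ'‖) ∧
    ∀ᵐ ω ∂P, ∀ N, 0 ≤ τ N ω ∧ (∀ θ ∈ U, ‖X N ω θ‖ ≤ l + τ N ω) ∧
      ∀ θ ∈ U, ∀ θ' ∈ U, ‖X N ω θ - X N ω θ'‖ ≤ (l + τ N ω) * ‖θ - θ'‖

theorem BoundedInM.bilin_rate {X : ℕ → Ω → G₁} {Y : ℕ → Ω → G₂} (β : G₁ →L[ℝ] G₂ →L[ℝ] G₃)
    (hX : BoundedInM P X rate) (hY : BoundedInM P Y rate) :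
    BoundedInM P (fun N ω => β (X N ω) (Y N ω)) rate :=
  (BoundedInM.bilin rate_nonneg β hX hY).mono fun N =>
    mul_le_of_le_one_left (rate_nonneg N) (rate_le_one N)

/-- The error splits into `β(X - x, Y - y) + β(X - x, y) + β(x, Y - y)`, where the first term is
even `O_M(N^{-1})`. The Lipschitz constants multiply to `(l + τ)(l' + τ')`, which is again a number
plus an `O_M(N^{-1/2})` term; the 2 counts the two terms of the product rule. -/
theorem ApproxField.bilin (β : G₁ →L[ℝ] G₂ →L[ℝ] G₃) {X : ℕ → Ω → E → G₁} {x : E → G₁}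
    {Y : ℕ → Ω → E → G₂} {y : E → G₂} (hX : ApproxField P U X x) (hY : ApproxField P U Y y) :
    ApproxField P U (fun N ω θ => β (X N ω θ) (Y N ω θ)) (fun θ => β (x θ) (y θ)) := by
  obtain ⟨l, τ, hl, hτ, hx, hxL, hXr⟩ := hX.reg
  obtain ⟨l', τ', hl', hτ', hy, hyL, hYr⟩ := hY.reg
  constructor
  · intro θ hθ
    have h1 := (hX.err θ hθ).bilin_rate β (hY.err θ hθ)
    have h2 := (hX.err θ hθ).clm_comp (β.flip (y θ))
    have h3 := (hY.err θ hθ).clm_comp (β (x θ))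
    refine (BoundedInM.add rate_nonneg (BoundedInM.add rate_nonneg h1 h2) h3).congr
      (ae_of_all _ fun ω N => ?_)
    simp only [map_sub, sub_apply, ContinuousLinearMap.flip_apply]
    abel
  · refine ⟨2 * ‖β‖ * (l * l'), fun N ω => 2 * ‖β‖ * (l * τ' N ω + l' * τ N ω + τ N ω * τ' N ω),
      by positivity, ?_, fun θ hθ => ?_, fun θ hθ θ' hθ' => ?_, ?_⟩
    · have h1 := (BoundedInM.add rate_nonneg (BoundedInM.add rate_nonneg
        (hτ'.clm_comp (ContinuousLinearMap.mul ℝ ℝ l))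
          (hτ.clm_comp (ContinuousLinearMap.mul ℝ ℝ l')))
        (hτ.bilin_rate (ContinuousLinearMap.mul ℝ ℝ) hτ')).clm_comp
          (ContinuousLinearMap.mul ℝ ℝ (2 * ‖β‖))
      simpa using h1
    · calc ‖β (x θ) (y θ)‖ ≤ ‖β‖ * l * l' := by
            refine (β.le_opNorm₂ _ _).trans ?_
            gcongr
            exacts [hx θ hθ, hy θ hθ]
        _ ≤ _ := by nlinarith [mul_nonneg (norm_nonneg β) (mul_nonneg hl hl')]
    · calc ‖β (x θ) (y θ) - β (x θ') (y θ')‖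
          = ‖β (x θ - x θ') (y θ) + β (x θ') (y θ - y θ')‖ := by
            congr 1
            simp only [map_sub, sub_apply]
            abel
        _ ≤ ‖β‖ * (l * ‖θ - θ'‖) * l' + ‖β‖ * l * (l' * ‖θ - θ'‖) := by
            refine (norm_add_le _ _).trans (add_le_add ((β.le_opNorm₂ _ _).trans ?_)
              ((β.le_opNorm₂ _ _).trans ?_))
            · gcongr
              exacts [hxL θ hθ θ' hθ', hy θ hθ]
            · gcongr
              exacts [hx θ' hθ', hyL θ hθ θ' hθ']
        _ = _ := by ring
    · filter_upwards [hXr, hYr] with ω h1 h2 N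
      obtain ⟨t0, hb, hL⟩ := h1 N
      obtain ⟨t0', hb', hL'⟩ := h2 N
      have e : 2 * ‖β‖ * (l * l') + 2 * ‖β‖ * (l * τ' N ω + l' * τ N ω + τ N ω * τ' N ω) =
          2 * ‖β‖ * ((l + τ N ω) * (l' + τ' N ω)) := by ring
      rw [e]
      refine ⟨by positivity, fun θ hθ => ?_, fun θ hθ θ' hθ' => ?_⟩
      · calc ‖β (X N ω θ) (Y N ω θ)‖ ≤ ‖β‖ * (l + τ N ω) * (l' + τ' N ω) := by
              refine (β.le_opNorm₂ _ _).trans ?_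
              gcongr
              exacts [hb θ hθ, hb' θ hθ]
          _ ≤ _ := by
              have : 0 ≤ ‖β‖ * ((l + τ N ω) * (l' + τ' N ω)) := by positivity
              nlinarith
      · calc ‖β (X N ω θ) (Y N ω θ) - β (X N ω θ') (Y N ω θ')‖
            = ‖β (X N ω θ - X N ω θ') (Y N ω θ) + β (X N ω θ') (Y N ω θ - Y N ω θ')‖ := by
              congr 1
              simp only [map_sub, sub_apply]
              abel
          _ ≤ ‖β‖ * ((l + τ N ω) * ‖θ - θ'‖) * (l' + τ' N ω) +
              ‖β‖ * (l + τ N ω) * ((l' + τ' N ω) * ‖θ - θ'‖) := by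
              refine (norm_add_le _ _).trans (add_le_add ((β.le_opNorm₂ _ _).trans ?_)
                ((β.le_opNorm₂ _ _).trans ?_))
              · gcongr
                exacts [hL θ hθ θ' hθ', hb' θ hθ]
              · gcongr
                exacts [hb θ' hθ', hL' θ hθ θ' hθ']
          _ = _ := by ring

theorem BoundedInM.zero {ι G : Type*} [NormedAddCommGroup G] (a : ι → ℝ) :
    BoundedInM P (fun _ _ => (0 : G)) a :=
  ⟨fun _ => aestronglyMeasurable_const, fun q _ _ => ⟨0, le_rfl, fun N => by simp⟩⟩

theorem ApproxField.const [IsProbabilityMeasure P] (U : Set E) (g : G) :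
    ApproxField P U (fun _ _ _ => g) (fun _ => g) := by
  refine ⟨fun θ _ => by simpa using BoundedInM.zero rate, ‖g‖, fun _ _ => 0, norm_nonneg _,
    BoundedInM.zero rate, fun θ _ => le_rfl,
    fun θ _ θ' _ => by simp; positivity, ae_of_all _ fun ω N => ⟨le_rfl, fun θ _ => by simp,
      fun θ _ θ' _ => by simp; positivity⟩⟩

theorem ApproxField.clm_comp [IsProbabilityMeasure P] (f : G₁ →L[ℝ] G₂) {X : ℕ → Ω → E → G₁}
    {x : E → G₁} (hX : ApproxField P U X x) :
    ApproxField P U (fun N ω θ => f (X N ω θ)) (fun θ => f (x θ)) :=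
  ApproxField.bilin (ContinuousLinearMap.id ℝ (G₁ →L[ℝ] G₂)) (ApproxField.const U f) hX

theorem ApproxField.add {X Y : ℕ → Ω → E → G} {x y : E → G} (hX : ApproxField P U X x)
    (hY : ApproxField P U Y y) :
    ApproxField P U (fun N ω θ => X N ω θ + Y N ω θ) (fun θ => x θ + y θ) := by
  obtain ⟨l, τ, hl, hτ, hx, hxL, hXr⟩ := hX.reg
  obtain ⟨l', τ', hl', hτ', hy, hyL, hYr⟩ := hY.reg
  constructor
  · intro θ hθ
    exact (BoundedInM.add rate_nonneg (hX.err θ hθ) (hY.err θ hθ)).congr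
      (ae_of_all _ fun ω N => by abel)
  · refine ⟨l + l', fun N ω => τ N ω + τ' N ω, by positivity, BoundedInM.add rate_nonneg hτ hτ',
      fun θ hθ => (norm_add_le _ _).trans (add_le_add (hx θ hθ) (hy θ hθ)),
      fun θ hθ θ' hθ' => ?_, ?_⟩
    · rw [add_sub_add_comm, add_mul]
      exact (norm_add_le _ _).trans (add_le_add (hxL θ hθ θ' hθ') (hyL θ hθ θ' hθ'))
    · filter_upwards [hXr, hYr] with ω h1 h2 N
      obtain ⟨t0, hb, hL⟩ := h1 N
      obtain ⟨t0', hb', hL'⟩ := h2 N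
      rw [add_add_add_comm]
      refine ⟨by positivity, fun θ hθ => (norm_add_le _ _).trans (add_le_add (hb θ hθ) (hb' θ hθ)),
        fun θ hθ θ' hθ' => ?_⟩
      rw [add_sub_add_comm, add_mul]
      exact (norm_add_le _ _).trans (add_le_add (hL θ hθ θ' hθ') (hL' θ hθ θ' hθ'))

theorem norm_timeAvg_le (r N : ℕ) {F : ℤ → G} {L : ℤ → ℝ} (h : ∀ n, ‖F n‖ ≤ L n) :
    ‖timeAvg r N F‖ ≤ timeAvg r N L := by
  unfold timeAvg
  rw [norm_smul, Real.norm_of_nonneg (by positivity), smul_eq_mul]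
  gcongr
  exact (norm_sum_le _ _).trans (Finset.sum_le_sum fun n _ => h n)

theorem timeAvg_sub (r N : ℕ) (F F' : ℤ → G) :
    timeAvg r N F - timeAvg r N F' = timeAvg r N fun n => F n - F' n := by
  simp only [timeAvg, Finset.sum_sub_distrib, smul_sub]

theorem timeAvg_mul_const (r N : ℕ) (F : ℤ → ℝ) (c : ℝ) :
    timeAvg r N F * c = timeAvg r N fun n => F n * c := by
  simp only [timeAvg, smul_eq_mul, mul_assoc, Finset.sum_mul]

/-- The Lipschitz constant of a time average is at most the time average of `L(past)`, with `L a = C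
(1 + 2‖a‖)^k`. This `L` is itself such a functional, so its average is its mean `l` plus an
`O_M(N^{-1/2})` fluctuation, which serves as `τ`. -/
theorem ParamPolyLip.approxField_timeAvg [IsProbabilityMeasure P] [FiniteDimensional ℝ G]
    {e : ℤ → Ω → ℝ} {ρ : ℝ} (he : IsNoise P e) (hρ0 : 0 < ρ) (hρ1 : ρ < 1) {Ψ : E → Hist → G}
    (h : ParamPolyLip U Ψ) (r : ℕ) :
    ApproxField P U (fun N ω θ => timeAvg r N fun n => Ψ θ (noisePast ρ e n ω))
      (fun θ => ∫ ω, Ψ θ (noisePast ρ e 0 ω) ∂P) := by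
  have hpl : ∀ θ ∈ U, PolyLip (Ψ θ) := fun θ hθ => h.polyLip hθ
  refine ⟨fun θ hθ => (hpl θ hθ).boundedInM_timeAvg_sub he hρ0 hρ1 r, ?_⟩
  obtain ⟨C, k, hC, hb, hl⟩ := h
  set L : Hist → ℝ := fun a => C * (1 + 2 * ‖a‖) ^ k
  have hL : PolyLip L := by
    have h1 : ParamPolyLip (Set.univ : Set ℝ) fun _ a => L a :=
      (const _ C).mul (((const _ (1 : ℝ)).add ((const _ (2 : ℝ)).mul (norm _))).pow k)
    exact h1.polyLip (θ := 0) trivial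
  have hLn : ∀ a, 0 ≤ L a := fun a => by positivity
  have hLi := hL.integrable he hρ0.le hρ1 0
  have hL1 : ∀ θ ∈ U, ∀ a, ‖Ψ θ a‖ ≤ L a := fun θ hθ a => (hb θ hθ a).trans (by
    simp only [L]
    gcongr
    linarith [norm_nonneg a])
  have hL2 : ∀ θ ∈ U, ∀ θ' ∈ U, ∀ a, ‖Ψ θ a - Ψ θ' a‖ ≤ L a * ‖θ - θ'‖ := fun θ hθ θ' hθ' a => by
    refine (hl θ hθ θ' hθ' a a).trans (le_of_eq ?_)
    simp only [L, sub_self, norm_zero, add_zero]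
    ring
  set l := ∫ ω, L (noisePast ρ e 0 ω) ∂P
  have hl0 : 0 ≤ l := integral_nonneg fun ω => hLn _
  refine ⟨l, fun N ω => |timeAvg r N (fun n => L (noisePast ρ e n ω)) - l|, hl0,
    (hL.boundedInM_timeAvg_sub_real he hρ0 hρ1 r).norm, fun θ hθ => ?_, fun θ hθ θ' hθ' => ?_,
    ae_of_all _ fun ω N => ⟨abs_nonneg _, fun θ hθ => ?_, fun θ hθ θ' hθ' => ?_⟩⟩
  · exact (norm_integral_le_integral_norm _).trans (integral_mono
      ((hpl θ hθ).integrable he hρ0.le hρ1 0).norm hLi fun ω => hL1 θ hθ _)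
  · rw [← integral_sub ((hpl θ hθ).integrable he hρ0.le hρ1 0)
      ((hpl θ' hθ').integrable he hρ0.le hρ1 0), ← integral_mul_const]
    exact (norm_integral_le_integral_norm _).trans (integral_mono
      (((hpl θ hθ).integrable he hρ0.le hρ1 0).sub
        ((hpl θ' hθ').integrable he hρ0.le hρ1 0)).norm (hLi.mul_const _)
          fun ω => hL2 θ hθ θ' hθ' _)
  · refine (norm_timeAvg_le r N fun n => hL1 θ hθ (noisePast ρ e n ω)).trans ?_
    linarith [le_abs_self (timeAvg r N (fun n => L (noisePast ρ e n ω)) - l)]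
  · rw [timeAvg_sub]
    refine (norm_timeAvg_le r N fun n => hL2 θ hθ θ' hθ' (noisePast ρ e n ω)).trans ?_
    rw [← timeAvg_mul_const]
    gcongr
    linarith [le_abs_self (timeAvg r N (fun n => L (noisePast ρ e n ω)) - l)]

/-! ### Twice differentiable random fields -/

/-- Fields that are differentiable twice on `U`, such that the fields and their first two
derivatives are approximated with error `O_M(N^{-1/2})`. -/
def ApproxField₂ (P : Measure Ω) (U : Set E) (X : ℕ → Ω → E → G) (x : E → G) : Prop :=
  ∃ (X₁ : ℕ → Ω → E → E →L[ℝ] G) (X₂ : ℕ → Ω → E → E →L[ℝ] E →L[ℝ] G)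
    (x₁ : E → E →L[ℝ] G) (x₂ : E → E →L[ℝ] E →L[ℝ] G),
    (∀ᵐ ω ∂P, ∀ N, ∀ θ ∈ U, HasFDerivAt (X N ω) (X₁ N ω θ) θ ∧
      HasFDerivAt (X₁ N ω) (X₂ N ω θ) θ) ∧
    (∀ θ ∈ U, HasFDerivAt x (x₁ θ) θ ∧ HasFDerivAt x₁ (x₂ θ) θ) ∧
    ApproxField P U X x ∧ ApproxField P U X₁ x₁ ∧ ApproxField P U X₂ x₂

namespace ApproxField₂

variable {X Y : ℕ → Ω → E → G} {x y : E → G}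

theorem add (hX : ApproxField₂ P U X x) (hY : ApproxField₂ P U Y y) :
    ApproxField₂ P U (fun N ω θ => X N ω θ + Y N ω θ) (fun θ => x θ + y θ) := by
  obtain ⟨X₁, X₂, x₁, x₂, hd, hdx, h0, h1, h2⟩ := hX
  obtain ⟨Y₁, Y₂, y₁, y₂, hd', hdy, h0', h1', h2'⟩ := hY
  refine ⟨_, _, _, _, ?_, fun θ hθ => ⟨(hdx θ hθ).1.add (hdy θ hθ).1,
    (hdx θ hθ).2.add (hdy θ hθ).2⟩,
    h0.add h0', h1.add h1', h2.add h2'⟩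
  filter_upwards [hd, hd'] with ω ha hb N θ hθ
  exact ⟨(ha N θ hθ).1.add (hb N θ hθ).1, (ha N θ hθ).2.add (hb N θ hθ).2⟩

theorem bilin (β : G₁ →L[ℝ] G₂ →L[ℝ] G₃) {X : ℕ → Ω → E → G₁} {x : E → G₁}
    {Y : ℕ → Ω → E → G₂} {y : E → G₂} (hX : ApproxField₂ P U X x) (hY : ApproxField₂ P U Y y) :
    ApproxField₂ P U (fun N ω θ => β (X N ω θ) (Y N ω θ)) (fun θ => β (x θ) (y θ)) := by
  obtain ⟨X₁, X₂, x₁, x₂, hd, hdx, h0, h1, h2⟩ := hX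
  obtain ⟨Y₁, Y₂, y₁, y₂, hd', hdy, h0', h1', h2'⟩ := hY
  -- `γ` and `κ` are the halves of the Leibniz rule in which the derivative falls on the second and
  -- on the first factor. Both are bounded bilinear, so the second derivative comes from the same
  -- rule.
  obtain ⟨γ, hγ⟩ : ∃ γ : G₁ →L[ℝ] (E →L[ℝ] G₂) →L[ℝ] (E →L[ℝ] G₃), γ = β.precompR E := ⟨_, rfl⟩
  obtain ⟨κ, hκ⟩ : ∃ κ : (E →L[ℝ] G₁) →L[ℝ] G₂ →L[ℝ] (E →L[ℝ] G₃), κ = β.precompL E := ⟨_, rfl⟩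
  have hder : ∀ {f : E → G₁} {f₁ : E → E →L[ℝ] G₁} {f₂ : E → E →L[ℝ] E →L[ℝ] G₁} {g : E → G₂}
      {g₁ : E → E →L[ℝ] G₂} {g₂ : E → E →L[ℝ] E →L[ℝ] G₂} {θ : E},
      (HasFDerivAt f (f₁ θ) θ ∧ HasFDerivAt f₁ (f₂ θ) θ) →
      (HasFDerivAt g (g₁ θ) θ ∧ HasFDerivAt g₁ (g₂ θ) θ) →
      HasFDerivAt (fun θ => β (f θ) (g θ))
        (γ (f θ) (g₁ θ) + κ (f₁ θ) (g θ)) θ ∧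
      HasFDerivAt (fun θ => γ (f θ) (g₁ θ) + κ (f₁ θ) (g θ))
        ((γ.precompR E (f θ) (g₂ θ) + γ.precompL E (f₁ θ) (g₁ θ)) +
        (κ.precompR E (f₁ θ) (g₁ θ) + κ.precompL E (f₂ θ) (g θ))) θ := by
    intro f f₁ f₂ g g₁ g₂ θ hf hg
    refine ⟨?_, ?_⟩
    · rw [hγ, hκ]
      exact β.hasFDerivAt_of_bilinear hf.1 hg.1
    have e1 : HasFDerivAt (fun θ => γ (f θ) (g₁ θ))
        (γ.precompR E (f θ) (g₂ θ) + γ.precompL E (f₁ θ) (g₁ θ)) θ :=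
      ContinuousLinearMap.hasFDerivAt_of_bilinear γ hf.1 hg.2
    have e2 : HasFDerivAt (fun θ => κ (f₁ θ) (g θ))
        (κ.precompR E (f₁ θ) (g₁ θ) + κ.precompL E (f₂ θ) (g θ)) θ :=
      ContinuousLinearMap.hasFDerivAt_of_bilinear κ hf.2 hg.1
    exact HasFDerivAt.add e1 e2
  refine ⟨fun N ω θ => γ (X N ω θ) (Y₁ N ω θ) + κ (X₁ N ω θ) (Y N ω θ),
    fun N ω θ => (γ.precompR E (X N ω θ) (Y₂ N ω θ) +
        γ.precompL E (X₁ N ω θ) (Y₁ N ω θ)) +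
      (κ.precompR E (X₁ N ω θ) (Y₁ N ω θ) +
        κ.precompL E (X₂ N ω θ) (Y N ω θ)),
    fun θ => γ (x θ) (y₁ θ) + κ (x₁ θ) (y θ),
    fun θ => (γ.precompR E (x θ) (y₂ θ) +
        γ.precompL E (x₁ θ) (y₁ θ)) +
      (κ.precompR E (x₁ θ) (y₁ θ) + κ.precompL E (x₂ θ) (y θ)),
    ?_, fun θ hθ => hder (hdx θ hθ) (hdy θ hθ), h0.bilin β h0',
    (h0.bilin γ h1').add (h1.bilin κ h0'), ?_⟩
  · filter_upwards [hd, hd'] with ω ha hb N θ hθ using hder (ha N θ hθ) (hb N θ hθ)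
  · have a1 := ApproxField.bilin (G₃ := E →L[ℝ] E →L[ℝ] G₃) (γ.precompR E) h0 h2'
    have a2 := ApproxField.bilin (G₃ := E →L[ℝ] E →L[ℝ] G₃) (γ.precompL E) h1 h1'
    have a3 := ApproxField.bilin (G₃ := E →L[ℝ] E →L[ℝ] G₃) (κ.precompR E) h1 h1'
    have a4 := ApproxField.bilin (G₃ := E →L[ℝ] E →L[ℝ] G₃) (κ.precompL E) h2 h0'
    exact ApproxField.add (ApproxField.add a1 a2) (ApproxField.add a3 a4)

theorem const [IsProbabilityMeasure P] (U : Set E) (g : G) :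
    ApproxField₂ P U (fun _ _ _ => g) (fun _ => g) :=
  ⟨fun _ _ _ => 0, fun _ _ _ => 0, fun _ => 0, fun _ => 0,
    ae_of_all _ fun _ _ θ _ => ⟨hasFDerivAt_const g θ, hasFDerivAt_const 0 θ⟩,
    fun θ _ => ⟨hasFDerivAt_const g θ, hasFDerivAt_const 0 θ⟩,
    ApproxField.const U g, ApproxField.const U 0, ApproxField.const U 0⟩

theorem clm_comp [IsProbabilityMeasure P] (f : G₁ →L[ℝ] G₂) {X : ℕ → Ω → E → G₁} {x : E → G₁}
    (hX : ApproxField₂ P U X x) :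
    ApproxField₂ P U (fun N ω θ => f (X N ω θ)) (fun θ => f (x θ)) :=
  bilin (ContinuousLinearMap.id ℝ (G₁ →L[ℝ] G₂)) (const U f) hX

theorem sub [IsProbabilityMeasure P] (hX : ApproxField₂ P U X x) (hY : ApproxField₂ P U Y y) :
    ApproxField₂ P U (fun N ω θ => X N ω θ - Y N ω θ) (fun θ => x θ - y θ) := by
  simpa [sub_eq_add_neg] using hX.add (hY.clm_comp (-ContinuousLinearMap.id ℝ G))

theorem sum [IsProbabilityMeasure P] {ι : Type*} (s : Finset ι) {X : ι → ℕ → Ω → E → G}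
    {x : ι → E → G} (h : ∀ i ∈ s, ApproxField₂ P U (X i) (x i)) :
    ApproxField₂ P U (fun N ω θ => ∑ i ∈ s, X i N ω θ) (fun θ => ∑ i ∈ s, x i θ) := by
  classical
  induction s using Finset.induction_on with
  | empty => simpa using const U (0 : G)
  | insert i s hi ih =>
    simp only [Finset.sum_insert hi]
    exact (h i (by simp)).add (ih fun j hj => h j (by simp [hj]))

theorem congr (hU : IsOpen U) (hX : ApproxField₂ P U X x)
    (h : ∀ᵐ ω ∂P, ∀ N, ∀ θ ∈ U, X N ω θ = Y N ω θ) (hxy : ∀ θ ∈ U, x θ = y θ) :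
    ApproxField₂ P U Y y := by
  obtain ⟨X₁, X₂, x₁, x₂, hd, hdx, h0, h1, h2⟩ := hX
  refine ⟨X₁, X₂, x₁, x₂, ?_, fun θ hθ => ⟨(hdx θ hθ).1.congr_of_eventuallyEq ?_, (hdx θ hθ).2⟩,
    ⟨fun θ hθ => (h0.err θ hθ).congr ?_, ?_⟩, h1, h2⟩
  · filter_upwards [hd, h] with ω ha hb N θ hθ
    refine ⟨(ha N θ hθ).1.congr_of_eventuallyEq ?_, (ha N θ hθ).2⟩
    filter_upwards [hU.mem_nhds hθ] with θ' hθ' using (hb N θ' hθ').symm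
  · filter_upwards [hU.mem_nhds hθ] with θ' hθ' using (hxy θ' hθ').symm
  · filter_upwards [h] with ω hω N
    rw [hω N θ hθ, hxy θ hθ]
  · obtain ⟨l, τ, hl, hτ, hx, hxL, hXr⟩ := h0.reg
    refine ⟨l, τ, hl, hτ, fun θ hθ => hxy θ hθ ▸ hx θ hθ, fun θ hθ θ' hθ' => ?_, ?_⟩
    · rw [← hxy θ hθ, ← hxy θ' hθ']
      exact hxL θ hθ θ' hθ'
    · filter_upwards [hXr, h] with ω ha hb N
      refine ⟨(ha N).1, fun θ hθ => hb N θ hθ ▸ (ha N).2.1 θ hθ, fun θ hθ θ' hθ' => ?_⟩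
      rw [← hb N θ hθ, ← hb N θ' hθ']
      exact (ha N).2.2 θ hθ θ' hθ'

/-- Differentiation under the expectation is dominated by a polynomial in the norm of the past,
uniformly in the parameter. -/
theorem _root_.ECF.ParamPolyLip.hasFDerivAt_integral [IsProbabilityMeasure P]
    {e : ℤ → Ω → ℝ} {ρ : ℝ} (he : IsNoise P e) (hρ0 : 0 < ρ) (hρ1 : ρ < 1) (hU : IsOpen U)
    {Ψ : E → Hist → G} {Ψ₁ : E → Hist → E →L[ℝ] G} (h : ParamPolyLip U Ψ) (h₁ : ParamPolyLip U Ψ₁)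
    (hd : ∀ θ ∈ U, ∀ a, HasFDerivAt (fun θ => Ψ θ a) (Ψ₁ θ a) θ) {θ : E} (hθ : θ ∈ U) :
    HasFDerivAt (fun θ => ∫ ω, Ψ θ (noisePast ρ e 0 ω) ∂P)
      (∫ ω, Ψ₁ θ (noisePast ρ e 0 ω) ∂P) θ := by
  have hm := (h₁.polyLip hθ).aestronglyMeasurable_noisePast he hρ0.le hρ1 0
  obtain ⟨C, k, hC, hb, -⟩ := h₁
  refine hasFDerivAt_integral_of_dominated_of_fderiv_le (hU.mem_nhds hθ)
    (bound := fun ω => C * (1 + 1 * ‖noisePast ρ e 0 ω‖) ^ k) ?_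
    ((h.polyLip hθ).integrable he hρ0.le hρ1 0) hm (ae_of_all _ fun ω θ' hθ' => ?_)
    (memLp_one_iff_integrable.1
      ((boundedInM_mul_one_add_norm_pow he hρ0.le hρ1 C 1 k).memLp 0 (by simp)))
    (ae_of_all _ fun ω θ' hθ' => hd θ' hθ' _)
  · filter_upwards [hU.mem_nhds hθ] with θ' hθ'
    exact (h.polyLip hθ').aestronglyMeasurable_noisePast he hρ0.le hρ1 0
  · rw [one_mul]
    exact hb θ' hθ' _

theorem of_paramPolyLip [IsProbabilityMeasure P] [FiniteDimensional ℝ G] [FiniteDimensional ℝ E]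
    {e : ℤ → Ω → ℝ} {ρ : ℝ} (he : IsNoise P e) (hρ0 : 0 < ρ) (hρ1 : ρ < 1) (hU : IsOpen U)
    {Ψ : E → Hist → G} {Ψ₁ : E → Hist → E →L[ℝ] G} {Ψ₂ : E → Hist → E →L[ℝ] E →L[ℝ] G}
    (h : ParamPolyLip U Ψ) (h₁ : ParamPolyLip U Ψ₁) (h₂ : ParamPolyLip U Ψ₂)
    (hd : ∀ θ ∈ U, ∀ a, HasFDerivAt (fun θ => Ψ θ a) (Ψ₁ θ a) θ)
    (hd₁ : ∀ θ ∈ U, ∀ a, HasFDerivAt (fun θ => Ψ₁ θ a) (Ψ₂ θ a) θ) (r : ℕ) :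
    ApproxField₂ P U (fun N ω θ => timeAvg r N fun n => Ψ θ (noisePast ρ e n ω))
      (fun θ => ∫ ω, Ψ θ (noisePast ρ e 0 ω) ∂P) := by
  refine ⟨fun N ω θ => timeAvg r N fun n => Ψ₁ θ (noisePast ρ e n ω),
    fun N ω θ => timeAvg r N fun n => Ψ₂ θ (noisePast ρ e n ω),
    fun θ => ∫ ω, Ψ₁ θ (noisePast ρ e 0 ω) ∂P, fun θ => ∫ ω, Ψ₂ θ (noisePast ρ e 0 ω) ∂P,
    ae_of_all _ fun ω N θ hθ => ⟨?_, ?_⟩, fun θ hθ => ⟨?_, ?_⟩,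
    h.approxField_timeAvg he hρ0 hρ1 r, h₁.approxField_timeAvg he hρ0 hρ1 r,
    h₂.approxField_timeAvg he hρ0 hρ1 r⟩
  · exact (HasFDerivAt.fun_sum fun n _ => hd θ hθ (noisePast ρ e n ω)).const_smul (N : ℝ)⁻¹
  · exact (HasFDerivAt.fun_sum fun n _ => hd₁ θ hθ (noisePast ρ e n ω)).const_smul (N : ℝ)⁻¹
  · exact h.hasFDerivAt_integral he hρ0 hρ1 hU h₁ hd hθ
  · exact h₁.hasFDerivAt_integral he hρ0 hρ1 hU h₂ hd₁ hθ

end ApproxField₂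

end ECF

/-! ### Stable state-space filters as operators on the discounted past. -/

namespace ECF

/-! ### Shift and head of a sequence -/

theorem Hist.summable_tail (f : Hist) : Summable fun m => |f (m + 1)| :=
  (summable_nat_add_iff 1).2 f.hasSum_norm.summable

/-- The left shift on `ℓ¹`. -/
noncomputable def Hist.tail : Hist →L[ℝ] Hist :=
  LinearMap.mkContinuous
    { toFun := fun f => ⟨fun m => f (m + 1), memℓp_one_of_summable f.summable_tail⟩
      map_add' := fun f g => rfl
      map_smul' := fun c f => rfl } 1
    fun f => by
      rw [one_mul, ← (Hist.hasSum_norm _).tsum_eq, ← f.hasSum_norm.tsum_eq,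
        f.hasSum_norm.summable.tsum_eq_zero_add]
      exact le_add_of_nonneg_left (norm_nonneg _)

theorem Hist.tail_apply (f : Hist) (m : ℕ) : Hist.tail f m = f (m + 1) := rfl

theorem Hist.norm_tail : ‖Hist.tail‖ ≤ 1 := LinearMap.mkContinuous_norm_le _ zero_le_one _

theorem Hist.norm_tail_pow_apply_le (j : ℕ) (f : Hist) : ‖(Hist.tail ^ j) f‖ ≤ ‖f‖ := by
  induction j with
  | zero => exact le_rfl
  | succ j ih =>
    rw [pow_succ', mul_apply_eq_comp]
    exact (Hist.tail.le_of_opNorm_le Hist.norm_tail _).trans (by rwa [one_mul])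

theorem Hist.tail_pow_apply (j : ℕ) (f : Hist) (m : ℕ) : (Hist.tail ^ j) f m = f (m + j) := by
  induction j generalizing m with
  | zero => rfl
  | succ j ih =>
    rw [pow_succ', mul_apply_eq_comp, Hist.tail_apply, ih, add_right_comm, add_assoc]

/-- The first term of a sequence. -/
noncomputable def Hist.head : Hist →L[ℝ] ℝ :=
  LinearMap.mkContinuous
    { toFun := fun f => f 0
      map_add' := fun f g => rfl
      map_smul' := fun c f => rfl } 1
    fun f => by
      rw [one_mul]
      exact lp.norm_apply_le_norm one_ne_zero f 0

theorem Hist.head_apply (f : Hist) : Hist.head f = f 0 := rfl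

theorem Hist.tail_single_succ (m : ℕ) (x : ℝ) :
    Hist.tail (lp.single 1 (m + 1) x) = lp.single 1 m x := by
  ext i
  rw [Hist.tail_apply, lp.single_apply, lp.single_apply]
  simp [Pi.single_apply]

theorem Hist.tail_single_zero (x : ℝ) : Hist.tail (lp.single 1 0 x) = 0 := by
  ext i
  rw [Hist.tail_apply, lp.single_apply]
  simp

/-- Going back `j` steps in time is the shift up to the factor `ρ^j`, so lagged outputs are linear
functionals of the same past. -/
theorem tail_pow_discount {ρ : ℝ} {e : ℤ → ℝ} (he : ∀ n, Summable fun m => |ρ ^ m * past e n m|)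
    (n : ℤ) (j : ℕ) :
    (Hist.tail ^ j) (discount ρ (past e n)) = ρ ^ j • discount ρ (past e (n - j)) := by
  ext m
  rw [Hist.tail_pow_apply, discount_apply (he n), lp.coeFn_smul, Pi.smul_apply,
    discount_apply (he (n - j)), ← past_add, smul_eq_mul]
  ring

/-! ### Resolvents -/

section Resolvent

variable {V : Type*} [NormedAddCommGroup V] [NormedSpace ℝ V]

/-- The operator `Λ ↦ T ∘ Λ ∘ tail`. -/
noncomputable def tailComp (T : V →L[ℝ] V) : (Hist →L[ℝ] V) →L[ℝ] (Hist →L[ℝ] V) :=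
  (ContinuousLinearMap.compL ℝ Hist V V T).comp
    ((ContinuousLinearMap.compL ℝ Hist Hist V).flip Hist.tail)

theorem tailComp_apply (T : V →L[ℝ] V) (Λ : Hist →L[ℝ] V) (a : Hist) :
    tailComp T Λ a = T (Λ (Hist.tail a)) := rfl

theorem tailComp_pow_apply (T : V →L[ℝ] V) (k : ℕ) (Λ : Hist →L[ℝ] V) (a : Hist) :
    (tailComp T ^ k) Λ a = (T ^ k) (Λ ((Hist.tail ^ k) a)) := by
  induction k generalizing Λ a with
  | zero => rfl
  | succ k ih =>
    rw [pow_succ, mul_apply_eq_comp, ih, tailComp_apply, pow_succ,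
      mul_apply_eq_comp, pow_succ', mul_apply_eq_comp]

/-- `1 - x` is a factor of `1 - x^k`, and the two factors commute. A spectral radius below 1 makes
only some power contractive, not necessarily `x` itself. -/
theorem isUnit_one_sub_of_norm_pow_lt_one {R : Type*} [NormedRing R] [CompleteSpace R] {x : R}
    {k : ℕ} (h : ‖x ^ k‖ < 1) : IsUnit (1 - x) := by
  have h1 : IsUnit (1 - x ^ k) := isUnit_one_sub_of_norm_lt_one h
  rw [← mul_neg_geom_sum] at h1
  refine ((Commute.isUnit_mul_iff ?_).1 h1).1
  exact (mul_neg_geom_sum x k).trans (geom_sum_mul_neg x k).symm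

theorem isUnit_one_sub_tailComp [CompleteSpace V] {T : V →L[ℝ] V} {k : ℕ} (h : ‖T ^ k‖ < 1) :
    IsUnit (1 - tailComp T) := by
  refine isUnit_one_sub_of_norm_pow_lt_one (R := (Hist →L[ℝ] V) →L[ℝ] (Hist →L[ℝ] V)) (k := k)
    (lt_of_le_of_lt ?_ h)
  refine ContinuousLinearMap.opNorm_le_bound _ (norm_nonneg _) fun Λ => ?_
  refine ContinuousLinearMap.opNorm_le_bound _ (by positivity) fun a => ?_
  rw [tailComp_pow_apply, mul_assoc]
  refine ((T ^ k).le_opNorm _).trans ?_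
  gcongr
  refine (Λ.le_opNorm _).trans ?_
  gcongr
  exact Hist.norm_tail_pow_apply_le k a

/-- The solution of `Λ a = a₀ v + T Λ (tail a)`. -/
noncomputable def resolvent (T : V →L[ℝ] V) (v : V) : Hist →L[ℝ] V :=
  Ring.inverse (1 - tailComp T) (Hist.head.smulRight v)

theorem resolvent_apply {T : V →L[ℝ] V} (h : IsUnit (1 - tailComp T)) (v : V) (a : Hist) :
    resolvent T v a = a 0 • v + T (resolvent T v (Hist.tail a)) := by
  have h1 : (1 - tailComp T) (resolvent T v) = Hist.head.smulRight v := by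
    rw [resolvent, ← mul_apply_eq_comp, Ring.mul_inverse_cancel _ h]
    rfl
  have h2 := congrArg (fun Λ : Hist →L[ℝ] V => Λ a) h1
  simp only [sub_apply, one_apply_eq_self, ContinuousLinearMap.smulRight_apply,
    Hist.head_apply, tailComp_apply] at h2
  rw [← h2]
  abel

/-- The defining equation, read on sequences with a single nonzero term, gives `T^m v` by recursion;
continuity and linearity give the rest. -/
theorem hasSum_resolvent {T : V →L[ℝ] V} (h : IsUnit (1 - tailComp T)) (v : V) (a : Hist) :
    HasSum (fun m => a m • (T ^ m) v) (resolvent T v a) := by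
  have h1 : ∀ (m : ℕ) (x : ℝ), resolvent T v (lp.single 1 m x) = x • (T ^ m) v := by
    intro m
    induction m with
    | zero =>
      intro x
      rw [resolvent_apply h, Hist.tail_single_zero, map_zero, map_zero, add_zero,
        lp.single_apply_self]
      rfl
    | succ m ih =>
      intro x
      rw [resolvent_apply h, Hist.tail_single_succ, ih, lp.single_apply_ne _ _ _ (by simp),
        zero_smul, zero_add, map_smul, pow_succ', mul_apply_eq_comp]
  have h2 := (lp.hasSum_single (by simp) a).mapL (resolvent T v)
  simpa only [h1] using h2

/-- Inversion is smooth on the units of a Banach algebra, so the impulse response series need not be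
differentiated term by term. -/
theorem contDiffOn_resolvent [CompleteSpace V] {E : Type*} [NormedAddCommGroup E] [NormedSpace ℝ E]
    {n : WithTop ℕ∞} {U : Set E} {T : E → V →L[ℝ] V} {v : E → V} (hT : ContDiffOn ℝ n T U)
    (hv : ContDiffOn ℝ n v U) (h : ∀ θ ∈ U, IsUnit (1 - tailComp (T θ))) :
    ContDiffOn ℝ n (fun θ => resolvent (T θ) (v θ)) U := by
  have hL : ContDiff ℝ n (fun S : V →L[ℝ] V => ContinuousLinearMap.compL ℝ Hist V V S) :=
    ContinuousLinearMap.contDiff _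
  have h0 : ContDiffOn ℝ n (fun θ => tailComp (T θ)) U :=
    (hL.comp_contDiffOn hT).clm_comp contDiffOn_const
  have h1 : ContDiffOn ℝ n (fun θ => 1 - tailComp (T θ)) U := contDiffOn_const.sub h0
  have h2 : ContDiffOn ℝ n (fun θ => Ring.inverse (1 - tailComp (T θ))) U := by
    intro θ hθ
    have := contDiffAt_ringInverse (R := (Hist →L[ℝ] V) →L[ℝ] (Hist →L[ℝ] V)) (n := n) ℝ
      (h θ hθ).unit
    exact this.comp_contDiffWithinAt θ (h1 θ hθ)
  exact h2.clm_apply (contDiffOn_const.smulRight hv)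

end Resolvent

/-! ### Stable matrices -/

section Stable

variable {s : ℕ}

/-- The operator with a given matrix, as a linear function of the matrix entries. -/
noncomputable def entriesToCLM (s : ℕ) :
    (Fin s → Fin s → ℝ) →L[ℝ] ((Fin s → ℝ) →L[ℝ] (Fin s → ℝ)) :=
  LinearMap.toContinuousLinearMap
    { toFun := fun F => LinearMap.toContinuousLinearMap (Matrix.toLin' (Matrix.of F))
      map_add' := fun F G => by
        ext v i
        exact congrFun (Matrix.add_mulVec (Matrix.of F) (Matrix.of G) v) i
      map_smul' := fun c F => by
        ext v i
        exact congrFun (Matrix.smul_mulVec c (Matrix.of F) v) i }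

theorem entriesToCLM_apply (F : Matrix (Fin s) (Fin s) ℝ) (v : Fin s → ℝ) :
    entriesToCLM s F v = F *ᵥ v := rfl

theorem entriesToCLM_pow (F : Matrix (Fin s) (Fin s) ℝ) (k : ℕ) :
    entriesToCLM s (F ^ k) = entriesToCLM s F ^ k := by
  induction k with
  | zero =>
    ext v i
    rw [entriesToCLM_apply]
    simp
  | succ k ih =>
    ext v i
    rw [pow_succ (entriesToCLM s F), mul_apply_eq_comp, ← ih, entriesToCLM_apply,
      entriesToCLM_apply, entriesToCLM_apply, pow_succ, Matrix.mulVec_mulVec]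

attribute [local instance] Matrix.linftyOpNormedRing Matrix.linftyOpNormedAlgebra

theorem norm_entry_le_linftyOpNorm (F : Matrix (Fin s) (Fin s) ℂ) (i j : Fin s) :
    ‖F i j‖ ≤ ‖F‖ := by
  rw [Matrix.linfty_opNorm_def]
  have h1 : ‖F i j‖₊ ≤ ∑ j, ‖F i j‖₊ :=
    Finset.single_le_sum (f := fun j => ‖F i j‖₊) (fun _ _ => zero_le) (Finset.mem_univ j)
  have h2 := Finset.le_sup (f := fun i => ∑ j, ‖F i j‖₊) (Finset.mem_univ i)
  exact_mod_cast h1.trans h2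

/-- Choose `t` and `ρ` with spectral radius `< t < ρ < 1`. By Gelfand's formula the powers of `F`
are eventually at most `t^n`, so the entries of `(F/ρ)^n` are at most `(t/ρ)^n → 0`. -/
theorem exists_norm_pow_lt_one (F : Matrix (Fin s) (Fin s) ℝ)
    (hF : ∀ z ∈ spectrum ℂ (F.map (algebraMap ℝ ℂ)), ‖z‖ < 1) :
    ∃ ρ : ℝ, 0 < ρ ∧ ρ < 1 ∧ ∃ k : ℕ, ‖(ρ⁻¹ • entriesToCLM s F) ^ k‖ < 1 := by
  -- Without states the operator space is trivial and any `ρ` works.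
  rcases Nat.eq_zero_or_pos s with rfl | hs
  · refine ⟨1 / 2, by norm_num, by norm_num, 1, ?_⟩
    rw [Subsingleton.elim (((1 / 2 : ℝ)⁻¹ • entriesToCLM 0 F) ^ 1) 0, norm_zero]
    exact one_pos
  have : Nonempty (Fin s) := ⟨⟨0, hs⟩⟩
  set a : Matrix (Fin s) (Fin s) ℂ := F.map (algebraMap ℝ ℂ) with ha
  have : CompleteSpace (Matrix (Fin s) (Fin s) ℂ) := FiniteDimensional.complete ℂ _
  have hr : spectralRadius ℂ a < (1 : NNReal) :=
    spectrum.spectralRadius_lt_of_forall_lt a fun z hz => by exact_mod_cast hF z hz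
  obtain ⟨t, ht, ht1⟩ := ENNReal.lt_iff_exists_nnreal_btwn.1 hr
  obtain ⟨ρ, htρ, hρ1⟩ := exists_between (show (t : ℝ) < 1 by exact_mod_cast ht1)
  have hρ0 : 0 < ρ := t.coe_nonneg.trans_lt htρ
  refine ⟨ρ, hρ0, hρ1, ?_⟩
  have hev : ∀ᶠ n in atTop, ‖a ^ n‖ ≤ (t : ℝ) ^ n := by
    filter_upwards [(spectrum.pow_nnnorm_pow_one_div_tendsto_nhds_spectralRadius
      a).eventually_lt_const ht, eventually_ne_atTop 0] with n hn hn0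
    have h1 := ENNReal.rpow_le_rpow hn.le (Nat.cast_nonneg (α := ℝ) n)
    rw [← ENNReal.rpow_mul, one_div_mul_cancel (by exact_mod_cast hn0), ENNReal.rpow_one,
      ENNReal.rpow_natCast] at h1
    exact_mod_cast h1
  have hmap : ∀ n, (F ^ n).map (algebraMap ℝ ℂ) = a ^ n := fun n =>
    map_pow (RingHom.mapMatrix (algebraMap ℝ ℂ)) F n
  have hlim : Tendsto (fun n : ℕ => entriesToCLM s (fun i j => ρ⁻¹ ^ n * (F ^ n) i j)) atTop
      (𝓝 (entriesToCLM s 0)) := by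
    refine ((entriesToCLM s).continuous.tendsto 0).comp ?_
    refine tendsto_pi_nhds.2 fun i => tendsto_pi_nhds.2 fun j => ?_
    refine squeeze_zero_norm' (a := fun n : ℕ => (ρ⁻¹ * t) ^ n) ?_
      (tendsto_pow_atTop_nhds_zero_of_lt_one (by positivity) ?_)
    · filter_upwards [hev] with n hn
      have h1 : |(F ^ n) i j| ≤ (t : ℝ) ^ n := by
        refine le_trans (le_of_eq ?_) ((norm_entry_le_linftyOpNorm (a ^ n) i j).trans hn)
        rw [← hmap, Matrix.map_apply, Complex.coe_algebraMap, Complex.norm_real, Real.norm_eq_abs]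
      rw [norm_mul, Real.norm_of_nonneg (by positivity), mul_pow, Real.norm_eq_abs]
      gcongr
    · rw [inv_mul_lt_one₀ hρ0]
      exact htρ
  rw [map_zero] at hlim
  obtain ⟨k, hk⟩ := (hlim.norm.eventually_lt_const
    (by simp : ‖(0 : (Fin s → ℝ) →L[ℝ] (Fin s → ℝ))‖ < 1)).exists
  refine ⟨k, ?_⟩
  rw [smul_pow, ← entriesToCLM_pow]
  exact ((entriesToCLM s).map_smul (ρ⁻¹ ^ k) (F ^ k)) ▸ hk

end Stable

/-- Near each parameter, the blocks of the output of a stable filter family depend linearly on the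
discounted past of the input, in a way that is `C³` in the parameter. -/
theorem IsStableC3.exists_blockProd_eq {p r M : ℕ} {A : EuclideanSpace ℝ (Fin p) → PowerSeries ℝ}
    {D : Set (EuclideanSpace ℝ (Fin p))} (hD : IsOpen D) (hA : IsStableC3 A D)
    {θ₀ : EuclideanSpace ℝ (Fin p)} (hθ₀ : θ₀ ∈ D) (u : Fin M → Fin r → ℝ) :
    ∃ ρ : ℝ, 0 < ρ ∧ ρ < 1 ∧ ∃ U, IsOpen U ∧ θ₀ ∈ U ∧ U ⊆ D ∧
      ∃ B : Fin M → EuclideanSpace ℝ (Fin p) → Hist →L[ℝ] ℝ, (∀ k, ContDiffOn ℝ 3 (B k) U) ∧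
        ∀ k, ∀ θ ∈ U, ∀ e : ℤ → ℝ, (∀ n, Summable fun m => |ρ ^ m * past e n m|) → ∀ n,
          blockProd (u k) (filterOutput (A θ) e) n = B k θ (discount ρ (past e n)) := by
  obtain ⟨s, F, b, c, d, hF, hb, hc, hd, hsp, hcoef⟩ := hA
  obtain ⟨ρ, hρ0, hρ1, k₀, hk₀⟩ := exists_norm_pow_lt_one (F θ₀) (hsp θ₀ hθ₀)
  -- The factor `ρ⁻¹` compensates the discounting: `ρ^m e` times `(F/ρ)^m` is `F^m e`.
  set T : EuclideanSpace ℝ (Fin p) → (Fin s → ℝ) →L[ℝ] (Fin s → ℝ) :=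
    fun θ => ρ⁻¹ • entriesToCLM s (F θ) with hTdef
  have hT : ContDiffOn ℝ 3 T D := by
    refine ContDiffOn.const_smul ρ⁻¹ ((entriesToCLM s).contDiff.comp_contDiffOn ?_)
    exact contDiffOn_pi.2 fun i => contDiffOn_pi.2 fun j => hF i j
  have hTc : ContinuousOn (fun θ => 1 - tailComp (T θ)) D := by
    refine continuousOn_const.sub ?_
    exact ContinuousOn.clm_comp (((ContinuousLinearMap.compL ℝ Hist (Fin s → ℝ)
      (Fin s → ℝ)).continuous.comp_continuousOn hT.continuousOn)) continuousOn_const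
  -- The `ρ` found at `θ₀` is kept on a whole neighbourhood, since the units form an open set.
  set U : Set (EuclideanSpace ℝ (Fin p)) := D ∩ (fun θ => 1 - tailComp (T θ)) ⁻¹' {x | IsUnit x}
  have hU : IsOpen U := hTc.isOpen_inter_preimage hD
    (Units.isOpen (R := (Hist →L[ℝ] (Fin s → ℝ)) →L[ℝ] (Hist →L[ℝ] (Fin s → ℝ))))
  have hUD : U ⊆ D := Set.inter_subset_left
  set Λ : EuclideanSpace ℝ (Fin p) → Hist →L[ℝ] (Fin s → ℝ) := fun θ => resolvent (T θ) (b θ)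
  have hΛ : ContDiffOn ℝ 3 Λ U := contDiffOn_resolvent (hT.mono hUD)
    ((contDiffOn_pi.2 fun i => hb i).mono hUD) fun θ hθ => hθ.2
  let C : EuclideanSpace ℝ (Fin p) → (Fin s → ℝ) →L[ℝ] ℝ := fun θ =>
    ∑ i, c θ i • ContinuousLinearMap.proj i
  have hC : ContDiffOn ℝ 3 C U := ContDiffOn.sum fun i _ =>
    ((hc i).mono hUD).smul contDiffOn_const
  -- This is the output at time `n - 1`, the latest time in the past at `n`. The feedthrough `d`
  -- acts on the head; the state acts on the past at `n - 1`, which is `ρ⁻¹` times the tail.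
  let Y : EuclideanSpace ℝ (Fin p) → Hist →L[ℝ] ℝ := fun θ =>
    d θ • Hist.head + ρ⁻¹ • ((C θ).comp (Λ θ)).comp Hist.tail
  have hY : ContDiffOn ℝ 3 Y U := ((hd.mono hUD).smul contDiffOn_const).add
    (((hC.clm_comp hΛ).clm_comp contDiffOn_const).const_smul ρ⁻¹)
  have hout : ∀ θ ∈ U, ∀ e : ℤ → ℝ, (∀ n, Summable fun m => |ρ ^ m * past e n m|) → ∀ n,
      filterOutput (A θ) e (n - 1) = Y θ (discount ρ (past e n)) := by
    intro θ hθ e he n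
    have h1 : Hist.tail (discount ρ (past e n)) = ρ • discount ρ (past e (n - 1)) := by
      simpa using tail_pow_discount he n 1
    have h2 : Y θ (discount ρ (past e n)) =
        d θ * e (n - 1) + C θ (Λ θ (discount ρ (past e (n - 1)))) := by
      simp only [Y, _root_.add_apply, _root_.smul_apply,
        ContinuousLinearMap.comp_apply, h1, map_smul, Hist.head_apply, discount_apply (he n),
        smul_eq_mul, past]
      rw [inv_mul_cancel_left₀ hρ0.ne']
      simp
    have h3 := (hasSum_resolvent hθ.2 (b θ) (discount ρ (past e (n - 1)))).mapL (C θ)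
    have h4 : ∀ m : ℕ, C θ (discount ρ (past e (n - 1)) m • (T θ ^ m) (b θ)) =
        PowerSeries.coeff (m + 1) (A θ) * e (n - 1 - ((m + 1 : ℕ) : ℤ)) := by
      intro m
      have h5 : C θ ((F θ) ^ m *ᵥ b θ) = c θ ⬝ᵥ (F θ ^ m *ᵥ b θ) := by
        simp [C, dotProduct]
      rw [(hcoef θ (hUD hθ)).2 m, ← h5, discount_apply (he (n - 1)), map_smul, hTdef]
      simp only [smul_pow, _root_.smul_apply, ← entriesToCLM_pow, map_smul,
        entriesToCLM_apply, smul_eq_mul, past]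
      rw [show n - 1 - 1 - (m : ℤ) = n - 1 - ((m + 1 : ℕ) : ℤ) by push_cast; ring]
      have : ρ ^ m * ρ⁻¹ ^ m = 1 := by rw [← mul_pow, mul_inv_cancel₀ hρ0.ne', one_pow]
      linear_combination (e (n - 1 - ((m + 1 : ℕ) : ℤ)) * (C θ) (F θ ^ m *ᵥ b θ)) * this
    simp only [h4] at h3
    rw [filterOutput, h2]
    have h6 := (hasSum_nat_add_iff (f := fun l : ℕ => PowerSeries.coeff l (A θ) *
      e (n - 1 - (l : ℤ))) 1).1 h3
    rw [h6.tsum_eq, Finset.sum_range_one, (hcoef θ (hUD hθ)).1, add_comm]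
    simp only [Nat.cast_zero, sub_zero, Λ]
  refine ⟨ρ, hρ0, hρ1, U, hU, ⟨hθ₀, isUnit_one_sub_tailComp hk₀⟩, hUD,
    fun k θ => ∑ j : Fin r, (u k j * ρ⁻¹ ^ (j : ℕ)) • (Y θ).comp (Hist.tail ^ (j : ℕ)),
    fun k => ContDiffOn.sum fun j _ => (hY.clm_comp contDiffOn_const).const_smul _, ?_⟩
  intro k θ hθ e he n
  simp only [blockProd, _root_.sum_apply, _root_.smul_apply,
    ContinuousLinearMap.comp_apply, tail_pow_discount he, map_smul]
  refine Finset.sum_congr rfl fun j _ => ?_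
  rw [← hout θ hθ e he, show n - ((j : ℕ) : ℤ) - 1 = n - (((j : ℕ) : ℤ) + 1) by ring, smul_eq_mul,
    smul_eq_mul]
  have : ρ ^ (j : ℕ) * ρ⁻¹ ^ (j : ℕ) = 1 := by rw [← mul_pow, mul_inv_cancel₀ hρ0.ne', one_pow]
  linear_combination (-u k j * filterOutput (A θ) e (n - (((j : ℕ) : ℤ) + 1))) * this

end ECF

/-! ### Empirical characteristic functions and the cost as smooth random fields. -/

namespace ECF

section

variable {E G : Type*} [NormedAddCommGroup E] [NormedSpace ℝ E] [NormedAddCommGroup G]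
  [NormedSpace ℝ G] {U W : Set E}
  {Ω : Type*} [MeasurableSpace Ω] {P : Measure Ω}

theorem ApproxField.subset {X : ℕ → Ω → E → G} {x : E → G} (h : ApproxField P U X x)
    (hWU : W ⊆ U) : ApproxField P W X x := by
  refine ⟨fun θ hθ => h.err θ (hWU hθ), ?_⟩
  obtain ⟨l, τ, hl, hτ, hx, hxL, hX⟩ := h.reg
  refine ⟨l, τ, hl, hτ, fun θ hθ => hx θ (hWU hθ),
    fun θ hθ θ' hθ' => hxL θ (hWU hθ) θ' (hWU hθ'), hX.mono fun ω hω N => ?_⟩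
  exact ⟨(hω N).1, fun θ hθ => (hω N).2.1 θ (hWU hθ),
    fun θ hθ θ' hθ' => (hω N).2.2 θ (hWU hθ) θ' (hWU hθ')⟩

theorem ApproxField₂.subset {X : ℕ → Ω → E → G} {x : E → G} (h : ApproxField₂ P U X x)
    (hWU : W ⊆ U) : ApproxField₂ P W X x := by
  obtain ⟨X₁, X₂, x₁, x₂, hd, hdx, h0, h1, h2⟩ := h
  exact ⟨X₁, X₂, x₁, x₂, hd.mono fun ω hω N θ hθ => hω N θ (hWU hθ), fun θ hθ => hdx θ (hWU hθ),
    h0.subset hWU, h1.subset hWU, h2.subset hWU⟩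

/-- Meant for the observed data, whose averages do not vary with the parameter of the simulation. -/
theorem ApproxField₂.of_boundedInM [IsProbabilityMeasure P] (U : Set E) {X : ℕ → Ω → G} {x : G}
    (h : BoundedInM P (fun N ω => X N ω - x) rate) :
    ApproxField₂ P U (fun N ω _ => X N ω) (fun _ => x) := by
  refine ⟨fun _ _ _ => 0, fun _ _ _ => 0, fun _ => 0, fun _ => 0,
    ae_of_all _ fun _ _ θ _ => ⟨hasFDerivAt_const _ θ, hasFDerivAt_const 0 θ⟩,
    fun θ _ => ⟨hasFDerivAt_const _ θ, hasFDerivAt_const 0 θ⟩,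
    ⟨fun _ _ => h, ‖x‖, fun N ω => ‖X N ω - x‖, norm_nonneg _, h.norm, fun _ _ => le_rfl,
      fun θ _ θ' _ => by simp; positivity, ae_of_all _ fun ω N => ⟨norm_nonneg _, fun θ _ => ?_,
        fun θ _ θ' _ => by simp; positivity⟩⟩,
    ApproxField.const U 0, ApproxField.const U 0⟩
  have := norm_add_le x (X N ω - x)
  rwa [add_sub_cancel] at this

theorem exists_bound_lipschitz_of_contDiffAt {f : E → G} {θ : E} (hf : ContDiffAt ℝ 1 f θ) :
    ∃ C : ℝ, ∃ t ∈ 𝓝 θ, (∀ a ∈ t, ‖f a‖ ≤ C) ∧ ∀ a ∈ t, ∀ b ∈ t, ‖f a - f b‖ ≤ C * ‖a - b‖ := by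
  obtain ⟨K, t, ht, hK⟩ := hf.exists_lipschitzOnWith
  have h1 : ∀ᶠ a in 𝓝 θ, ‖f a‖ < ‖f θ‖ + 1 :=
    hf.continuousAt.norm.eventually_lt_const (lt_add_one _)
  refine ⟨max K (‖f θ‖ + 1), t ∩ {a | ‖f a‖ < ‖f θ‖ + 1}, inter_mem ht h1,
    fun a ha => ha.2.le.trans (le_max_right _ _), fun a ha b hb => ?_⟩
  exact (hK.norm_sub_le ha.1 hb.1).trans (by gcongr; exact le_max_left _ _)

theorem ParamPolyLip.exists_of_contDiffAt {B : E → Hist →L[ℝ] G} {θ : E}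
    (hB : ContDiffAt ℝ 1 B θ) : ∃ t ∈ 𝓝 θ, ∀ W ⊆ t, ParamPolyLip W fun θ a => B θ a := by
  obtain ⟨C, t, ht, h1, h2⟩ := exists_bound_lipschitz_of_contDiffAt hB
  exact ⟨t, ht, fun W hW => ParamPolyLip.apply (fun θ hθ => h1 θ (hW hθ))
    fun θ hθ θ' hθ' => h2 θ (hW hθ) θ' (hW hθ')⟩

/-- The parameter derivative of a family of linear functionals. -/
noncomputable def paramDeriv (B : E → Hist →L[ℝ] G) (θ : E) : Hist →L[ℝ] E →L[ℝ] G :=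
  (fderiv ℝ B θ).flip

theorem hasFDerivAt_paramDeriv {B : E → Hist →L[ℝ] G} {θ : E} (hB : DifferentiableAt ℝ B θ)
    (a : Hist) : HasFDerivAt (fun θ => B θ a) (paramDeriv B θ a) θ := by
  have h := ((ContinuousLinearMap.apply ℝ G a).hasFDerivAt (x := B θ)).comp θ hB.hasFDerivAt
  exact h

theorem contDiffOn_paramDeriv {B : E → Hist →L[ℝ] G} {n m : WithTop ℕ∞} (hU : IsOpen U)
    (hB : ContDiffOn ℝ n B U) (hmn : m + 1 ≤ n) : ContDiffOn ℝ m (paramDeriv B) U := by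
  have h : ContDiff ℝ m fun S : E →L[ℝ] Hist →L[ℝ] G => S.flip :=
    IsBoundedLinearMap.contDiff (F := Hist →L[ℝ] E →L[ℝ] G)
      ⟨⟨fun _ _ => rfl, fun _ _ => rfl⟩, 1, one_pos, fun S => by
        rw [ContinuousLinearMap.opNorm_flip, one_mul]⟩
  exact h.comp_contDiffOn (hB.fderiv_of_isOpen hU hmn)

/-- The derivatives of `exp(B θ a)` are this bounded factor times expressions polynomial in linear
functionals of `a`. Of the three derivatives of `B`, two are used for the fields and the third for
the local Lipschitz bound of the second derivative. -/
theorem ApproxField₂.exists_timeAvg_cexp [IsProbabilityMeasure P] [FiniteDimensional ℝ E]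
    {e : ℤ → Ω → ℝ} {ρ : ℝ} (he : IsNoise P e) (hρ0 : 0 < ρ) (hρ1 : ρ < 1)
    {B : E → Hist →L[ℝ] ℂ} (hU : IsOpen U) (hB : ContDiffOn ℝ 3 B U)
    (hre : ∀ θ a, (B θ a).re = 0) {θ₀ : E} (hθ₀ : θ₀ ∈ U) (r : ℕ) :
    ∃ W, IsOpen W ∧ θ₀ ∈ W ∧ W ⊆ U ∧ (∀ θ ∈ W, PolyLip fun a => Complex.exp (B θ a)) ∧
      ApproxField₂ P W (fun N ω θ => timeAvg r N fun n => Complex.exp (B θ (noisePast ρ e n ω)))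
        (fun θ => ∫ ω, Complex.exp (B θ (noisePast ρ e 0 ω)) ∂P) := by
  set B₁ := paramDeriv B
  set B₂ := paramDeriv B₁
  have hB₁ : ContDiffOn ℝ 2 B₁ U := contDiffOn_paramDeriv hU hB (by norm_num)
  have hB₂ : ContDiffOn ℝ 1 B₂ U := contDiffOn_paramDeriv hU hB₁ (by norm_num)
  have hn := hU.mem_nhds hθ₀
  obtain ⟨t₀, ht₀, hp₀⟩ := ParamPolyLip.exists_of_contDiffAt
    ((hB.contDiffAt hn).of_le (by norm_num))
  obtain ⟨t₁, ht₁, hp₁⟩ := ParamPolyLip.exists_of_contDiffAt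
    ((hB₁.contDiffAt hn).of_le (by norm_num))
  obtain ⟨t₂, ht₂, hp₂⟩ := ParamPolyLip.exists_of_contDiffAt (hB₂.contDiffAt hn)
  obtain ⟨W, hWt, hW, hθW⟩ := mem_nhds_iff.1
    (inter_mem hn (inter_mem ht₀ (inter_mem ht₁ ht₂)))
  have hWU : W ⊆ U := fun θ hθ => (hWt hθ).1
  have q₀ := (hp₀ W fun θ hθ => (hWt hθ).2.1).cexp fun θ _ a => hre θ a
  have q₁ := hp₁ W fun θ hθ => (hWt hθ).2.2.1
  have q₂ := hp₂ W fun θ hθ => (hWt hθ).2.2.2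
  obtain ⟨β, hβ⟩ : ∃ β : ℂ →L[ℝ] (E →L[ℝ] ℂ) →L[ℝ] (E →L[ℝ] ℂ), ∀ z f, β z f = z • f :=
    ⟨ContinuousLinearMap.lsmul ℝ ℂ, fun _ _ => rfl⟩
  have q₁' : ParamPolyLip W fun θ a => β (Complex.exp (B θ a)) (B₁ θ a) := q₀.bilin β q₁
  have q₂' : ParamPolyLip W fun θ a => β.precompR E (Complex.exp (B θ a)) (B₂ θ a) +
      β.precompL E (β (Complex.exp (B θ a)) (B₁ θ a)) (B₁ θ a) := by
    have a1 := ParamPolyLip.bilin (G₃ := E →L[ℝ] E →L[ℝ] ℂ) (β.precompR E) q₀ q₂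
    have a2 := ParamPolyLip.bilin (G₃ := E →L[ℝ] E →L[ℝ] ℂ) (β.precompL E) q₁' q₁
    exact a1.add a2
  have hd : ∀ θ ∈ W, ∀ a, HasFDerivAt (fun θ => Complex.exp (B θ a))
      (β (Complex.exp (B θ a)) (B₁ θ a)) θ := by
    intro θ hθ a
    rw [hβ]
    exact (hasFDerivAt_paramDeriv ((hB.contDiffAt (hU.mem_nhds (hWU hθ))).differentiableAt
      (by norm_num)) a).cexp
  refine ⟨W, hW, hθW, hWU, fun θ hθ => q₀.polyLip hθ, ApproxField₂.of_paramPolyLip he hρ0 hρ1 hW q₀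
    q₁' q₂' hd (fun θ hθ a => ?_) r⟩
  exact ContinuousLinearMap.hasFDerivAt_of_bilinear β (hd θ hθ a)
    (hasFDerivAt_paramDeriv ((hB₁.contDiffAt (hU.mem_nhds (hWU hθ))).differentiableAt
      (by norm_num)) a)

end

/-! ### The averaged scores and the cost -/

variable {Ω : Type*} [MeasurableSpace Ω] {P : Measure Ω} [IsProbabilityMeasure P] {p r M : ℕ}
  {A : EuclideanSpace ℝ (Fin p) → PowerSeries ℝ} {D : Set (EuclideanSpace ℝ (Fin p))}

/-- The values of the empirical characteristic function of the blocks are, near each parameter,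
smooth fields approximating the characteristic function. -/
theorem IsStableC3.exists_approxField₂_timeAvg (hD : IsOpen D) (hA : IsStableC3 A D) {Z : ℝ → Ω → ℝ}
    {δ : ℝ} (he : IsNoise P fun n => increment Z δ n) {θ₀ : EuclideanSpace ℝ (Fin p)} (hθ₀ : θ₀ ∈ D)
    (u : Fin M → Fin r → ℝ) : ∃ W, IsOpen W ∧ θ₀ ∈ W ∧ W ⊆ D ∧ ∀ k,
      (∀ θ ∈ W, Integrable (fun ω => Complex.exp (Complex.I *
        blockProd (u k) (series A Z δ θ ω) ((r : ℤ) + 1))) P) ∧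
      ApproxField₂ P W (fun N ω θ => timeAvg r N fun n =>
        Complex.exp (Complex.I * blockProd (u k) (series A Z δ θ ω) n))
        (fun θ => ∫ ω, Complex.exp (Complex.I *
          blockProd (u k) (series A Z δ θ ω) ((r : ℤ) + 1)) ∂P) := by
  obtain ⟨ρ, hρ0, hρ1, U, hU, hθU, hUD, B, hB, hBeq⟩ := hA.exists_blockProd_eq hD hθ₀ u
  let J : ℝ →L[ℝ] ℂ := Complex.I • Complex.ofRealCLM
  have hJ : ∀ x, J x = Complex.I * x := fun x => rfl
  have hJB : ∀ k, ContDiffOn ℝ 3 (fun θ => J.comp (B k θ)) U := fun k =>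
    contDiffOn_const.clm_comp (hB k)
  choose W hW hθW hWU hpl hWf using fun k => ApproxField₂.exists_timeAvg_cexp (P := P) he hρ0 hρ1 hU
    (hJB k) (fun θ a => by simp [hJ]) hθU r
  -- The null set is where some discounted past is not summable; it does not depend on `θ`, so the
  -- fields agree on all of `U` at once.
  have hval : ∀ᵐ ω ∂P, ∀ k, ∀ θ ∈ U, ∀ n,
      Complex.exp ((J.comp (B k θ)) (noisePast ρ (fun n => increment Z δ n) n ω)) =
        Complex.exp (Complex.I * blockProd (u k) (series A Z δ θ ω) n) := by
    filter_upwards [he.ae_summable hρ0.le hρ1] with ω hω k θ hθ n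
    rw [ContinuousLinearMap.comp_apply, hJ, series, hBeq k θ hθ _ hω n]
    rfl
  have hWo : IsOpen (U ∩ ⋂ k, W k) := hU.inter (isOpen_iInter_of_finite hW)
  have hsub : ∀ k, U ∩ ⋂ k, W k ⊆ W k := fun k θ hθ => Set.mem_iInter.1 hθ.2 k
  have hcongr : ∀ k, ∀ θ ∈ U, ∀ n, (fun ω => Complex.exp ((J.comp (B k θ))
      (noisePast ρ (fun n => increment Z δ n) n ω))) =ᵐ[P] fun ω =>
        Complex.exp (Complex.I * blockProd (u k) (series A Z δ θ ω) n) := fun k θ hθ n =>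
    hval.mono fun ω hω => hω k θ hθ n
  refine ⟨U ∩ ⋂ k, W k, hWo, ⟨hθU, Set.mem_iInter.2 hθW⟩, fun θ hθ => hUD hθ.1,
    fun k => ⟨fun θ hθ => ?_, ((hWf k).subset (hsub k)).congr hWo ?_ fun θ hθ => ?_⟩⟩
  · exact ((hpl k θ (hsub k hθ)).integrable he hρ0.le hρ1 _).congr (hcongr k θ hθ.1 _)
  · filter_upwards [hval] with ω hω N θ hθ
    simp_rw [hω k θ hθ.1]
  -- Stationarity moves the expectation from time 0 to the time `r + 1` of `expScore`.
  · rw [(hpl k θ (hsub k hθ)).integral_eq he hρ0.le hρ1 0 ((r : ℤ) + 1)]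
    exact integral_congr_ae (hcongr k θ hθ.1 _)

theorem avgScore_eq (u : Fin M → Fin r → ℝ) (y y' : ℤ → ℝ) (N : ℕ) (k : Fin M) :
    avgScore u y y' N k =
      timeAvg r N (fun n => Complex.exp (Complex.I * blockProd (u k) y n)) -
        timeAvg r N (fun n => Complex.exp (Complex.I * blockProd (u k) y' n)) := by
  rw [timeAvg_sub, avgScore, timeAvg, Complex.real_smul]
  simp [score]

/-- The weighted square is the real part of a finite sum of products, and all these operations
preserve `ApproxField₂`. -/
theorem ApproxField₂.weightedSq {U : Set (EuclideanSpace ℝ (Fin p))}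
    {X : Fin M → ℕ → Ω → EuclideanSpace ℝ (Fin p) → ℂ} {x : Fin M → EuclideanSpace ℝ (Fin p) → ℂ}
    (h : ∀ k, ApproxField₂ P U (X k) (x k)) (K : Matrix (Fin M) (Fin M) ℂ) :
    ApproxField₂ P U (fun N ω θ => ECF.weightedSq K fun k => X k N ω θ)
      (fun θ => ECF.weightedSq K fun k => x k θ) := by
  have h1 := ApproxField₂.clm_comp Complex.reCLM (ApproxField₂.sum Finset.univ fun k _ =>
    ApproxField₂.bilin (ContinuousLinearMap.mul ℝ ℂ)
      (ApproxField₂.clm_comp (Complex.conjCLE : ℂ →L[ℝ] ℂ) (h k))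
      (ApproxField₂.sum Finset.univ fun k' _ =>
        ApproxField₂.clm_comp (ContinuousLinearMap.mul ℝ ℂ (K⁻¹ k k')) (h k')))
  exact h1

/-- Near each parameter the cost is a smooth field approximating the asymptotic cost. -/
theorem exists_approxField₂_cost (hD : IsOpen D) (hA : IsStableC3 A D) {Z Z' : ℝ → Ω → ℝ} {δ : ℝ}
    (he : IsNoise P fun n => increment Z δ n) (he' : IsNoise P fun n => increment Z' δ n)
    {θs θ₀ : EuclideanSpace ℝ (Fin p)} (hθs : θs ∈ D) (hθ₀ : θ₀ ∈ D) (u : Fin M → Fin r → ℝ)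
    (K : Matrix (Fin M) (Fin M) ℂ) : ∃ W, IsOpen W ∧ θ₀ ∈ W ∧ W ⊆ D ∧
      ApproxField₂ P W (cost A Z Z' δ u K θs) (asympCost P A Z Z' δ u K θs) := by
  obtain ⟨Ws, -, hθsW, -, hs⟩ := hA.exists_approxField₂_timeAvg hD he hθs u
  obtain ⟨W, hW, hθW, hWD, h⟩ := hA.exists_approxField₂_timeAvg hD he' hθ₀ u
  refine ⟨W, hW, hθW, hWD, ?_⟩
  have h1 : ∀ k, ApproxField₂ P W
      (fun N ω θ => avgScore u (series A Z δ θs ω) (series A Z' δ θ ω) N k)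
      (fun θ => expScore P A Z Z' δ u θs θ k) := by
    intro k
    obtain ⟨X₁, X₂, x₁, x₂, -, -, h0, -, -⟩ := (hs k).2
    refine ((ApproxField₂.of_boundedInM W (h0.err θs hθsW)).sub (h k).2).congr hW
      (ae_of_all _ fun ω N θ _ => (avgScore_eq u _ _ N k).symm) fun θ hθ => ?_
    exact (integral_sub ((hs k).1 θs hθsW) ((h k).1 θ hθ)).symm
  exact ApproxField₂.weightedSq h1 K

end ECF

/-! ### Newton's method and the zeros of random gradients. -/

namespace ECF

/-- A quantitative Newton-type statement: a map whose derivative is close to an invertible operator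
and whose value at `a` is small has exactly one zero near `a`, given by one Newton step up to a
quadratic error. -/
theorem exists_unique_zero_of_hasFDerivAt {E : Type*} [NormedAddCommGroup E] [NormedSpace ℝ E]
    [CompleteSpace E] {f : E → E} {f' : E → E →L[ℝ] E} {a : E} {ε C η L : ℝ} (H : E ≃L[ℝ] E)
    (hε : 0 < ε) (hC : 0 < C) (hη : 0 ≤ η) (hL : 0 ≤ L) (hJ : ‖(H.symm : E →L[ℝ] E)‖ ≤ C)
    (hf : ∀ θ ∈ Metric.ball a ε, HasFDerivAt f (f' θ) θ)
    (hf' : ∀ θ ∈ Metric.ball a ε, ‖f' θ - (H : E →L[ℝ] E)‖ ≤ η + L * ‖θ - a‖)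
    (h1 : 4 * C * η ≤ 1) (h2 : 4 * C * L * ε ≤ 1) (h3 : 4 * C * ‖f a‖ ≤ ε) :
    ∃ z ∈ Metric.closedBall a (ε / 2), f z = 0 ∧
      (∀ z' ∈ Metric.ball a ε, f z' = 0 → z' = z) ∧
      ‖z - a + H.symm (f a)‖ ≤ 2 * C ^ 2 * ‖f a‖ * (η + 2 * L * C * ‖f a‖) := by
  have hJa : ∀ x, ‖H.symm x‖ ≤ C * ‖x‖ := fun x =>
    (H.symm : E →L[ℝ] E).le_of_opNorm_le hJ x
  -- Mean value inequality for `f - H` on the ball of radius `t`. The radius is left free: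
  -- contraction uses any `t < ε`, the final estimate `t = ‖z - a‖`.
  have hlin : ∀ (t : ℝ) (θ θ' : E), 0 ≤ t → t < ε → ‖θ - a‖ ≤ t → ‖θ' - a‖ ≤ t →
      ‖f θ - f θ' - H (θ - θ')‖ ≤ (η + L * t) * ‖θ - θ'‖ := by
    intro t θ θ' _ htε hθ hθ'
    have hsub : Metric.closedBall a t ⊆ Metric.ball a ε := Metric.closedBall_subset_ball htε
    have h := Convex.norm_image_sub_le_of_norm_hasFDerivWithin_le (f := fun x => f x - H x)
      (f' := fun x => f' x - (H : E →L[ℝ] E)) (s := Metric.closedBall a t) (C := η + L * t)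
        (x := θ') (y := θ)
      (fun x hx => ((hf x (hsub hx)).sub (H : E →L[ℝ] E).hasFDerivAt).hasFDerivWithinAt)
      (fun x hx => (hf' x (hsub hx)).trans (by
        have : ‖x - a‖ ≤ t := by simpa [dist_eq_norm] using hx
        gcongr)) (convex_closedBall a t) (by simpa [dist_eq_norm] using hθ')
      (by simpa [dist_eq_norm] using hθ)
    refine le_trans (le_of_eq ?_) h
    congr 1
    rw [map_sub]
    abel
  set Φ : E → E := fun θ => θ - H.symm (f θ) with hΦ
  -- `C (η + L t) ≤ 1/4 + 1/4` by `h1` and `h2`.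
  have hcontr : ∀ θ ∈ Metric.ball a ε, ∀ θ' ∈ Metric.ball a ε, ‖Φ θ - Φ θ'‖ ≤ 1 / 2 * ‖θ - θ'‖ := by
    intro θ hθ θ' hθ'
    rw [Metric.mem_ball, dist_eq_norm] at hθ hθ'
    set t := max ‖θ - a‖ ‖θ' - a‖
    have htε : t < ε := max_lt hθ hθ'
    have h := hlin t θ θ' ((norm_nonneg _).trans (le_max_left _ _)) htε (le_max_left _ _)
      (le_max_right _ _)
    have e : Φ θ - Φ θ' = -H.symm (f θ - f θ' - H (θ - θ')) := by
      simp only [hΦ, map_sub, ContinuousLinearEquiv.symm_apply_apply]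
      abel
    rw [e, norm_neg]
    refine (hJa _).trans ((mul_le_mul_of_nonneg_left h hC.le).trans ?_)
    rw [← mul_assoc]
    gcongr
    have : C * L * t ≤ C * L * ε := by gcongr
    nlinarith
  have hΦa : ‖Φ a - a‖ ≤ C * ‖f a‖ := by
    simp only [hΦ, sub_sub_cancel_left, norm_neg]
    exact hJa _
  have hfix : ∀ θ, Φ θ = θ ↔ f θ = 0 := fun θ => by
    simp [hΦ]
  have hsub : Metric.closedBall a (ε / 2) ⊆ Metric.ball a ε :=
    Metric.closedBall_subset_ball (by linarith)
  have ha : a ∈ Metric.ball a ε := Metric.mem_ball_self hε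
  -- Half of the radius `ε/2` from contraction, plus `C ‖f a‖ ≤ ε/4` by `h3`.
  have hmaps : Set.MapsTo Φ (Metric.closedBall a (ε / 2)) (Metric.closedBall a (ε / 2)) := by
    intro θ hθ
    have h := hcontr θ (hsub hθ) a ha
    rw [Metric.mem_closedBall, dist_eq_norm] at hθ ⊢
    have := norm_add_le (Φ θ - Φ a) (Φ a - a)
    rw [sub_add_sub_cancel] at this
    linarith
  have hK : ContractingWith (1 / 2 : NNReal) (hmaps.restrict Φ _ _) := by
    refine ⟨by rw [← NNReal.coe_lt_coe]; norm_num, LipschitzWith.of_dist_le_mul fun x y => ?_⟩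
    have := hcontr x (hsub x.2) y (hsub y.2)
    simpa [Subtype.dist_eq, dist_eq_norm] using this
  obtain ⟨z, hz, hzfix, -⟩ := ContractingWith.exists_fixedPoint'
    (Metric.isClosed_closedBall.isComplete) hmaps hK
    (Metric.mem_closedBall_self (by positivity) : a ∈ Metric.closedBall a (ε / 2))
      (edist_ne_top _ _)
  have hz0 : f z = 0 := (hfix z).1 hzfix
  refine ⟨z, hz, hz0, fun z' hz' hfz' => ?_, ?_⟩
  · have h := hcontr z' hz' z (hsub hz)
    rw [(hfix z').2 hfz', (hfix z).2 hz0] at h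
    have : ‖z' - z‖ = 0 := le_antisymm (by linarith [norm_nonneg (z' - z)]) (norm_nonneg _)
    exact sub_eq_zero.1 (norm_eq_zero.1 this)
  · have hd : ‖z - a‖ ≤ 2 * (C * ‖f a‖) := by
      have h := hcontr z (hsub hz) a ha
      have := norm_add_le (Φ z - Φ a) (Φ a - a)
      rw [sub_add_sub_cancel, (hfix z).2 hz0] at this
      rw [(hfix z).2 hz0] at h
      linarith
    have hzε : ‖z - a‖ < ε := by
      have := hsub hz
      rwa [Metric.mem_ball, dist_eq_norm] at this
    have h := hlin ‖z - a‖ z a (norm_nonneg _) hzε le_rfl (by simp)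
    have e : z - a + H.symm (f a) = -H.symm (f z - f a - H (z - a)) := by
      simp only [hz0, map_sub, map_zero, ContinuousLinearEquiv.symm_apply_apply]
      abel
    rw [e, norm_neg]
    calc ‖H.symm (f z - f a - H (z - a))‖ ≤ C * ((η + L * ‖z - a‖) * ‖z - a‖) :=
          (hJa _).trans (mul_le_mul_of_nonneg_left h hC.le)
      _ ≤ C * ((η + L * (2 * (C * ‖f a‖))) * (2 * (C * ‖f a‖))) := by gcongr
      _ = _ := by ring

/-! ### Gradient equations of random fields -/

variable {E : Type*} [NormedAddCommGroup E] [InnerProductSpace ℝ E] [CompleteSpace E]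

/-- The Riesz isomorphism, as a real linear map. -/
noncomputable def riesz (E : Type*) [NormedAddCommGroup E] [InnerProductSpace ℝ E]
    [CompleteSpace E] : (E →L[ℝ] ℝ) →L[ℝ] E :=
  LinearMap.mkContinuous
    { toFun := fun f => (InnerProductSpace.toDual ℝ E).symm f
      map_add' := fun f g => map_add _ f g
      map_smul' := fun c f => by simp } 1 fun f => by simp

theorem gradient_eq_riesz (f : E → ℝ) (θ : E) : gradient f θ = riesz E (fderiv ℝ f θ) := rfl

theorem riesz_eq_zero {f : E →L[ℝ] ℝ} : riesz E f = 0 ↔ f = 0 :=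
  map_eq_zero_iff _ (InnerProductSpace.toDual ℝ E).symm.injective

variable {Ω : Type*} [MeasurableSpace Ω] {P : Measure Ω} [IsProbabilityMeasure P]

/-- Outside an event controlled by `O_M(N^{-1/2})` variables, the gradients of the random fields
have no zero in `S`. -/
def NoCriticalPoint (P : Measure Ω) (V : ℕ → Ω → E → ℝ) (S : Set E) : Prop :=
  ∃ T : ℕ → Ω → ℝ, BoundedInM P T rate ∧
    ∀ᵐ ω ∂P, ∀ N, 0 ≤ T N ω ∧ (T N ω < 1 → ∀ θ ∈ S, gradient (V N ω) θ ≠ 0)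

/-- Let `m > 0` be the norm of the limiting derivative at `θ₀`. If `T < 1`, the random derivative is
off by less than `m/3` at `θ₀` and varies by at most `m/3` over the ball, so it cannot vanish there.
As `T` is a sum of nonnegative terms, `T < 1` bounds each of them. -/
theorem ApproxField₂.noCriticalPoint {U : Set E} {V : ℕ → Ω → E → ℝ} {w : E → ℝ}
    (hU : IsOpen U) (h : ApproxField₂ P U V w) {θ₀ : E} (hθ₀ : θ₀ ∈ U) (hw : gradient w θ₀ ≠ 0) :
    ∃ S ∈ 𝓝 θ₀, NoCriticalPoint P V S := by
  obtain ⟨X₁, X₂, x₁, x₂, hd, hdx, -, h1, -⟩ := h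
  obtain ⟨l, τ, hl, hτ, -, -, hX⟩ := h1.reg
  have herr := (h1.err θ₀ hθ₀).norm
  set m := ‖x₁ θ₀‖
  have hm : 0 < m := by
    refine norm_pos_iff.2 fun h0 => hw ?_
    rw [gradient_eq_riesz, (hdx θ₀ hθ₀).1.fderiv, h0, map_zero]
  set ε := m / 3 / (l + 1)
  have hε : 0 < ε := by positivity
  refine ⟨U ∩ Metric.ball θ₀ ε, inter_mem (hU.mem_nhds hθ₀) (Metric.ball_mem_nhds θ₀ hε),
    fun N ω => 3 / m * ‖X₁ N ω θ₀ - x₁ θ₀‖ + τ N ω,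
    BoundedInM.add rate_nonneg (herr.clm_comp (ContinuousLinearMap.mul ℝ ℝ (3 / m))) hτ, ?_⟩
  filter_upwards [hd, hX] with ω hω hω' N
  obtain ⟨hτ0, -, hLip⟩ := hω' N
  have ht : 0 ≤ 3 / m * ‖X₁ N ω θ₀ - x₁ θ₀‖ := by positivity
  refine ⟨by positivity, fun hT θ hθ h0 => ?_⟩
  rw [gradient_eq_riesz, (hω N θ hθ.1).1.fderiv, riesz_eq_zero] at h0
  have hL := hLip θ₀ hθ₀ θ hθ.1
  have hdist : ‖θ₀ - θ‖ < ε := by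
    have := hθ.2
    rwa [Metric.mem_ball, dist_comm, dist_eq_norm] at this
  rw [h0, sub_zero] at hL
  have e1 : (l + τ N ω) * ‖θ₀ - θ‖ ≤ m / 3 := by
    calc (l + τ N ω) * ‖θ₀ - θ‖ ≤ (l + 1) * ε := by
          gcongr
          linarith
      _ = m / 3 := by
          simp only [ε]
          field_simp
  have e2 : ‖X₁ N ω θ₀ - x₁ θ₀‖ < m / 3 := by
    have : 3 / m * ‖X₁ N ω θ₀ - x₁ θ₀‖ < 1 := by linarith
    rw [div_mul_eq_mul_div, div_lt_one hm] at this
    linarith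
  have e3 : m ≤ ‖X₁ N ω θ₀‖ + ‖X₁ N ω θ₀ - x₁ θ₀‖ := by
    have := norm_sub_norm_le (x₁ θ₀) (X₁ N ω θ₀)
    rw [norm_sub_rev (x₁ θ₀)] at this
    simp only [m]
    linarith
  linarith

/-- Under finite unions the control variables add up, so a finite cover needs no supremum over
parameters. -/
theorem noCriticalPoint_of_isCompact {V : ℕ → Ω → E → ℝ} {S : Set E} (hS : IsCompact S)
    (h : ∀ θ ∈ S, ∃ t ∈ 𝓝 θ, NoCriticalPoint P V t) : NoCriticalPoint P V S := by
  refine hS.induction_on (p := NoCriticalPoint P V) ?_ ?_ ?_ ?_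
  · exact ⟨fun _ _ => 0, BoundedInM.zero rate, ae_of_all _ fun ω N => by simp⟩
  · rintro s t hst ⟨T, hT, h⟩
    exact ⟨T, hT, h.mono fun ω hω N => ⟨(hω N).1, fun h1 θ hθ => (hω N).2 h1 θ (hst hθ)⟩⟩
  · rintro s t ⟨T, hT, h⟩ ⟨T', hT', h'⟩
    refine ⟨fun N ω => T N ω + T' N ω, BoundedInM.add rate_nonneg hT hT', ?_⟩
    filter_upwards [h, h'] with ω hω hω' N
    obtain ⟨h0, h1⟩ := hω N
    obtain ⟨h0', h1'⟩ := hω' N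
    refine ⟨by positivity, fun hlt θ hθ => ?_⟩
    rcases hθ with hθ | hθ
    · exact h1 (by linarith) θ hθ
    · exact h1' (by linarith) θ hθ
  · intro θ hθ
    obtain ⟨t, ht, h⟩ := h θ hθ
    exact ⟨t, mem_nhdsWithin_of_mem_nhds ht, h⟩

theorem rate_mul_rate {N : ℕ} (hN : 1 ≤ N) : rate N * rate N = (N : ℝ)⁻¹ := by
  rw [rate, if_neg (by omega), ← mul_inv, Real.mul_self_sqrt (Nat.cast_nonneg N)]

/-- The expansion of a zero of the gradient of a smooth random field around the nondegenerate zero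
of the gradient of the limiting field. -/
theorem exists_boundedInM_newton_error [FiniteDimensional ℝ E]
    {V : ℕ → Ω → E → ℝ} {w : E → ℝ} {D D₀ : Set E}
    {θs : E} (hD₀ : IsCompact D₀) (hD₀D : D₀ ⊆ D) (hθs : θs ∈ interior D₀)
    (hV : ∀ θ ∈ D, ∃ U, IsOpen U ∧ θ ∈ U ∧ U ⊆ D ∧ ApproxField₂ P U V w)
    (hw : ∀ θ ∈ D, gradient w θ = 0 ↔ θ = θs) (H : E ≃L[ℝ] E)
    (hH : (H : E →L[ℝ] E) = fderiv ℝ (gradient w) θs) :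
    ∃ Y : ℕ → Ω → ℝ, BoundedInM P Y (fun N => rate N * rate N) ∧
      ∀ᵐ ω ∂P, ∀ N, ∀ θ ∈ D₀, (∀ z ∈ D₀, gradient (V N ω) z = 0 →
          (∀ z' ∈ D₀, gradient (V N ω) z' = 0 → z' = z) → θ = z) →
        ‖θ - θs + H.symm (gradient (V N ω) θs)‖ ≤ Y N ω := by
  have hθsD : θs ∈ D := hD₀D (interior_subset hθs)
  obtain ⟨U, hU, hθU, -, X₁, X₂, x₁, x₂, hd, hdx, -, h1, h2⟩ := hV θs hθsD
  set D₁ : (E →L[ℝ] E →L[ℝ] ℝ) →L[ℝ] (E →L[ℝ] E) :=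
    ContinuousLinearMap.compL ℝ E (E →L[ℝ] ℝ) E (riesz E)
  have g1 := h1.clm_comp (riesz E)
  have g2 := h2.clm_comp D₁
  have hgw : ∀ θ ∈ U, gradient w θ = riesz E (x₁ θ) := fun θ hθ => by
    rw [gradient_eq_riesz, (hdx θ hθ).1.fderiv]
  have hHx : (H : E →L[ℝ] E) = D₁ (x₂ θs) := by
    rw [hH]
    refine HasFDerivAt.fderiv ?_
    have := ((riesz E).hasFDerivAt (x := x₁ θs)).comp θs (hdx θs hθU).2
    refine this.congr_of_eventuallyEq ?_
    filter_upwards [hU.mem_nhds hθU] with θ hθ using hgw θ hθ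
  obtain ⟨l, τ, hl, hτ, -, -, hreg⟩ := g2.reg
  set G : ℕ → Ω → ℝ := fun N ω => ‖riesz E (X₁ N ω θs)‖
  set F : ℕ → Ω → ℝ := fun N ω => ‖D₁ (X₂ N ω θs) - (H : E →L[ℝ] E)‖
  have hG : BoundedInM P G rate := by
    have h0 : riesz E (x₁ θs) = 0 := by rw [← hgw θs hθU, (hw θs hθsD).2 rfl]
    simpa only [h0, sub_zero] using (g1.err θs hθU).norm
  have hF : BoundedInM P F rate := by
    simpa only [F, hHx] using (g2.err θs hθU).norm
  set C : ℝ := ‖(H.symm : E →L[ℝ] E)‖ + 1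
  have hC : 0 < C := by positivity
  obtain ⟨ε₀, hε₀, hball⟩ := Metric.mem_nhds_iff.1
    (inter_mem (hU.mem_nhds hθU) (mem_interior_iff_mem_nhds.1 hθs))
  -- With `τ < 1` the Lipschitz constant is at most `l + 1`, so `ε` can be deterministic.
  set ε : ℝ := min ε₀ (1 / (4 * C * (l + 1)))
  have hε : 0 < ε := by positivity
  have hεball : Metric.ball θs ε ⊆ U ∩ D₀ := (Metric.ball_subset_ball (min_le_left _ _)).trans hball
  have hεC : 4 * C * (l + 1) * ε ≤ 1 := by
    calc 4 * C * (l + 1) * ε ≤ 4 * C * (l + 1) * (1 / (4 * C * (l + 1))) := by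
          gcongr
          exact min_le_right _ _
      _ = 1 := by field_simp
  obtain ⟨T₀, hT₀, hfar⟩ := noCriticalPoint_of_isCompact (P := P) (V := V)
    (hD₀.diff (Metric.isOpen_ball (x := θs) (ε := ε))) fun θ hθ => by
      have hne : θ ≠ θs := fun h => hθ.2 (h ▸ Metric.mem_ball_self hε)
      obtain ⟨U', hU', hθU', -, hV'⟩ := hV θ (hD₀D hθ.1)
      exact hV'.noCriticalPoint hU' hθU' (mt (hw θ (hD₀D hθ.1)).1 hne)
  obtain ⟨R, hR⟩ := hD₀.isBounded.subset_closedBall θs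
  -- `T < 1` gives at once the three smallness conditions of the Newton lemma and the absence of
  -- critical points away from `θs`.
  set T : ℕ → Ω → ℝ := fun N ω => 4 * C * F N ω + τ N ω + 4 * C / ε * G N ω + T₀ N ω
  have hT : BoundedInM P T rate :=
    BoundedInM.add rate_nonneg (BoundedInM.add rate_nonneg (BoundedInM.add rate_nonneg
      (hF.clm_comp (ContinuousLinearMap.mul ℝ ℝ (4 * C))) hτ)
      (hG.clm_comp (ContinuousLinearMap.mul ℝ ℝ (4 * C / ε)))) hT₀
  have hsq : ∀ {X Y : ℕ → Ω → ℝ}, BoundedInM P X rate → BoundedInM P Y rate →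
      BoundedInM P (fun N ω => X N ω * Y N ω) (fun N => rate N * rate N) := fun hX hY =>
    BoundedInM.mul rate_nonneg hX hY
  have hrr : ∀ N, 0 ≤ rate N * rate N := fun N => mul_nonneg (rate_nonneg N) (rate_nonneg N)
  have hcube : ∀ {X Y Y' : ℕ → Ω → ℝ}, BoundedInM P X rate → BoundedInM P Y rate →
      BoundedInM P Y' rate →
      BoundedInM P (fun N ω => X N ω * (Y N ω * Y' N ω)) (fun N => rate N * rate N) :=
    fun hX hY hY' => (BoundedInM.mul rate_nonneg hX (hsq hY hY')).mono fun N =>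
      mul_le_of_le_one_left (hrr N) (rate_le_one N)
  have hmul : ∀ (c : ℝ) {X : ℕ → Ω → ℝ}, BoundedInM P X (fun N => rate N * rate N) →
      BoundedInM P (fun N ω => c * X N ω) (fun N => rate N * rate N) := fun c _ hX =>
    hX.clm_comp (ContinuousLinearMap.mul ℝ ℝ c)
  -- The first three terms are the expanded Newton error for `T < 1`; the last two are the crude
  -- bound `|R| + C G` times `T²`, for `T ≥ 1`.
  refine ⟨fun N ω => (2 * C ^ 2 * (F N ω * G N ω) + 4 * C ^ 3 * l * (G N ω * G N ω)) +
    4 * C ^ 3 * (τ N ω * (G N ω * G N ω)) + |R| * (T N ω * T N ω) +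
    C * (G N ω * (T N ω * T N ω)), ?_, ?_⟩
  · exact BoundedInM.add hrr (BoundedInM.add hrr (BoundedInM.add hrr (BoundedInM.add hrr
      (hmul _ (hsq hF hG)) (hmul _ (hsq hG hG))) (hmul _ (hcube hτ hG hG))) (hmul _ (hsq hT hT)))
      (hmul _ (hcube hG hT hT))
  filter_upwards [hd, hreg, hfar] with ω hω hω' hω'' N θ hθ huniq
  obtain ⟨hτ0, -, hLip⟩ := hω' N
  obtain ⟨hT00, hfarN⟩ := hω'' N
  have hF0 : 0 ≤ F N ω := norm_nonneg _
  have hG0 : 0 ≤ G N ω := norm_nonneg _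
  have hgr : ∀ z ∈ U, gradient (V N ω) z = riesz E (X₁ N ω z) := fun z hz => by
    rw [gradient_eq_riesz, (hω N z hz).1.fderiv]
  rw [hgr θs hθU]
  have hJ : ‖(H.symm : E →L[ℝ] E)‖ ≤ C := by simp [C]
  by_cases hlt : T N ω < 1
  · have k1 : 0 ≤ 4 * C * F N ω := by positivity
    have k2 : 0 ≤ 4 * C / ε * G N ω := by positivity
    have k3 : 4 * C * F N ω + τ N ω + 4 * C / ε * G N ω + T₀ N ω < 1 := hlt
    obtain ⟨z, hz, hz0, hzu, hzn⟩ := exists_unique_zero_of_hasFDerivAt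
      (f := fun θ => riesz E (X₁ N ω θ)) (f' := fun θ => D₁ (X₂ N ω θ)) (a := θs) (ε := ε) (C := C)
      (η := F N ω) (L := l + τ N ω) H hε hC hF0 (by positivity) hJ
      (fun x hx => ((riesz E).hasFDerivAt (x := X₁ N ω x)).comp x (hω N x (hεball hx).1).2)
      (fun x hx => by
        have e1 := hLip x (hεball hx).1 θs hθU
        have e2 := norm_add_le (D₁ (X₂ N ω θs) - H) (D₁ (X₂ N ω x) - D₁ (X₂ N ω θs))
        rw [add_comm (D₁ (X₂ N ω θs) - (H : E →L[ℝ] E)), sub_add_sub_cancel] at e2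
        exact e2.trans (add_le_add le_rfl e1))
      (by linarith)
      (by
        refine le_trans ?_ hεC
        gcongr
        linarith)
      (by
        have : 4 * C / ε * G N ω < 1 := by linarith
        rw [div_mul_eq_mul_div, div_lt_one hε] at this
        exact this.le)
    have hzb : z ∈ Metric.ball θs ε := Metric.closedBall_subset_ball (by linarith) hz
    -- The estimator is tied down only if the critical point is unique in all of `D₀`: inside the
    -- ball by the Newton lemma, outside by `hfarN`.
    have hθz : θ = z := by
      refine huniq z (hεball hzb).2 ((hgr z (hεball hzb).1).trans hz0) fun z' hz' hgz' => ?_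
      by_cases hb : z' ∈ Metric.ball θs ε
      · exact hzu z' hb ((hgr z' (hεball hb).1).symm.trans hgz')
      · exact absurd hgz' (hfarN (by linarith) z' ⟨hz', hb⟩)
    rw [hθz]
    refine hzn.trans ?_
    have k4 : 0 ≤ |R| * (T N ω * T N ω) := mul_nonneg (abs_nonneg R) (mul_self_nonneg _)
    have k5 : 0 ≤ C * (G N ω * (T N ω * T N ω)) :=
      mul_nonneg hC.le (mul_nonneg hG0 (mul_self_nonneg _))
    have k6 : 2 * C ^ 2 * ‖riesz E (X₁ N ω θs)‖ *
        (F N ω + 2 * (l + τ N ω) * C * ‖riesz E (X₁ N ω θs)‖) =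
        2 * C ^ 2 * (F N ω * G N ω) + 4 * C ^ 3 * l * (G N ω * G N ω) +
          4 * C ^ 3 * (τ N ω * (G N ω * G N ω)) := by
      simp only [G]
      ring
    linarith
  · have hT1 : 1 ≤ T N ω * T N ω := by
      have := not_lt.1 hlt
      nlinarith
    have hθR : ‖θ - θs‖ ≤ |R| := by
      have := hR hθ
      rw [Metric.mem_closedBall, dist_eq_norm] at this
      exact this.trans (le_abs_self R)
    have hn : ‖θ - θs + H.symm (riesz E (X₁ N ω θs))‖ ≤ |R| + C * G N ω :=
      (norm_add_le _ _).trans (add_le_add hθR ((H.symm : E →L[ℝ] E).le_of_opNorm_le hJ _))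
    have k0 : 0 ≤ (2 * C ^ 2 * (F N ω * G N ω) + 4 * C ^ 3 * l * (G N ω * G N ω)) +
      4 * C ^ 3 * (τ N ω * (G N ω * G N ω)) := by positivity
    have k1 : |R| ≤ |R| * (T N ω * T N ω) := le_mul_of_one_le_right (abs_nonneg R) hT1
    have k2 : C * G N ω ≤ C * (G N ω * (T N ω * T N ω)) := by
      gcongr
      exact le_mul_of_one_le_right hG0 hT1
    linarith

end ECF

theorem theorem1 {Ω : Type*} [MeasurableSpace Ω] (P : Measure Ω) [IsProbabilityMeasure P]
    {p r M : ℕ}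
    -- parameter domains and true parameter
    (D D₀ : Set (EuclideanSpace ℝ (Fin p))) (θs : EuclideanSpace ℝ (Fin p))
    (hD : IsOpen D) (hD₀ : IsCompact D₀) (hD₀D : D₀ ⊆ D) (hθs : θs ∈ interior D₀)
    -- the filter
    (A : EuclideanSpace ℝ (Fin p) → PowerSeries ℝ) (hA : ECF.IsStableC3 A D)
    -- real noise and simulated noise
    (Z Z' : ℝ → Ω → ℝ) (b c : ℝ) (ν : Measure ℝ)
    (hZ : ECF.IsLevyProcess P Z) (hZ' : ECF.IsLevyProcess P Z')
    (hZν : ECF.HasLevyTriplet P Z b c ν) (hZ'ν : ECF.HasLevyTriplet P Z' b c ν)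
    (hind : IndepFun (fun ω t => Z t ω) (fun ω t => Z' t ω) P)
    (hmom : ∀ q : ℝ, 1 ≤ q → ∫⁻ x in {x : ℝ | 1 ≤ |x|}, ENNReal.ofReal (|x| ^ q) ∂ν < ∞)
    (hmean : ∀ t : ℝ, ∫ ω, Z t ω ∂P = 0) (hmean' : ∀ t : ℝ, ∫ ω, Z' t ω ∂P = 0)
    -- sampling interval, argument vectors, weighting matrix
    (δ : ℝ) (hδ : 0 < δ) (u : Fin M → Fin r → ℝ)
    (K : Matrix (Fin M) (Fin M) ℂ) (hK : K.PosDef)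
    -- the true parameter is the only critical point of the asymptotic cost, nondegenerate
    (hW : ∀ θ ∈ D, gradient (ECF.asympCost P A Z Z' δ u K θs) θ = 0 ↔ θ = θs)
    (hWW : (fderiv ℝ (gradient (ECF.asympCost P A Z Z' δ u K θs)) θs).IsInvertible)
    -- the estimator
    (θhat : ℕ → Ω → EuclideanSpace ℝ (Fin p))
    (hθhat : ECF.IsGradientEstimator P (ECF.cost A Z Z' δ u K θs) D₀ θhat) :
    ECF.IsOM P
      (fun N ω => (θhat N ω - θs) -
        (-(fderiv ℝ (gradient (ECF.asympCost P A Z Z' δ u K θs)) θs).inverse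
          (gradient (ECF.cost A Z Z' δ u K θs N ω) θs)))
      (fun N => (N : ℝ)⁻¹) := by
  have he : ECF.IsNoise P fun n => ECF.increment Z δ n := ECF.isNoise_increment hZ hZν hmom hδ
  have he' : ECF.IsNoise P fun n => ECF.increment Z' δ n := ECF.isNoise_increment hZ' hZ'ν hmom hδ
  have hθsD : θs ∈ D := hD₀D (interior_subset hθs)
  obtain ⟨H, hH⟩ := hWW
  obtain ⟨Y, hY, hbound⟩ := ECF.exists_boundedInM_newton_error (P := P)
    (V := ECF.cost A Z Z' δ u K θs) hD₀ hD₀D hθs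
    (fun θ hθ => ECF.exists_approxField₂_cost hD hA he he' hθsD hθ u K) hW H hH
  intro q hq
  obtain ⟨c', hc', hYb⟩ := hY.bound (ENNReal.ofReal q) (by simpa using hq) ENNReal.ofReal_ne_top
  refine ⟨c', fun N hN => ?_⟩
  have h := hYb N
  rw [ECF.rate_mul_rate hN] at h
  -- The bound is pathwise, so the estimator enters only through its almost sure membership and
  -- defining property.
  refine le_trans (eLpNorm_mono_ae ?_) h
  filter_upwards [hbound, hθhat.mem N, hθhat.eq_of_unique N hN] with ω hω hmem huniq
  rw [← hH, ContinuousLinearMap.inverse_equiv, sub_neg_eq_add]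
  exact (hω N (θhat N ω) hmem huniq).trans (Real.le_norm_self _)
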